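/- **Setting.** For $n\in\mathbb N$ let $\mathcal H_n$ be the Haar distribution on $n$-qubit pure states (the unitarily invariant probability measure on the unit sphere of $(\mathbb C^2)^{\otimes n}$), and let $\mathsf{TD}(\rho,\sigma)=\tfrac12\|\rho-\sigma\|_1$ be the trace distance. Let $m,n,\ell:\mathbb N\to\mathbb N$. In the common Haar state (CHS) model, a *statistical selectively secure $(\lambda,m,n,\ell)$-PRFS generator* is a quantum polynomial-time algorithm $G$ (a polynomial-time Turing machine computes from the classical input $(k,x)$ a circuit over $\{H,T,\mathrm{CNOT}\}$, with ancillas, that is run on the quantum input) such that * for all $\lambda$, $k\in\{0,1\}^\lambda$, $x\in\{0,1\}^{m(\lambda)}$, the map $G_{k,x}$ is a quantum channel on $n(\lambda)$ qubits that maps pure states to pure states; * for every polynomially bounded $t:\mathbb N\to\mathbb N$, every non-uniform computationally unbounded adversary $A=\{A_\lambda\}$ (a two-outcome measurement for each $\lambda$, which may depend on the queries), and all queries $x_1,\dots,x_{\ell(\lambda)}\in\{0,1\}^{m(\lambda)}$ (possibly repeated, chosen for each $\lambda$), there is a negligible function $\mathsf{negl}$ such that for all $\lambda$ $$\Big|\Pr_{k\gets\{0,1\}^\lambda,\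 |\vartheta\rangle\gets\mathcal H_{n(\lambda)}}\Big[A_\lambda\Big(x_1,\dots,x_{\ell(\lambda)},\bigotimes_{i=1}^{\ell(\lambda)}G_{k,x_i}(|\vartheta\rangle\langle\vartheta|)\otimes|\vartheta\rangle\langle\vartheta|^{\otimes t(\lambda)}\Big)=1\Big]-\Pr_{\substack{|\varphi_y\rangle\gets\mathcal H_{n(\lambda)},\ y\in\{0,1\}^{m(\lambda)}\\ |\vartheta\rangle\gets\mathcal H_{n(\lambda)}}}\Big[A_\lambda\Big(x_1,\dots,x_{\ell(\lambda)},\bigotimes_{i=1}^{\ell(\lambda)}|\varphi_{x_i}\rangle\langle\varphi_{x_i}|\otimes|\vartheta\rangle\langle\vartheta|^{\otimes t(\lambda)}\Big)=1\Big]\Big|\le\mathsf{negl}(\lambda).$$ **Construction.** For integers $m\ge1$ and $0\le\lambda'\le n$, a key $K=(k_1^0,\dots,k_m^0,k_1^1,\dots,k_m^1)\in\{0,1\}^{2m\lambda'}$ with blocks $k_i^b\in\{0,1\}^{\lambda'}$, and an input $x\in\{0,1\}^m$, let $G(K,x,\cdot)$ be conjugation by the unitary $Z^{\bigoplus_{i=1}^m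 k_i^{x_i}}\otimes I_{n-\lambda'}$ on $n$ qubits, where $Z^s=Z^{s_1}\otimes\cdots\otimes Z^{s_{\lambda'}}$. **Theorem.** 1. There is an absolute constant $C>0$ such that for all integers $m\ge1$, $0\le\lambda'\le n$, $\ell,t\ge0$ and all $x_1,\dots,x_\ell\in\{0,1\}^m$ (possibly repeated), $$\mathsf{TD}\Big(\mathbb E_{K\gets\{0,1\}^{2m\lambda'},\,|\vartheta\rangle\gets\mathcal H_n}\Big[\bigotimes_{i=1}^{\ell}G(K,x_i,|\vartheta\rangle\langle\vartheta|)\otimes|\vartheta\rangle\langle\vartheta|^{\otimes t}\Big],\ \mathbb E_{\substack{|\varphi_y\rangle\gets\mathcal H_n,\ y\in\{0,1\}^m\\ |\vartheta\rangle\gets\mathcal H_n}}\Big[\bigotimes_{i=1}^{\ell}|\varphi_{x_i}\rangle\langle\varphi_{x_i}|\otimes|\vartheta\rangle\langle\vartheta|^{\otimes t}\Big]\Big)\le C\,\frac{(\ell+t)^{2\ell}}{2^{\lambda'}}.$$ 2. Let $c\in[0,1)$, let $m(\lambda)=\lambda^c$ (rounded down or up to an integer), and let $n(\lambda)\ge\lambda^{1-c}$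 for all $\lambda$. Then there is a generator $G$ with keys of length $\lambda$, which uses one copy of the $n(\lambda)$-qubit common Haar state, such that for every $\varepsilon>0$ and every $\ell:\mathbb N\to\mathbb N$ with $\ell(\lambda)=O\big(\lambda^{1-c}/\log(\lambda)^{1+\varepsilon}\big)$, $G$ is a statistical selectively secure $(\lambda,m,n,\ell)$-PRFS generator in the CHS model. Moreover, $G$ can be taken to be the construction above with $\lambda'=\lfloor\lambda/(2m(\lambda))\rfloor\le n(\lambda)$, the blocks $k_1^0,\dots,k_m^0,k_1^1,\dots,k_m^1$ being the consecutive length-$\lambda'$ blocks of the first $2m(\lambda)\lambda'$ bits of the key. -/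

import Mathlib

open MeasureTheory Filter Asymptotics Computability
open scoped Kronecker BigOperators ComplexOrder

noncomputable section

namespace CHS

/-! ### Pure states, Haar measure, density matrices -/

/-- Bit strings of length `n`; they index the computational basis of `n` qubits. -/
abbrev Bits (n : ℕ) : Type := Fin n → Bool

/-- Operators (square complex matrices) on the space with basis `ι`. -/
abbrev Op (ι : Type) : Type := Matrix ι ι ℂ

/-- Unit vectors of the `n`-qubit space `(ℂ²)^{⊗n}`. -/
abbrev PureState (n : ℕ) : Type := Metric.sphere (0 : EuclideanSpace ℂ (Bits n)) 1

/-- The Haar distribution on `n`-qubit pure states: the normalized surface measure of the unit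
sphere (the unique unitarily invariant Borel probability measure on it). -/
def haar (n : ℕ) : Measure (PureState n) :=
  ((volume : Measure (EuclideanSpace ℂ (Bits n))).toSphere Set.univ)⁻¹ •
    (volume : Measure (EuclideanSpace ℂ (Bits n))).toSphere

instance haar_isProbabilityMeasure (n : ℕ) : IsProbabilityMeasure (haar n) := by
  have : NeZero (volume : Measure (EuclideanSpace ℂ (Bits n))).toSphere :=
    ⟨Measure.toSphere_ne_zero _⟩
  exact isProbabilityMeasureSMul

/-- The rank-one projection `|θ⟩⟨θ|`. -/
def ketbra {n : ℕ} (θ : PureState n) : Op (Bits n) :=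
  Matrix.vecMulVec (fun u => θ.1 u) (fun u => star (θ.1 u))

/-- The tensor product `⨂ᵢ ρᵢ` of a finite family of operators. -/
def tensorPi {ι κ : Type} [Fintype ι] (ρ : ι → Op κ) : Op (ι → κ) :=
  Matrix.of fun u v => ∏ i, ρ i (u i) (v i)

open scoped MatrixOrder in
/-- The trace norm `‖X‖₁ = Tr √(X† X)`. -/
def traceNorm {ι : Type} [Fintype ι] [DecidableEq ι] (X : Op ι) : ℝ :=
  (Matrix.trace (CFC.sqrt (X.conjTranspose * X))).re

/-- The trace distance. -/
def traceDist {ι : Type} [Fintype ι] [DecidableEq ι] (ρ σ : Op ι) : ℝ :=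
  traceNorm (ρ - σ) / 2

/-- Quantum channels: trace preserving linear maps all of whose ampliations `id_d ⊗ Φ` map
positive semidefinite operators to positive semidefinite operators. -/
def IsChannel {ι : Type} [Fintype ι] (Φ : Op ι →ₗ[ℂ] Op ι) : Prop :=
  (∀ ρ, (Φ ρ).trace = ρ.trace) ∧
  ∀ (d : ℕ) (X : Op (Fin d × ι)), X.PosSemidef →
    Matrix.PosSemidef (Matrix.of fun p q : Fin d × ι =>
      Φ (Matrix.of fun i j => X (p.1, i) (q.1, j)) p.2 q.2)

/-- The channel `ρ ↦ U ρ U†`. -/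
def conjBy {ι : Type} [Fintype ι] (U : Op ι) : Op ι →ₗ[ℂ] Op ι where
  toFun ρ := U * ρ * U.conjTranspose
  map_add' ρ σ := by rw [Matrix.mul_add, Matrix.add_mul]
  map_smul' a ρ := by simp

/-! ### Quantum circuits over the gate set {H, T, CNOT} -/

/-- A wire of a circuit: a qubit of the quantum input, or an ancilla qubit. -/
inductive Wire : Type
  | data (i : ℕ)
  | anc (j : ℕ)

inductive Gate : Type
  | H (w : Wire)
  | T (w : Wire)
  | CNOT (control target : Wire)

/-- A circuit: a number of ancilla qubits, initially `|0⟩`, and a list of gates in the order in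
which they are applied. -/
structure Circuit : Type where
  ancillas : ℕ
  gates : List Gate

/-- The qubit that a wire denotes, if there are `n` input qubits and `a` ancillas. -/
def Wire.resolve (n a : ℕ) : Wire → Option (Fin n ⊕ Fin a)
  | .data i => if h : i < n then some (.inl ⟨i, h⟩) else none
  | .anc j => if h : j < a then some (.inr ⟨j, h⟩) else none

/-- All wires exist, and the wires of a two-qubit gate differ. -/
def Gate.WellFormed (n a : ℕ) : Gate → Prop
  | .H w => (w.resolve n a).isSome
  | .T w => (w.resolve n a).isSome
  | .CNOT c t => (c.resolve n a).isSome ∧ (t.resolve n a).isSome ∧ c ≠ t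

def Circuit.WellFormed (n : ℕ) (C : Circuit) : Prop :=
  ∀ g ∈ C.gates, g.WellFormed n C.ancillas

def hadamard : Op Bool := Matrix.of fun a b => (if a && b then -1 else 1) / (Real.sqrt 2 : ℂ)

def tGate : Op Bool :=
  Matrix.diagonal fun b => if b then Complex.exp (Real.pi / 4 * Complex.I) else 1

/-- The one-qubit operator `M` on qubit `w`, the identity on the other qubits. -/
def onQubit {W : Type} [Fintype W] [DecidableEq W] (w : W) (M : Op Bool) : Op (W → Bool) :=
  tensorPi fun v => if v = w then M else 1

/-- The controlled-NOT, `|s⟩ ↦ |s with bit t replaced by s t ⊕ s c⟩`. -/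
def cnotOn {W : Type} [DecidableEq W] [Fintype W] (c t : W) : Op (W → Bool) :=
  Matrix.of fun s s' => if s = Function.update s' t (xor (s' t) (s' c)) then 1 else 0

/-- The unitary of a gate (the identity for gates that are not well-formed). -/
def Gate.op (n a : ℕ) : Gate → Op (Fin n ⊕ Fin a → Bool)
  | .H w => (w.resolve n a).elim 1 fun w => onQubit w hadamard
  | .T w => (w.resolve n a).elim 1 fun w => onQubit w tGate
  | .CNOT c t =>
      (c.resolve n a).elim 1 fun c => (t.resolve n a).elim 1 fun t => cnotOn c t

/-- The unitary of a list of gates, the head of the list being applied first. -/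
def gatesOp (n a : ℕ) (gs : List Gate) : Op (Fin n ⊕ Fin a → Bool) :=
  gs.foldl (fun U g => g.op n a * U) 1

/-- `ρ ⊗ |0…0⟩⟨0…0|`. -/
def withAncillas {n a : ℕ} (ρ : Op (Bits n)) : Op (Fin n ⊕ Fin a → Bool) :=
  Matrix.of fun s s' =>
    if (∀ j, s (.inr j) = false) ∧ (∀ j, s' (.inr j) = false) then
      ρ (fun i => s (.inl i)) (fun i => s' (.inl i)) else 0

/-- The partial trace over the ancillas. -/
def traceAncillas {n a : ℕ} (X : Op (Fin n ⊕ Fin a → Bool)) : Op (Bits n) :=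
  Matrix.of fun u v => ∑ w : Bits a, X (Sum.elim u w) (Sum.elim v w)

/-- Running a circuit on an `n`-qubit input. -/
def Circuit.run (n : ℕ) (C : Circuit) (ρ : Op (Bits n)) : Op (Bits n) :=
  traceAncillas (conjBy (gatesOp n C.ancillas C.gates) (withAncillas ρ))

/-! ### Description of circuits by strings -/

/-- The alphabet for descriptions of circuits. -/
inductive Sym : Type
  | tick | start | data | anc | h | t | cnot

/-- Wire numbers are written in unary. -/
def Wire.encode : Wire → List Sym
  | .data i => List.replicate i .tick ++ [.data]
  | .anc j => List.replicate j .tick ++ [.anc]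

def Gate.encode : Gate → List Sym
  | .H w => w.encode ++ [.h]
  | .T w => w.encode ++ [.t]
  | .CNOT c t => c.encode ++ t.encode ++ [.cnot]

def Circuit.encode (C : Circuit) : List Sym :=
  List.replicate C.ancillas .tick ++ [.start] ++ C.gates.flatMap Gate.encode

/-- State of the left-to-right reader of a description. -/
structure ReadState : Type where
  count : ℕ
  ancillas : ℕ
  wires : List Wire
  gates : List Gate

def ReadState.next (s : ReadState) : Sym → ReadState
  | .tick => { s with count := s.count + 1 }
  | .start => { s with count := 0, ancillas := s.count }
  | .data => { s with count := 0, wires := .data s.count :: s.wires }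
  | .anc => { s with count := 0, wires := .anc s.count :: s.wires }
  | .h => match s.wires with
    | w :: ws => { s with wires := ws, gates := s.gates ++ [.H w] }
    | [] => s
  | .t => match s.wires with
    | w :: ws => { s with wires := ws, gates := s.gates ++ [.T w] }
    | [] => s
  | .cnot => match s.wires with
    | t :: c :: ws => { s with wires := ws, gates := s.gates ++ [.CNOT c t] }
    | _ => s

def Circuit.decode (l : List Sym) : Circuit :=
  let s := l.foldl ReadState.next ⟨0, 0, [], []⟩
  ⟨s.ancillas, s.gates⟩

lemma read_ticks (i c a : ℕ) (ws : List Wire) (gs : List Gate) :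
    (List.replicate i Sym.tick).foldl ReadState.next ⟨c, a, ws, gs⟩ = ⟨c + i, a, ws, gs⟩ := by
  induction i generalizing c with
  | zero => rfl
  | succ i ih =>
    rw [List.replicate_succ, List.foldl_cons]
    exact (ih (c + 1)).trans (by congr 1; omega)

lemma read_wire (w : Wire) (a : ℕ) (ws : List Wire) (gs : List Gate) :
    w.encode.foldl ReadState.next ⟨0, a, ws, gs⟩ = ⟨0, a, w :: ws, gs⟩ := by
  cases w <;> simp [Wire.encode, read_ticks, ReadState.next]

lemma read_gate (g : Gate) (a : ℕ) (gs : List Gate) :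
    g.encode.foldl ReadState.next ⟨0, a, [], gs⟩ = ⟨0, a, [], gs ++ [g]⟩ := by
  cases g <;> simp [Gate.encode, read_wire, ReadState.next]

lemma read_gates (l : List Gate) (a : ℕ) (gs : List Gate) :
    (l.flatMap Gate.encode).foldl ReadState.next ⟨0, a, [], gs⟩ = ⟨0, a, [], gs ++ l⟩ := by
  induction l generalizing gs with
  | nil => simp
  | cons g l ih => simp [List.flatMap_cons, List.foldl_append, read_gate, ih]

lemma Circuit.decode_encode (C : Circuit) : Circuit.decode C.encode = C := by
  have h := read_ticks C.ancillas 0 0 [] []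
  simp [Circuit.decode, Circuit.encode, List.foldl_append, h, ReadState.next, read_gates]

/-- Circuits as strings over the alphabet `Sym`. -/
def circuitEncoding : Encoding Circuit Sym where
  encode := Circuit.encode
  decode l := some (Circuit.decode l)
  decode_encode C := congrArg some C.decode_encode

/-- Pairs of bit strings as strings. -/
def bitsPairEncoding : Encoding (List Bool × List Bool) (Bool ⊕ Bool) :=
  encodingProd (encodingList Bool) (encodingList Bool)

/-! ### Generators in the common Haar state model -/

/-- A generator with keys of length `lam`, inputs of length `m lam`, which acts on one copy of an
`n lam`-qubit common state and outputs `n lam` qubits. -/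
abbrev Generator (m n : ℕ → ℕ) : Type :=
  ∀ lam : ℕ, Bits lam → Bits (m lam) → (Op (Bits (n lam)) →ₗ[ℂ] Op (Bits (n lam)))

/-- Quantum polynomial time: one polynomial-time Turing machine writes down, from the key and the
classical input, a circuit that is then run on the quantum input. -/
def IsQPT {m n : ℕ → ℕ} (G : Generator m n) : Prop :=
  ∃ f : List Bool × List Bool → Circuit,
    Nonempty (Turing.TM2ComputableInPolyTime bitsPairEncoding.encode circuitEncoding.encode f) ∧
    ∀ (lam : ℕ) (k : Bits lam) (x : Bits (m lam)),
      (f (List.ofFn k, List.ofFn x)).WellFormed (n lam) ∧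
      ∀ ρ, G lam k x ρ = (f (List.ofFn k, List.ofFn x)).run (n lam) ρ

/-- `⨂ᵢ Φ_{xᵢ}(|θ⟩⟨θ|) ⊗ |θ⟩⟨θ|^{⊗t}`, where `Φ_x = G_{k,x}`. -/
def realState {m n ℓ : ℕ} (Φ : Bits m → (Op (Bits n) →ₗ[ℂ] Op (Bits n)))
    (x : Fin ℓ → Bits m) (t : ℕ) (θ : PureState n) :
    Op ((Fin ℓ → Bits n) × (Fin t → Bits n)) :=
  tensorPi (fun i => Φ (x i) (ketbra θ)) ⊗ₖ tensorPi (fun _ : Fin t => ketbra θ)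

/-- `⨂ᵢ |φ_{xᵢ}⟩⟨φ_{xᵢ}| ⊗ |θ⟩⟨θ|^{⊗t}`. -/
def idealState {m n ℓ : ℕ} (x : Fin ℓ → Bits m) (t : ℕ)
    (φ : Bits m → PureState n) (θ : PureState n) :
    Op ((Fin ℓ → Bits n) × (Fin t → Bits n)) :=
  tensorPi (fun i => ketbra (φ (x i))) ⊗ₖ tensorPi (fun _ : Fin t => ketbra θ)

/-- Independent Haar states `φ_y` for all `y ∈ {0,1}^m`, and a further one `θ`. -/
def haarFamily (m n : ℕ) : Measure ((Bits m → PureState n) × PureState n) :=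
  (Measure.pi fun _ : Bits m => haar n).prod (haar n)

/-- The accepting element `0 ≤ M ≤ 1` of a two-outcome measurement. -/
def IsEffect {ι : Type} [Fintype ι] [DecidableEq ι] (M : Op ι) : Prop :=
  M.PosSemidef ∧ (1 - M).PosSemidef

/-- The probability that the measurement with accepting element `M` accepts `ρ`. -/
def acceptProb {ι : Type} [Fintype ι] (M ρ : Op ι) : ℝ := (M * ρ).trace.re

/-- Acceptance probability for outputs of the generator, under a uniform key and a common Haar
state. -/
def realProb {m n : ℕ → ℕ} (G : Generator m n) (lam : ℕ) {ℓ : ℕ}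
    (x : Fin ℓ → Bits (m lam)) (t : ℕ)
    (M : Op ((Fin ℓ → Bits (n lam)) × (Fin t → Bits (n lam)))) : ℝ :=
  𝔼 k : Bits lam, ∫ θ, acceptProb M (realState (G lam k) x t θ) ∂haar (n lam)

/-- Acceptance probability for independent Haar states. -/
def idealProb {m n ℓ : ℕ} (x : Fin ℓ → Bits m) (t : ℕ)
    (M : Op ((Fin ℓ → Bits n) × (Fin t → Bits n))) : ℝ :=
  ∫ p, acceptProb M (idealState x t p.1 p.2) ∂haarFamily m n

/-- `t` is bounded by a polynomial. -/
def PolyBounded (t : ℕ → ℕ) : Prop := ∃ p : Polynomial ℕ, ∀ lam, t lam ≤ p.eval lam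

def Negligible (f : ℕ → ℝ) : Prop := SuperpolynomialDecay atTop (fun lam : ℕ => (lam : ℝ)) f

/-- Every `G_{k,x}` is a quantum channel that maps pure states to pure states. -/
def StateGeneration {m n : ℕ → ℕ} (G : Generator m n) : Prop :=
  ∀ (lam : ℕ) (k : Bits lam) (x : Bits (m lam)),
    IsChannel (G lam k x) ∧ ∀ θ : PureState (n lam), ∃ θ' : PureState (n lam),
      G lam k x (ketbra θ) = ketbra θ'

/-- `ℓ`-query selective security. An unbounded non-uniform adversary is an arbitrary measurement
for each `lam`, which may depend on the classical queries. -/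
def SelectivelySecure {m n : ℕ → ℕ} (ℓ : ℕ → ℕ) (G : Generator m n) : Prop :=
  ∀ t : ℕ → ℕ, PolyBounded t →
  ∀ A : ∀ lam : ℕ, (Fin (ℓ lam) → Bits (m lam)) →
      Op ((Fin (ℓ lam) → Bits (n lam)) × (Fin (t lam) → Bits (n lam))),
    (∀ lam x, IsEffect (A lam x)) →
  ∀ x : ∀ lam : ℕ, Fin (ℓ lam) → Bits (m lam),
  ∃ negl : ℕ → ℝ, Negligible negl ∧ ∀ lam,
    |realProb G lam (x lam) (t lam) (A lam (x lam)) -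
      idealProb (x lam) (t lam) (A lam (x lam))| ≤ negl lam

/-- Statistical selectively secure `(lam, m, n, ℓ)`-PRFS generators in the common Haar state
model. -/
structure IsStatisticalPRFS (m n ℓ : ℕ → ℕ) (G : Generator m n) : Prop where
  qpt : IsQPT G
  stateGeneration : StateGeneration G
  selectivelySecure : SelectivelySecure ℓ G

/-! ### The GGM-style generator -/

/-- A key `(k_1^0,…,k_m^0,k_1^1,…,k_m^1)` of `2m` blocks of length `b`; `K c i` is `k_i^c`. -/
abbrev BlockKey (m b : ℕ) : Type := Bool → Fin m → Bits b

/-- `⊕ᵢ k_i^{x_i}`. -/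
def ggmMask {m b : ℕ} (K : BlockKey m b) (x : Bits m) : Bits b :=
  fun j => decide (Odd (Finset.univ.filter fun i : Fin m => K (x i) i j = true).card)

/-- The Pauli matrix `Z`. -/
def pauliZ : Op Bool := Matrix.diagonal fun b => if b then -1 else 1

/-- `Z^s ⊗ I_{n-b}` on `n` qubits, where `Z^s = Z^{s_1} ⊗ ⋯ ⊗ Z^{s_b}`, for `b ≤ n`. -/
def zPrefix {b : ℕ} (n : ℕ) (s : Bits b) : Op (Bits n) :=
  tensorPi fun i : Fin n => if ∃ h : i.val < b, s ⟨i.val, h⟩ = true then pauliZ else 1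

/-- `G(K, x, ·)`, conjugation by `Z^{⊕ᵢ k_i^{x_i}} ⊗ I`. -/
def ggmChannel {m b : ℕ} (n : ℕ) (K : BlockKey m b) (x : Bits m) :
    Op (Bits n) →ₗ[ℂ] Op (Bits n) :=
  conjBy (zPrefix n (ggmMask K x))

lemma block_index_lt {lam m : ℕ} (c : Bool) (i : Fin m) (j : Fin (lam / (2 * m))) :
    (c.toNat * m + i.val) * (lam / (2 * m)) + j.val < lam := by
  have hc : c.toNat ≤ 1 := Bool.toNat_le c
  have h1 : c.toNat * m + i.val + 1 ≤ 2 * m := by nlinarith [i.isLt]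
  have h2 := Nat.mul_le_mul_right (lam / (2 * m)) h1
  have h3 : 2 * m * (lam / (2 * m)) ≤ lam := Nat.mul_div_le lam (2 * m)
  nlinarith [j.isLt]

/-- The first `2m⌊lam/(2m)⌋` bits of a key of length `lam`, cut into `2m` consecutive blocks
`k_1^0,…,k_m^0,k_1^1,…,k_m^1` of length `⌊lam/(2m)⌋`. -/
def keyBlocks {lam : ℕ} (m : ℕ) (k : Bits lam) : BlockKey m (lam / (2 * m)) :=
  fun c i j => k ⟨(c.toNat * m + i.val) * (lam / (2 * m)) + j.val, block_index_lt c i j⟩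

/-- `𝔼_{K,θ} [⨂ᵢ G(K, xᵢ, |θ⟩) ⊗ |θ⟩⟨θ|^{⊗t}]` for a uniform key with blocks of length `b`. -/
def ggmRealAverage {m ℓ : ℕ} (b n : ℕ) (x : Fin ℓ → Bits m) (t : ℕ) :
    Op ((Fin ℓ → Bits n) × (Fin t → Bits n)) :=
  Matrix.of fun u v =>
    𝔼 K : BlockKey m b, ∫ θ, realState (ggmChannel n K) x t θ u v ∂haar n

/-- `𝔼_{φ,θ} [⨂ᵢ |φ_{xᵢ}⟩⟨φ_{xᵢ}| ⊗ |θ⟩⟨θ|^{⊗t}]`. -/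
def idealAverage {m ℓ : ℕ} (n : ℕ) (x : Fin ℓ → Bits m) (t : ℕ) :
    Op ((Fin ℓ → Bits n) × (Fin t → Bits n)) :=
  Matrix.of fun u v => ∫ p, idealState x t p.1 p.2 u v ∂haarFamily m n

end CHS

end

noncomputable section

namespace CHS

/-! Work with matrix entries in the computational basis, indexed by `u : J → Bits n`, where `J = Fin
ℓ ⊕ Fin t` lists the tensor factors. Invariance under diagonal unitaries kills the entry `(u, v)` of
an averaged product of Haar states unless `v` is a permutation of `u` that respects the labels of
the states (`IsEnsemble.kernel_eq_zero`); otherwise it equals the diagonal entry at `u`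
(`kernel_eq_of_perm`). In the ideal state the label of a factor is its query, or `none` for a copy
of the common state. In the real state one Haar state fills all factors, so every permutation is
admitted, but the average over keys contributes the factor `signAverage`, which vanishes as soon as
flipping one key bit changes the relative sign (`signAverage_eq_zero`).

Call `u` good if it is injective and every permutation of it that passes these key tests also arises
from a label-preserving one. On good rows both states are multiples of one and the same 0/1 matrix;
both have trace one, so their difference is controlled by the diagonal weight on bad vectors
(`exists_posSemidef_sub`). A bad vector satisfies a parity condition: over some set of at least two
factors, the first `b` bits add up to zero (`exists_parityEvent_of_not_good`). One set per pair of
factors and one per map from queries to factors suffice, which makes `(ℓ+t)^2 + (ℓ+t)^ℓ` sets,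
independently of `m`. Each condition has probability at most `3/2^b` (`IsEnsemble.parityEvent_le`):
a Fourier expansion reduces it to second moments of one Haar state, and these follow from
`moment_le_diag` and `moment_diag_le`.

For the asymptotic statement the block length is of order `λ^(1-c)` while `ℓ log λ = o(λ^(1-c))`, so
`(ℓ+t)^(2ℓ)/2^b` decays like `exp(-δ λ^(1-c))`. Four `T` gates make a `Z`, and an explicit stack
machine adds up the selected key blocks and writes these gates (`Machine.run_machine`). -/

/-! ### Invariance of the Haar distribution -/

/-- The action of a linear isometry on pure states. -/
def PureState.apply {n : ℕ} (U : EuclideanSpace ℂ (Bits n) ≃ₗᵢ[ℂ] EuclideanSpace ℂ (Bits n))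
    (θ : PureState n) : PureState n :=
  ⟨U θ.1, by simp⟩

lemma PureState.continuous_apply {n : ℕ}
    (U : EuclideanSpace ℂ (Bits n) ≃ₗᵢ[ℂ] EuclideanSpace ℂ (Bits n)) :
    Continuous (PureState.apply U) :=
  Continuous.subtype_mk (U.continuous.comp continuous_subtype_val) _

lemma measurePreserving_volume {n : ℕ}
    (U : EuclideanSpace ℂ (Bits n) ≃ₗᵢ[ℂ] EuclideanSpace ℂ (Bits n)) :
    MeasurePreserving U := by
  let V : EuclideanSpace ℂ (Bits n) ≃ₗᵢ[ℝ] EuclideanSpace ℂ (Bits n) :=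
    { U.toLinearEquiv.restrictScalars ℝ with norm_map' := U.norm_map }
  exact V.measurePreserving

/-- Surface measure of a set is a multiple of the volume of the cone over it; a linear isometry
preserves volume and carries cones to cones. -/
lemma measurePreserving_haar {n : ℕ}
    (U : EuclideanSpace ℂ (Bits n) ≃ₗᵢ[ℂ] EuclideanSpace ℂ (Bits n)) :
    MeasurePreserving (PureState.apply U) (haar n) (haar n) := by
  suffices h : MeasurePreserving (PureState.apply U)
      (volume : Measure (EuclideanSpace ℂ (Bits n))).toSphere
      (volume : Measure (EuclideanSpace ℂ (Bits n))).toSphere by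
    refine ⟨h.measurable, ?_⟩
    rw [haar, Measure.map_smul, h.map_eq]
  have hm := (PureState.continuous_apply U).measurable
  refine ⟨hm, Measure.ext fun s hs => ?_⟩
  rw [Measure.map_apply hm hs, Measure.toSphere_apply' _ (hm hs), Measure.toSphere_apply' _ hs]
  congr 1
  conv_rhs =>
    rw [← (measurePreserving_volume U).measure_preimage_emb U.toHomeomorph.measurableEmbedding]
  congr 1
  ext v
  simp only [Set.mem_smul, Set.mem_image, Set.mem_preimage]
  constructor
  · rintro ⟨r, hr, _, ⟨θ, hθ, rfl⟩, rfl⟩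
    refine ⟨r, hr, _, ⟨_, hθ, rfl⟩, ?_⟩
    show r • U θ.1 = U (r • θ.1)
    rw [← Complex.coe_smul, ← Complex.coe_smul, map_smul]
  · rintro ⟨r, hr, _, ⟨θ, hθ, rfl⟩, h⟩
    refine ⟨r, hr, _, ⟨PureState.apply U.symm θ, ?_, rfl⟩, ?_⟩
    · have : PureState.apply U (PureState.apply U.symm θ) = θ :=
        Subtype.ext (U.apply_symm_apply _)
      simpa [this] using hθ
    · apply U.injective
      rw [← h]
      show U (r • U.symm θ.1) = r • θ.1
      rw [← Complex.coe_smul, ← Complex.coe_smul, map_smul, U.apply_symm_apply]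

lemma integral_haar_apply {n : ℕ} {E : Type*} [NormedAddCommGroup E] [NormedSpace ℝ E]
    (U : EuclideanSpace ℂ (Bits n) ≃ₗᵢ[ℂ] EuclideanSpace ℂ (Bits n)) (f : PureState n → E)
    (hf : Continuous f) :
    ∫ θ, f (PureState.apply U θ) ∂haar n = ∫ θ, f θ ∂haar n := by
  have h := measurePreserving_haar U
  conv_rhs => rw [← h.map_eq]
  rw [integral_map h.measurable.aemeasurable]
  exact hf.aestronglyMeasurable

/-- The diagonal unitary with the given phases. -/
def phaseIsometry {n : ℕ} (c : Bits n → Circle) :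
    EuclideanSpace ℂ (Bits n) ≃ₗᵢ[ℂ] EuclideanSpace ℂ (Bits n) :=
  LinearIsometryEquiv.piLpCongrRight 2 fun z =>
    { LinearEquiv.smulOfNeZero ℂ ℂ (c z : ℂ) (Circle.coe_ne_zero _) with
      norm_map' := fun v => by
        show ‖(c z : ℂ) * v‖ = ‖v‖
        simp [Circle.norm_coe] }

@[simp]
lemma apply_phaseIsometry {n : ℕ} (c : Bits n → Circle) (θ : PureState n) (z : Bits n) :
    (PureState.apply (phaseIsometry c) θ).1 z = c z * θ.1 z := rfl

/-- The unitary that permutes the computational basis. -/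
def permIsometry {n : ℕ} (σ : Equiv.Perm (Bits n)) :
    EuclideanSpace ℂ (Bits n) ≃ₗᵢ[ℂ] EuclideanSpace ℂ (Bits n) :=
  LinearIsometryEquiv.piLpCongrLeft 2 ℂ ℂ σ

@[simp]
lemma apply_permIsometry {n : ℕ} (σ : Equiv.Perm (Bits n)) (θ : PureState n) (z : Bits n) :
    (PureState.apply (permIsometry σ) θ).1 z = θ.1 (σ.symm z) := rfl

/-- The reflection in the line of `e_a + 2 e_b`. -/
def mixIsometry {n : ℕ} (a b : Bits n) :
    EuclideanSpace ℂ (Bits n) ≃ₗᵢ[ℂ] EuclideanSpace ℂ (Bits n) :=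
  (Submodule.span ℂ {EuclideanSpace.single a (1 : ℂ) + EuclideanSpace.single b (2 : ℂ)}).reflection

/-- Equal weights on `e_a` and `e_b` would merely swap the two coordinates. The weights 1 and 2
genuinely mix them, and the squared norm 5 keeps the coefficients rational. -/
lemma apply_mixIsometry {n : ℕ} {a b : Bits n} (hab : a ≠ b) (θ : PureState n) :
    (PureState.apply (mixIsometry a b) θ).1 a = (4 * θ.1 b - 3 * θ.1 a) / 5 := by
  have hn : ‖(EuclideanSpace.single a (1 : ℂ) + EuclideanSpace.single b (2 : ℂ) :
      EuclideanSpace ℂ (Bits n))‖ ^ 2 = 5 := by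
    rw [@norm_add_sq ℂ]
    simp [EuclideanSpace.inner_single_left, hab]
    norm_num
  have hn' : ((‖(EuclideanSpace.single a (1 : ℂ) + EuclideanSpace.single b (2 : ℂ) :
      EuclideanSpace ℂ (Bits n))‖ : ℂ)) ^ 2 = 5 := by exact_mod_cast hn
  show (mixIsometry a b θ.1) a = _
  rw [mixIsometry, Submodule.reflection_singleton_apply]
  rw [show ((RCLike.ofReal ‖(EuclideanSpace.single a (1 : ℂ) + EuclideanSpace.single b (2 : ℂ) :
      EuclideanSpace ℂ (Bits n))‖ : ℂ)) ^ 2 = 5 from hn']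
  simp [inner_add_left, EuclideanSpace.inner_single_left, hab, map_ofNat]
  ring

/-! ### Second moments of the Haar distribution -/

/-- The probability of outcome `z` when `θ` is measured in the computational basis. -/
def PureState.prob {n : ℕ} (θ : PureState n) (z : Bits n) : ℝ := ‖θ.1 z‖ ^ 2

lemma PureState.prob_nonneg {n : ℕ} (θ : PureState n) (z : Bits n) : 0 ≤ θ.prob z :=
  sq_nonneg _

lemma PureState.sum_prob {n : ℕ} (θ : PureState n) : ∑ z, θ.prob z = 1 := by
  have h := EuclideanSpace.norm_sq_eq θ.1
  rw [mem_sphere_zero_iff_norm.1 θ.2] at h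
  simpa [PureState.prob] using h.symm

@[fun_prop]
lemma continuous_amplitude {n : ℕ} (z : Bits n) : Continuous fun θ : PureState n => θ.1 z := by
  fun_prop

@[fun_prop]
lemma continuous_prob {n : ℕ} (z : Bits n) : Continuous fun θ : PureState n => θ.prob z := by
  unfold PureState.prob
  fun_prop

lemma integrable_haar {n : ℕ} {E : Type*} [NormedAddCommGroup E] {f : PureState n → E}
    (hf : Continuous f) : Integrable f (haar n) :=
  hf.integrable_of_hasCompactSupport (HasCompactSupport.of_compactSpace f)

/-- The second moments `𝔼 |θ_a|² |θ_b|²`. -/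
def moment {n : ℕ} (a b : Bits n) : ℝ := ∫ θ, θ.prob a * θ.prob b ∂haar n

lemma moment_perm {n : ℕ} (σ : Equiv.Perm (Bits n)) (a b : Bits n) :
    moment (σ a) (σ b) = moment a b := by
  rw [moment, ← integral_haar_apply (permIsometry σ) _ (by fun_prop)]
  simp [moment, PureState.prob]

lemma moment_diag_eq {n : ℕ} (a b : Bits n) : moment b b = moment a a := by
  have h := moment_perm (Equiv.swap a b) a a
  rwa [Equiv.swap_apply_left] at h

lemma moment_offdiag_eq {n : ℕ} {a b a' b' : Bits n} (h : a ≠ b) (h' : a' ≠ b') :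
    moment a' b' = moment a b := by
  obtain ⟨σ, hσ⟩ := Equiv.Perm.exists_extending_pair ![a, b] ![a', b']
    (by intro i j; fin_cases i <;> fin_cases j <;> simp [h, h.symm])
    (by intro i j; fin_cases i <;> fin_cases j <;> simp [h', h'.symm])
  have h0 := hσ 0
  have h1 := hσ 1
  simp only [Matrix.cons_val_zero, Matrix.cons_val_one] at h0 h1
  rw [← h0, ← h1, moment_perm]

lemma moment_le_diag {n : ℕ} (a b : Bits n) : moment a b ≤ moment a a := by
  have h : moment a b ≤ ∫ θ, (θ.prob a * θ.prob a + θ.prob b * θ.prob b) / 2 ∂haar n := by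
    refine integral_mono (integrable_haar (by fun_prop)) (integrable_haar (by fun_prop))
      fun θ => ?_
    show θ.prob a * θ.prob b ≤ (θ.prob a * θ.prob a + θ.prob b * θ.prob b) / 2
    nlinarith [sq_nonneg (θ.prob a - θ.prob b)]
  rw [integral_div, integral_add (integrable_haar (by fun_prop)) (integrable_haar (by fun_prop))]
    at h
  change _ ≤ (moment a a + moment b b) / 2 at h
  rw [moment_diag_eq a b] at h
  linarith

/-- Adding the two signs of `y` cancels the terms odd in `y`. The surviving term `Re(x ȳ)²` is
bounded by `|x|²|y|²`; the square given to `nlinarith` is the discarded `Im(x ȳ)²`. -/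
lemma mixed_fourth_power_le (x y : ℂ) :
    (‖(4 * y - 3 * x) / 5‖ ^ 2) ^ 2 + (‖(4 * (-y) - 3 * x) / 5‖ ^ 2) ^ 2 ≤
      2 / 625 * (81 * (‖x‖ ^ 2 * ‖x‖ ^ 2) + 256 * (‖y‖ ^ 2 * ‖y‖ ^ 2)
        + 864 * (‖x‖ ^ 2 * ‖y‖ ^ 2)) := by
  have h5 : ∀ z : ℂ, ‖z / 5‖ ^ 2 = (z.re * z.re + z.im * z.im) / 25 := fun z => by
    rw [norm_div, div_pow, ← Complex.normSq_eq_norm_sq, Complex.normSq_apply]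
    norm_num
  rw [h5, h5]
  simp only [← Complex.normSq_eq_norm_sq, Complex.normSq_apply, Complex.sub_re, Complex.sub_im,
    Complex.mul_re, Complex.mul_im, Complex.neg_re, Complex.neg_im, Complex.re_ofNat,
    Complex.im_ofNat]
  nlinarith [sq_nonneg (x.re * y.im - x.im * y.re)]

/-- With `α`, `β` the diagonal and off-diagonal moments, invariance under mixing, with and without a
sign flip at `b`, gives `2α ≤ (2/625)(337α + 864β)`, that is, `α ≤ 3β`. -/
lemma moment_diag_le {n : ℕ} {a b : Bits n} (hab : a ≠ b) : moment a a ≤ 3 * moment a b := by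
  let f : PureState n → ℝ := fun θ => θ.prob a * θ.prob a
  have hf : Continuous f := by fun_prop
  let c : Bits n → Circle := fun z => if z = b then -1 else 1
  let g : PureState n → ℝ := fun θ => f (PureState.apply (mixIsometry a b) θ)
  have hg : Continuous g := hf.comp (PureState.continuous_apply _)
  have h1 : ∫ θ, g θ ∂haar n = moment a a := integral_haar_apply _ f hf
  have h2 : ∫ θ, g (PureState.apply (phaseIsometry c) θ) ∂haar n = moment a a :=
    (integral_haar_apply _ g hg).trans h1
  have h3 : ∫ θ, (g θ + g (PureState.apply (phaseIsometry c) θ)) ∂haar n ≤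
      ∫ θ : PureState n, 2 / 625 * (81 * (θ.prob a * θ.prob a) + 256 * (θ.prob b * θ.prob b)
        + 864 * (θ.prob a * θ.prob b)) ∂haar n := by
    refine integral_mono (integrable_haar (hg.add (hg.comp (PureState.continuous_apply _))))
      (integrable_haar (by fun_prop)) fun θ => ?_
    have h := mixed_fourth_power_le (θ.1 a) (θ.1 b)
    simpa [g, f, PureState.prob, apply_mixIsometry hab, c, hab, ← pow_two] using h
  have hg' : Continuous fun θ => g (PureState.apply (phaseIsometry c) θ) :=
    hg.comp (PureState.continuous_apply _)
  rw [integral_add (integrable_haar hg) (integrable_haar hg'), h1, h2,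
    integral_const_mul, integral_add (integrable_haar (by fun_prop))
    (integrable_haar (by fun_prop)), integral_add (integrable_haar (by fun_prop))
    (integrable_haar (by fun_prop)), integral_const_mul, integral_const_mul,
    integral_const_mul] at h3
  change _ ≤ 2 / 625 * (81 * moment a a + 256 * moment b b + 864 * moment a b) at h3
  rw [moment_diag_eq a b] at h3
  linarith

lemma sum_moment (n : ℕ) : ∑ a : Bits n, ∑ b : Bits n, moment a b = 1 := by
  have h : ∀ a b : Bits n, Integrable (fun θ : PureState n => θ.prob a * θ.prob b) (haar n) :=
    fun a b => integrable_haar (by fun_prop)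
  simp only [moment]
  simp_rw [← integral_finsetSum _ fun b _ => h _ b]
  rw [← integral_finsetSum _ fun a _ => integrable_finsetSum _ fun b _ => h a b]
  have h1 : ∀ θ : PureState n, ∑ a, ∑ b, θ.prob a * θ.prob b = 1 := fun θ => by
    rw [← Finset.sum_mul_sum, θ.sum_prob, one_mul]
  simp [h1]

/-- The variance of a linear statistic with vanishing total weight. -/
lemma integral_weighted_prob_sq_le {n : ℕ} (w : Bits n → ℝ) (hw : ∀ z, w z ^ 2 = 1)
    (h0 : ∑ z, w z = 0) :
    ∫ θ : PureState n, (∑ z, w z * θ.prob z) ^ 2 ∂haar n ≤ 2 / 2 ^ n := by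
  -- A single weight of square one cannot sum to zero, so there are two basis vectors.
  obtain ⟨a, b, hab⟩ : ∃ a b : Bits n, a ≠ b := by
    by_contra! h
    have : Subsingleton (Bits n) := ⟨h⟩
    rw [Fintype.sum_subsingleton _ (fun _ => false)] at h0
    simpa [h0] using hw fun _ => false
  set α := moment a a
  set β := moment a b
  have hM : ∀ z z' : Bits n, moment z z' = β + if z = z' then α - β else 0 := by
    intro z z'
    split_ifs with h
    · subst h
      simp [α, moment_diag_eq a z]
    · simp [β, moment_offdiag_eq hab h]
  have hexp : ∫ θ : PureState n, (∑ z, w z * θ.prob z) ^ 2 ∂haar n =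
      ∑ z, ∑ z', w z * w z' * moment z z' := by
    have h : ∀ z z' : Bits n,
        Integrable (fun θ : PureState n => w z * w z' * (θ.prob z * θ.prob z')) (haar n) :=
      fun a b => integrable_haar (by fun_prop)
    simp only [moment, ← integral_const_mul]
    simp_rw [← integral_finsetSum _ fun b _ => h _ b]
    rw [← integral_finsetSum _ fun a _ => integrable_finsetSum _ fun b _ => h a b]
    congr 1
    ext θ
    rw [pow_two, Finset.sum_mul_sum]
    exact Finset.sum_congr rfl fun _ _ => Finset.sum_congr rfl fun _ _ => by ring
  have hcard : (Fintype.card (Bits n) : ℝ) = 2 ^ n := by simp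
  -- The constant part `β` is multiplied by the squared total weight, which is zero; only the
  -- diagonal excess `α - β` remains.
  have hval : ∑ z, ∑ z', w z * w z' * moment z z' = 2 ^ n * (α - β) := by
    simp only [hM, mul_add, Finset.sum_add_distrib, mul_ite, mul_zero, Finset.sum_ite_eq,
      Finset.mem_univ, if_true, ← pow_two, hw]
    rw [← hcard]
    simp [← Finset.sum_mul, ← Finset.mul_sum, h0]
    ring
  have hone : (2 ^ n : ℝ) * (2 ^ n) * β + 2 ^ n * (α - β) = 1 := by
    rw [← sum_moment n, ← hcard]
    simp only [hM, Finset.sum_add_distrib, Finset.sum_ite_eq, Finset.mem_univ, if_true]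
    simp
    ring
  have h1 : β ≤ α := moment_le_diag a b
  have h2 : α ≤ 3 * β := moment_diag_le hab
  rw [hexp, hval, le_div_iff₀ (by positivity)]
  have hN : (0 : ℝ) < 2 ^ n := by positivity
  -- Normalization together with `β ≤ α` forces `β ≤ 4^(-n)`, and then `α - β ≤ 2β`.
  have h3 : (2 ^ n : ℝ) * (2 ^ n) * β ≤ 1 := by nlinarith
  nlinarith [mul_pos hN hN]

/-! ### Characters of the group of bit strings -/

/-- The sign `(-1)^a`. -/
def sgn (a : Bool) : ℝ := if a then -1 else 1

@[simp] lemma sgn_true : sgn true = -1 := rfl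

@[simp] lemma sgn_false : sgn false = 1 := rfl

lemma sgn_mul_self (a : Bool) : sgn a * sgn a = 1 := by cases a <;> simp

/-- The character `z ↦ (-1)^{s·z}`, where `s` is matched with the first bits of `z`. -/
def chi {b n : ℕ} (h : b ≤ n) (s : Bits b) (z : Bits n) : ℝ :=
  ∏ q : Fin b, if s q then sgn (z (Fin.castLE h q)) else 1

lemma chi_mul_self {b n : ℕ} (h : b ≤ n) (s : Bits b) (z : Bits n) :
    chi h s z * chi h s z = 1 := by
  rw [chi, ← Finset.prod_mul_distrib]
  refine Finset.prod_eq_one fun q _ => ?_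
  split_ifs <;> simp [sgn_mul_self]

lemma chi_zero {b n : ℕ} (h : b ≤ n) (z : Bits n) : chi h (fun _ => false) z = 1 := by
  simp [chi]

lemma chi_eq_prod {b n : ℕ} (h : b ≤ n) (s : Bits b) (z : Bits n) :
    chi h s z =
      ∏ i : Fin n, if ∃ h : i.val < b, s ⟨i.val, h⟩ = true then sgn (z i) else 1 := by
  obtain ⟨d, rfl⟩ := Nat.exists_eq_add_of_le h
  rw [Fin.prod_univ_add]
  have h2 : ∏ i : Fin d, (if ∃ h : (Fin.natAdd b i).val < b, s ⟨(Fin.natAdd b i).val, h⟩ = true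
      then sgn (z (Fin.natAdd b i)) else 1) = 1 :=
    Finset.prod_eq_one fun i _ => by simp
  rw [h2, mul_one, chi]
  refine Finset.prod_congr rfl fun q _ => ?_
  simp only [Fin.val_castAdd, Fin.is_lt, exists_true_left]
  rfl

/-- The sum factors over the qubits, and the factor at a set bit of `s` is `1 - 1`. -/
lemma sum_chi {b n : ℕ} (h : b ≤ n) {s : Bits b} (hs : s ≠ fun _ => false) :
    ∑ z, chi h s z = 0 := by
  obtain ⟨q, hq⟩ := Function.ne_iff.1 hs
  simp only [chi_eq_prod]
  rw [← Fintype.piFinset_univ, ← Finset.prod_univ_sum (fun _ : Fin n => Finset.univ)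
    fun i a => if ∃ h : i.val < b, s ⟨i.val, h⟩ = true then sgn a else 1]
  refine Finset.prod_eq_zero (Finset.mem_univ (Fin.castLE h q)) ?_
  have : ∃ h' : (Fin.castLE h q).val < b, s ⟨(Fin.castLE h q).val, h'⟩ = true :=
    ⟨q.2, by simpa using hq⟩
  simp only [this, if_true]
  simp

/-- Conjugation by `Z^s ⊗ I` multiplies matrix entries by signs. -/
lemma zPrefix_eq_diagonal {b n : ℕ} (h : b ≤ n) (s : Bits b) :
    zPrefix n s = Matrix.diagonal fun z => (chi h s z : ℂ) := by
  ext u v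
  rw [zPrefix, tensorPi, Matrix.of_apply, Matrix.diagonal_apply]
  split_ifs with huv
  · subst huv
    rw [chi_eq_prod]
    push_cast
    refine Finset.prod_congr rfl fun i _ => ?_
    split_ifs <;> cases hu : u i <;> simp [pauliZ]
  · obtain ⟨i, hi⟩ := Function.ne_iff.1 huv
    refine Finset.prod_eq_zero (Finset.mem_univ i) ?_
    split_ifs <;> simp [pauliZ, hi]

/-! ### The probability of parity events -/

/-- The first `b` bits of the strings `u j`, `j ∈ D`, add up to zero. -/
def ParityEvent {J : Type} {b n : ℕ} (h : b ≤ n) (D : Finset J) (u : J → Bits n) : Prop :=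
  ∀ q : Fin b, ∏ j ∈ D, sgn (u j (Fin.castLE h q)) = 1

/-- The Fourier transform of the output distribution. -/
def PureState.fourier {b n : ℕ} (h : b ≤ n) (s : Bits b) (θ : PureState n) : ℝ :=
  ∑ z, chi h s z * θ.prob z

@[fun_prop]
lemma continuous_fourier {b n : ℕ} (h : b ≤ n) (s : Bits b) :
    Continuous fun θ : PureState n => θ.fourier h s := by
  unfold PureState.fourier
  fun_prop

lemma PureState.abs_fourier_le {b n : ℕ} (h : b ≤ n) (s : Bits b) (θ : PureState n) :
    |θ.fourier h s| ≤ 1 := by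
  rw [← θ.sum_prob]
  refine (Finset.abs_sum_le_sum_abs _ _).trans (Finset.sum_le_sum fun z _ => ?_)
  have h1 : |chi h s z| = 1 := by
    have := chi_mul_self h s z
    rw [← abs_mul_abs_self] at this
    nlinarith [abs_nonneg (chi h s z)]
  rw [abs_mul, h1, one_mul, abs_of_nonneg (θ.prob_nonneg z)]

lemma sum_prod_chi {J : Type} {b n : ℕ} (h : b ≤ n) (D : Finset J) (u : J → Bits n) :
    ∑ s, ∏ j ∈ D, chi h s (u j) =
      ∏ q : Fin b, (1 + ∏ j ∈ D, sgn (u j (Fin.castLE h q))) := by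
  have h1 : ∀ s : Bits b, ∏ j ∈ D, chi h s (u j) =
      ∏ q, if s q then ∏ j ∈ D, sgn (u j (Fin.castLE h q)) else 1 := fun s => by
    simp only [chi]
    rw [Finset.prod_comm]
    refine Finset.prod_congr rfl fun q _ => ?_
    split_ifs <;> simp
  simp only [h1]
  rw [← Fintype.piFinset_univ, ← Finset.prod_univ_sum (fun _ : Fin b => Finset.univ)
    fun q (a : Bool) => if a = true then ∏ j ∈ D, sgn (u j (Fin.castLE h q)) else 1]
  exact Finset.prod_congr rfl fun q _ => by simp [add_comm]

lemma prod_sgn_eq {J : Type} (D : Finset J) (u : J → Bool) :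
    ∏ j ∈ D, sgn (u j) = 1 ∨ ∏ j ∈ D, sgn (u j) = -1 := by
  rw [← mul_self_eq_one_iff, ← Finset.prod_mul_distrib]
  exact Finset.prod_eq_one fun j _ => sgn_mul_self _

open scoped Classical in
-- The character sum factors as `∏ (1 ± 1)` over the `b` bits: it is `2^b` on the event, and never
-- negative.
lemma indicator_parityEvent_le {J : Type} {b n : ℕ} (h : b ≤ n) (D : Finset J) (u : J → Bits n) :
    (if ParityEvent h D u then (1 : ℝ) else 0) ≤ (∑ s, ∏ j ∈ D, chi h s (u j)) / 2 ^ b := by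
  rw [sum_prod_chi]
  split_ifs with hu
  · rw [Finset.prod_congr rfl fun q _ => by rw [hu q], le_div_iff₀ (by positivity)]
    norm_num
  · refine div_nonneg (Finset.prod_nonneg fun q _ => ?_) (by positivity)
    rcases prod_sgn_eq D fun j => u j (Fin.castLE h q) with h | h <;> rw [h] <;> norm_num

open scoped Classical in
-- For fixed states the outcomes are independent, so a character averages to a product of Fourier
-- coefficients. These have modulus at most one: all but two are dropped, and the inequality of
-- arithmetic and geometric means decouples those two, leaving quantities that involve one state
-- each.
lemma sum_parityEvent_le {J : Type} [Fintype J] [DecidableEq J] {b n : ℕ} (h : b ≤ n) (D : Finset J)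
    {j₁ j₂ : J} (h₁ : j₁ ∈ D) (h₂ : j₂ ∈ D) (hne : j₁ ≠ j₂) (ψ : J → PureState n) :
    ∑ u : J → Bits n with ParityEvent h D u, ∏ j, (ψ j).prob (u j) ≤
      (∑ s, ((ψ j₁).fourier h s ^ 2 + (ψ j₂).fourier h s ^ 2) / 2) / 2 ^ b := by
  have hs : ∀ s : Bits b, ∑ u : J → Bits n, (∏ j, (ψ j).prob (u j)) * ∏ j ∈ D, chi h s (u j) =
      ∏ j ∈ D, (ψ j).fourier h s := fun s => by
    have h1 : ∀ u : J → Bits n, (∏ j, (ψ j).prob (u j)) * ∏ j ∈ D, chi h s (u j) =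
        ∏ j, (if j ∈ D then chi h s (u j) * (ψ j).prob (u j) else (ψ j).prob (u j)) := fun u => by
      rw [← Fintype.prod_ite_mem D, ← Finset.prod_mul_distrib]
      refine Finset.prod_congr rfl fun j _ => ?_
      split_ifs <;> ring
    simp only [h1]
    rw [← Fintype.piFinset_univ, ← Finset.prod_univ_sum (fun _ : J => Finset.univ)
      fun j z => if j ∈ D then chi h s z * (ψ j).prob z else (ψ j).prob z,
      ← Fintype.prod_ite_mem D]
    refine Finset.prod_congr rfl fun j _ => ?_
    split_ifs
    · rfl
    · exact (ψ j).sum_prob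
  have hb : ∀ s : Bits b, ∏ j ∈ D, (ψ j).fourier h s ≤
      ((ψ j₁).fourier h s ^ 2 + (ψ j₂).fourier h s ^ 2) / 2 := fun s => by
    have h2' : j₂ ∈ D.erase j₁ := Finset.mem_erase.2 ⟨hne.symm, h₂⟩
    rw [← Finset.mul_prod_erase D _ h₁, ← Finset.mul_prod_erase _ _ h2', ← mul_assoc]
    set a := (ψ j₁).fourier h s
    set c := (ψ j₂).fourier h s
    set p := ∏ j ∈ (D.erase j₁).erase j₂, (ψ j).fourier h s
    have hp : |p| ≤ 1 := by
      rw [Finset.abs_prod]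
      exact Finset.prod_le_one (fun _ _ => abs_nonneg _) fun j _ => (ψ j).abs_fourier_le h s
    calc a * c * p ≤ |a * c * p| := le_abs_self _
      _ = |a| * |c| * |p| := by rw [abs_mul, abs_mul]
      _ ≤ |a| * |c| * 1 := by gcongr
      _ ≤ (a ^ 2 + c ^ 2) / 2 := by
        rw [← sq_abs a, ← sq_abs c]
        nlinarith [sq_nonneg (|a| - |c|)]
  calc ∑ u : J → Bits n with ParityEvent h D u, ∏ j, (ψ j).prob (u j)
      = ∑ u : J → Bits n, (∏ j, (ψ j).prob (u j)) * if ParityEvent h D u then 1 else 0 := by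
        rw [Finset.sum_filter]
        simp
    _ ≤ ∑ u : J → Bits n, (∏ j, (ψ j).prob (u j)) *
          ((∑ s, ∏ j ∈ D, chi h s (u j)) / 2 ^ b) := by
        refine Finset.sum_le_sum fun u _ => mul_le_mul_of_nonneg_left
          (indicator_parityEvent_le h D u) (Finset.prod_nonneg fun j _ => (ψ j).prob_nonneg _)
    _ = (∑ s, ∏ j ∈ D, (ψ j).fourier h s) / 2 ^ b := by
        simp only [← mul_div_assoc, ← Finset.sum_div, Finset.mul_sum]
        rw [Finset.sum_comm]
        simp only [hs]
    _ ≤ _ := by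
        gcongr with s
        exact hb s

/-- The expected collision probability of the first `b` bits of two outcomes. -/
lemma integral_sum_fourier_sq_le {b n : ℕ} (h : b ≤ n) :
    ∑ s, ∫ θ : PureState n, θ.fourier h s ^ 2 ∂haar n ≤ 3 := by
  have h0 : ∫ θ : PureState n, θ.fourier h (fun _ => false) ^ 2 ∂haar n = 1 := by
    simp [PureState.fourier, chi_zero, PureState.sum_prob]
  -- The trivial character contributes 1; the others number at most `2^b ≤ 2^n` and contribute at
  -- most `2/2^n` each.
  rw [← Finset.add_sum_erase _ _ (Finset.mem_univ (fun _ : Fin b => false)), h0]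
  have h1 : ∑ s ∈ Finset.univ.erase (fun _ : Fin b => false),
      ∫ θ : PureState n, θ.fourier h s ^ 2 ∂haar n ≤
      ∑ s ∈ Finset.univ.erase (fun _ : Fin b => false), (2 : ℝ) / 2 ^ n :=
    Finset.sum_le_sum fun s hs => integral_weighted_prob_sq_le _
      (fun z => by rw [pow_two, chi_mul_self]) (sum_chi h (Finset.ne_of_mem_erase hs))
  have h2 : ((Finset.univ.erase (fun _ : Fin b => false)).card : ℝ) ≤ 2 ^ n := by
    have h3 : (Finset.univ.erase (fun _ : Fin b => false)).card ≤ 2 ^ b :=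
      (Finset.card_le_card (Finset.erase_subset _ _)).trans (by simp)
    exact_mod_cast h3.trans (Nat.pow_le_pow_right two_pos h)
  rw [Finset.sum_const, nsmul_eq_mul] at h1
  have h4 : ((Finset.univ.erase (fun _ : Fin b => false)).card : ℝ) * (2 / 2 ^ n) ≤ 2 := by
    rw [mul_div_assoc', div_le_iff₀ (by positivity)]
    nlinarith
  linarith

/-! ### Ensembles of Haar states -/

/-- A random family of Haar states in which states with distinct labels can be rotated
independently. -/
structure IsEnsemble {Ω J Y : Type} [TopologicalSpace Ω] [MeasurableSpace Ω] {n : ℕ}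
    (μ : Measure Ω) (lab : J → Y) (ψ : J → Ω → PureState n) : Prop where
  continuous : ∀ j, Continuous (ψ j)
  marginal : ∀ j, MeasurePreserving (ψ j) μ (haar n)
  twirl : ∀ U : Y → (EuclideanSpace ℂ (Bits n) ≃ₗᵢ[ℂ] EuclideanSpace ℂ (Bits n)),
    ∃ W : Ω → Ω, MeasurePreserving W μ μ ∧
      ∀ j ω, ψ j (W ω) = PureState.apply (U (lab j)) (ψ j ω)

/-- The averaged tensor product of the states of a random family. -/
def kernel {Ω J : Type} [MeasurableSpace Ω] [Fintype J] {n : ℕ}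
    (μ : Measure Ω) (ψ : J → Ω → PureState n) (u v : J → Bits n) : ℂ :=
  ∫ ω, ∏ j, ((ψ j ω).1 (u j) * star ((ψ j ω).1 (v j))) ∂μ

/-- `v` arises from `u` by a permutation of the positions that preserves the labels. -/
def Rel {J Y X : Type} (lab : J → Y) (u v : J → X) : Prop :=
  ∃ π : Equiv.Perm J, (∀ j, lab (π j) = lab j) ∧ ∀ j, v j = u (π j)

lemma Rel.refl {J Y X : Type} (lab : J → Y) (u : J → X) : Rel lab u u :=
  ⟨1, fun _ => rfl, fun _ => rfl⟩

lemma Rel.symm {J Y X : Type} {lab : J → Y} {u v : J → X} (h : Rel lab u v) : Rel lab v u := by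
  obtain ⟨π, h1, h2⟩ := h
  refine ⟨π.symm, fun j => ?_, fun j => ?_⟩
  · conv_rhs => rw [← π.apply_symm_apply j, h1]
  · rw [h2, π.apply_symm_apply]

lemma Rel.trans {J Y X : Type} {lab : J → Y} {u v w : J → X} (h : Rel lab u v)
    (h' : Rel lab v w) : Rel lab u w := by
  obtain ⟨π, h1, h2⟩ := h
  obtain ⟨ρ, h3, h4⟩ := h'
  exact ⟨ρ.trans π, fun j => (h1 _).trans (h3 j), fun j => (h4 j).trans (h2 _)⟩

open scoped Classical in
-- The fibres of the maps `j ↦ (lab j, u j)` and `j ↦ (lab j, v j)` have equal sizes, so bijections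
-- between them glue to a permutation.
lemma rel_of_card_eq {J Y X : Type} [Fintype J] {lab : J → Y} {u v : J → X}
    (h : ∀ y z, (Finset.univ.filter fun j => lab j = y ∧ u j = z).card =
      (Finset.univ.filter fun j => lab j = y ∧ v j = z).card) : Rel lab u v := by
  have e : ∀ c : Y × X, Nonempty ({j // (lab j, v j) = c} ≃ {j // (lab j, u j) = c}) := by
    rintro ⟨y, z⟩
    refine Fintype.card_eq.1 ?_
    rw [Fintype.card_subtype, Fintype.card_subtype]
    simpa [Prod.ext_iff] using (h y z).symm
  let π : Equiv.Perm J := Equiv.ofFiberEquiv fun c => (e c).some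
  have hπ : ∀ j, (lab (π j), u (π j)) = (lab j, v j) := fun j =>
    Equiv.ofFiberEquiv_map (fun c => (e c).some) j
  exact ⟨π, fun j => (Prod.ext_iff.1 (hπ j)).1, fun j => (Prod.ext_iff.1 (hπ j)).2.symm⟩

lemma exists_circle_pow_ne {a b : ℕ} (h : a < b) : ∃ ζ : Circle, ζ ^ a ≠ ζ ^ b := by
  -- The power `b - a` of this number is `-1`.
  refine ⟨Circle.exp (Real.pi / (b - a : ℕ)), fun he => ?_⟩
  have h1 : Circle.exp (Real.pi / (b - a : ℕ)) ^ (b - a) = 1 := by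
    rw [← Nat.add_sub_cancel' h.le, pow_add] at he
    simpa using he
  have hpos : ((b - a : ℕ) : ℝ) ≠ 0 := by
    have : 0 < b - a := Nat.sub_pos_of_lt h
    positivity
  rw [← Circle.exp_nsmul, nsmul_eq_mul, mul_div_cancel₀ _ hpos] at h1
  have h2 := congrArg (fun z : Circle => (z : ℂ)) h1
  norm_num [Circle.coe_exp] at h2

lemma integrable_of_continuous {Ω E : Type} [TopologicalSpace Ω] [CompactSpace Ω]
    [MeasurableSpace Ω] [OpensMeasurableSpace Ω] {μ : Measure Ω} [IsProbabilityMeasure μ]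
    [NormedAddCommGroup E] [SecondCountableTopologyEither Ω E] {f : Ω → E} (hf : Continuous f) :
    Integrable f μ :=
  hf.integrable_of_hasCompactSupport (HasCompactSupport.of_compactSpace f)

lemma IsEnsemble.continuous_integrand {Ω J Y : Type} [TopologicalSpace Ω] [MeasurableSpace Ω]
    [Fintype J] {n : ℕ} {μ : Measure Ω} {lab : J → Y} {ψ : J → Ω → PureState n}
    (hE : IsEnsemble μ lab ψ) (u v : J → Bits n) :
    Continuous fun ω => ∏ j, ((ψ j ω).1 (u j) * star ((ψ j ω).1 (v j))) :=
  continuous_finsetProd _ fun j _ =>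
    ((continuous_amplitude (u j)).comp (hE.continuous j)).mul
      ((continuous_amplitude (v j)).comp (hE.continuous j)).star

lemma IsEnsemble.kernel_twirl {Ω J Y : Type} [TopologicalSpace Ω] [CompactSpace Ω]
    [MeasurableSpace Ω] [OpensMeasurableSpace Ω] [Fintype J] {n : ℕ} {μ : Measure Ω}
    {lab : J → Y} {ψ : J → Ω → PureState n} (hE : IsEnsemble μ lab ψ)
    (U : Y → (EuclideanSpace ℂ (Bits n) ≃ₗᵢ[ℂ] EuclideanSpace ℂ (Bits n))) (u v : J → Bits n) :
    kernel μ (fun j ω => PureState.apply (U (lab j)) (ψ j ω)) u v = kernel μ ψ u v := by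
  obtain ⟨W, hW, hψ⟩ := hE.twirl U
  rw [kernel, kernel]
  conv_rhs => rw [← hW.map_eq]
  rw [integral_map hW.measurable.aemeasurable
    (hE.continuous_integrand u v).aestronglyMeasurable]
  simp only [hψ]

lemma IsEnsemble.kernel_perm {Ω J Y : Type} [TopologicalSpace Ω] [CompactSpace Ω]
    [MeasurableSpace Ω] [OpensMeasurableSpace Ω] [Fintype J] {n : ℕ} {μ : Measure Ω}
    {lab : J → Y} {ψ : J → Ω → PureState n} (hE : IsEnsemble μ lab ψ)
    (σ : Equiv.Perm (Bits n)) (u v : J → Bits n) :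
    kernel μ ψ (fun j => σ (u j)) (fun j => σ (v j)) = kernel μ ψ u v := by
  rw [← hE.kernel_twirl fun _ => permIsometry σ]
  simp [kernel]

/-- Some permutation of the basis carries one injective tuple to the other, and it acts on all
states as one common unitary. -/
lemma IsEnsemble.kernel_self_eq {Ω J Y : Type} [TopologicalSpace Ω] [CompactSpace Ω]
    [MeasurableSpace Ω] [OpensMeasurableSpace Ω] [Fintype J] {n : ℕ} {μ : Measure Ω}
    {lab : J → Y} {ψ : J → Ω → PureState n} (hE : IsEnsemble μ lab ψ) {u v : J → Bits n}
    (hu : Function.Injective u) (hv : Function.Injective v) :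
    kernel μ ψ u u = kernel μ ψ v v := by
  obtain ⟨σ, hσ⟩ := Equiv.Perm.exists_extending_pair v u hv hu
  rw [← hE.kernel_perm σ v v]
  simp only [hσ]

open scoped Classical in
-- If `u` and `v` are unrelated, some basis vector `z` occurs with different multiplicities among
-- the factors of some label `y`. Multiplying coordinate `z` of the states labelled `y` by a phase
-- preserves the average but multiplies the entry by a number other than one.
lemma IsEnsemble.kernel_eq_zero {Ω J Y : Type} [TopologicalSpace Ω] [CompactSpace Ω]
    [MeasurableSpace Ω] [OpensMeasurableSpace Ω] [Fintype J] {n : ℕ} {μ : Measure Ω}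
    {lab : J → Y} {ψ : J → Ω → PureState n} (hE : IsEnsemble μ lab ψ) {u v : J → Bits n}
    (h : ¬ Rel lab u v) : kernel μ ψ u v = 0 := by
  obtain ⟨y, z, hyz⟩ : ∃ y z, (Finset.univ.filter fun j => lab j = y ∧ u j = z).card ≠
      (Finset.univ.filter fun j => lab j = y ∧ v j = z).card := by
    by_contra! h'
    exact h (rel_of_card_eq fun y z => by convert h' y z)
  obtain ⟨ζ, hζ⟩ : ∃ ζ : Circle, ζ ^ (Finset.univ.filter fun j => lab j = y ∧ u j = z).card ≠
      ζ ^ (Finset.univ.filter fun j => lab j = y ∧ v j = z).card := by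
    rcases lt_or_gt_of_ne hyz with h | h
    · exact exists_circle_pow_ne h
    · obtain ⟨ζ, hζ⟩ := exists_circle_pow_ne h
      exact ⟨ζ, hζ.symm⟩
  let c : Y → Bits n → Circle := fun y' z' => if y' = y ∧ z' = z then ζ else 1
  have hprod : ∀ w : J → Bits n, ∏ j, c (lab j) (w j) =
      ζ ^ (Finset.univ.filter fun j => lab j = y ∧ w j = z).card := fun w => by
    simp only [c]
    rw [Finset.prod_ite]
    simp
  have hk := hE.kernel_twirl (fun y' => phaseIsometry (c y')) u v
  have hfac : ∀ ω, ∏ j, ((PureState.apply (phaseIsometry (c (lab j))) (ψ j ω)).1 (u j) *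
      star ((PureState.apply (phaseIsometry (c (lab j))) (ψ j ω)).1 (v j))) =
      ((∏ j, c (lab j) (u j) : Circle) * star ((∏ j, c (lab j) (v j) : Circle) : ℂ)) *
        ∏ j, ((ψ j ω).1 (u j) * star ((ψ j ω).1 (v j))) := fun ω => by
    have hcoe : ∀ w : J → Bits n, ((∏ j, c (lab j) (w j) : Circle) : ℂ) =
        ∏ j, (c (lab j) (w j) : ℂ) := fun w => map_prod Circle.coeHom _ _
    rw [hcoe, hcoe, star_prod, ← Finset.prod_mul_distrib, ← Finset.prod_mul_distrib]
    refine Finset.prod_congr rfl fun j _ => ?_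
    simp only [apply_phaseIsometry, star_mul']
    ring
  rw [kernel] at hk
  simp only [hfac] at hk
  rw [integral_const_mul] at hk
  change _ * kernel μ ψ u v = kernel μ ψ u v at hk
  by_contra hne
  have h1 := mul_right_cancel₀ hne (hk.trans (one_mul _).symm)
  rw [hprod, hprod] at h1
  apply hζ
  apply Circle.ext
  set p := ζ ^ (Finset.univ.filter fun j => lab j = y ∧ u j = z).card
  set r := ζ ^ (Finset.univ.filter fun j => lab j = y ∧ v j = z).card
  have h2 : (star (r : ℂ)) * (r : ℂ) = 1 := by
    rw [mul_comm]
    exact (Complex.mul_conj _).trans (by simp)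
  calc (p : ℂ) = (p : ℂ) * (star (r : ℂ) * r) := by rw [h2, mul_one]
    _ = r := by rw [← mul_assoc, h1, one_mul]

lemma kernel_eq_of_perm {Ω J : Type} [MeasurableSpace Ω] [Fintype J] {n : ℕ} {μ : Measure Ω}
    {ψ : J → Ω → PureState n} {u v : J → Bits n} (π : Equiv.Perm J)
    (hψ : ∀ j, ψ (π j) = ψ j) (hv : ∀ j, v j = u (π j)) : kernel μ ψ u v = kernel μ ψ u u := by
  rw [kernel, kernel]
  congr 1
  ext ω
  rw [Finset.prod_mul_distrib, Finset.prod_mul_distrib]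
  congr 1
  rw [← Equiv.prod_comp π fun j => star ((ψ j ω).1 (u j))]
  simp only [hψ, hv]

lemma kernel_self {Ω J : Type} [MeasurableSpace Ω] [Fintype J] {n : ℕ} {μ : Measure Ω}
    {ψ : J → Ω → PureState n} (u : J → Bits n) :
    kernel μ ψ u u = ((∫ ω, ∏ j, (ψ j ω).prob (u j) ∂μ : ℝ) : ℂ) := by
  rw [kernel, ← integral_complex_ofReal]
  congr 1
  ext ω
  push_cast
  refine Finset.prod_congr rfl fun j _ => ?_
  rw [PureState.prob, ← Complex.normSq_eq_norm_sq]
  exact Complex.mul_conj _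

lemma IsEnsemble.continuous_prod_prob {Ω J Y : Type} [TopologicalSpace Ω] [MeasurableSpace Ω]
    [Fintype J] {n : ℕ} {μ : Measure Ω} {lab : J → Y} {ψ : J → Ω → PureState n}
    (hE : IsEnsemble μ lab ψ) (u : J → Bits n) :
    Continuous fun ω => ∏ j, (ψ j ω).prob (u j) :=
  continuous_finsetProd _ fun j _ => (continuous_prob (u j)).comp (hE.continuous j)

lemma IsEnsemble.sum_prob {Ω J Y : Type} [TopologicalSpace Ω] [CompactSpace Ω]
    [MeasurableSpace Ω] [OpensMeasurableSpace Ω] [Fintype J] [DecidableEq J] {n : ℕ}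
    {μ : Measure Ω} [IsProbabilityMeasure μ]
    {lab : J → Y} {ψ : J → Ω → PureState n} (hE : IsEnsemble μ lab ψ) :
    ∑ u : J → Bits n, ∫ ω, ∏ j, (ψ j ω).prob (u j) ∂μ = 1 := by
  rw [← integral_finsetSum _ fun u _ => integrable_of_continuous (hE.continuous_prod_prob u)]
  have h1 : ∀ ω, ∑ u : J → Bits n, ∏ j, (ψ j ω).prob (u j) = 1 := fun ω => by
    rw [← Fintype.piFinset_univ, ← Finset.prod_univ_sum (fun _ : J => Finset.univ)
      fun j z => (ψ j ω).prob z]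
    simp [PureState.sum_prob]
  simp [h1]

lemma IsEnsemble.integral_comp {Ω J Y : Type} [TopologicalSpace Ω] [MeasurableSpace Ω] {n : ℕ}
    {μ : Measure Ω} {lab : J → Y} {ψ : J → Ω → PureState n} (hE : IsEnsemble μ lab ψ) (j : J)
    {f : PureState n → ℝ} (hf : Continuous f) : ∫ ω, f (ψ j ω) ∂μ = ∫ θ, f θ ∂haar n := by
  rw [← (hE.marginal j).map_eq, integral_map (hE.marginal j).measurable.aemeasurable
    hf.aestronglyMeasurable]

open scoped Classical in
-- After the decoupling only the marginals of single states matter, so the bound needs no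
-- independence between factors and serves the real and the ideal ensemble alike.
lemma IsEnsemble.parityEvent_le {Ω J Y : Type} [TopologicalSpace Ω] [CompactSpace Ω]
    [MeasurableSpace Ω] [OpensMeasurableSpace Ω] [Fintype J] [DecidableEq J] {b n : ℕ}
    {μ : Measure Ω} [IsProbabilityMeasure μ]
    {lab : J → Y} {ψ : J → Ω → PureState n} (hE : IsEnsemble μ lab ψ) (h : b ≤ n) {D : Finset J}
    {j₁ j₂ : J} (h₁ : j₁ ∈ D) (h₂ : j₂ ∈ D) (hne : j₁ ≠ j₂) :
    ∑ u : J → Bits n with ParityEvent h D u, ∫ ω, ∏ j, (ψ j ω).prob (u j) ∂μ ≤ 3 / 2 ^ b := by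
  have hc : ∀ (j : J) (s : Bits b), Continuous fun ω => (ψ j ω).fourier h s ^ 2 := fun j s =>
    ((continuous_fourier h s).comp (hE.continuous j)).pow 2
  have hi : ∀ (j : J) (s : Bits b), Integrable (fun ω => (ψ j ω).fourier h s ^ 2) μ :=
    fun j s => integrable_of_continuous (hc j s)
  have hi2 : ∀ s : Bits b, Integrable
      (fun ω => ((ψ j₁ ω).fourier h s ^ 2 + (ψ j₂ ω).fourier h s ^ 2) / 2) μ :=
    fun s => ((hi j₁ s).add (hi j₂ s)).div_const 2
  have hcomp : ∀ (j : J) (s : Bits b), ∫ ω, (ψ j ω).fourier h s ^ 2 ∂μ =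
      ∫ θ : PureState n, θ.fourier h s ^ 2 ∂haar n := fun j s =>
    hE.integral_comp j (f := fun θ => θ.fourier h s ^ 2) (by fun_prop)
  rw [← integral_finsetSum _ fun u _ => integrable_of_continuous (hE.continuous_prod_prob u)]
  calc _ ≤ ∫ ω, (∑ s, ((ψ j₁ ω).fourier h s ^ 2 + (ψ j₂ ω).fourier h s ^ 2) / 2) / 2 ^ b ∂μ := by
        refine integral_mono (integrable_finsetSum _ fun u _ =>
          integrable_of_continuous (hE.continuous_prod_prob u))
          ((integrable_finsetSum _ fun s _ => hi2 s).div_const _)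
          fun ω => sum_parityEvent_le h D h₁ h₂ hne fun j => ψ j ω
    _ = (∑ s, ∫ θ : PureState n, θ.fourier h s ^ 2 ∂haar n) / 2 ^ b := by
        rw [integral_div, integral_finsetSum _ fun s _ => hi2 s]
        congr 1
        refine Finset.sum_congr rfl fun s _ => ?_
        rw [integral_div, integral_add (hi j₁ s) (hi j₂ s), hcomp, hcomp]
        ring
    _ ≤ 3 / 2 ^ b := by
        gcongr
        exact integral_sum_fourier_sq_le h

/-! ### Differences of positive semidefinite matrices -/

open scoped MatrixOrder in
-- In an eigenbasis of `P - Q` each eigenvalue is a difference of nonnegative diagonal entries of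
-- `P` and `Q`, hence bounded in modulus by their sum.
lemma traceNorm_sub_le {ι : Type} [Fintype ι] [DecidableEq ι] {P Q : Op ι} (hP : P.PosSemidef)
    (hQ : Q.PosSemidef) : traceNorm (P - Q) ≤ P.trace.re + Q.trace.re := by
  have hX : (P - Q).IsHermitian := hP.isHermitian.sub hQ.isHermitian
  set X := P - Q with hXdef
  let U : Op ι := hX.eigenvectorUnitary
  have hUU : U.conjTranspose * U = 1 := Unitary.coe_star_mul_self hX.eigenvectorUnitary
  have hUU' : U * U.conjTranspose = 1 := Unitary.coe_mul_star_self hX.eigenvectorUnitary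
  let lam := hX.eigenvalues
  let D : Op ι := Matrix.diagonal fun i => ((lam i : ℝ) : ℂ)
  let A : Op ι := Matrix.diagonal fun i => ((|lam i| : ℝ) : ℂ)
  have hspec : X = U * D * U.conjTranspose := hX.spectral_theorem
  have hA : A.PosSemidef := Matrix.PosSemidef.diagonal fun i => by
    simp only [Pi.zero_apply]
    exact_mod_cast abs_nonneg (lam i)
  have hDD : D.conjTranspose * D = A * A := by
    simp only [D, A, Matrix.diagonal_conjTranspose, Matrix.diagonal_mul_diagonal]
    congr 1
    ext i
    simp only [Pi.star_apply, Complex.star_def, Complex.conj_ofReal]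
    exact_mod_cast (abs_mul_abs_self (lam i)).symm
  have hsqrt : CFC.sqrt (X.conjTranspose * X) = U * A * U.conjTranspose := by
    refine CFC.sqrt_unique ?_ (Matrix.nonneg_iff_posSemidef.2 (hA.mul_mul_conjTranspose_same U))
    rw [hspec]
    simp only [Matrix.conjTranspose_mul, Matrix.conjTranspose_conjTranspose]
    calc U * A * U.conjTranspose * (U * A * U.conjTranspose)
        = U * A * (U.conjTranspose * U) * A * U.conjTranspose := by simp only [Matrix.mul_assoc]
      _ = U * (A * A) * U.conjTranspose := by rw [hUU, Matrix.mul_one, Matrix.mul_assoc U]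
      _ = U * D.conjTranspose * (U.conjTranspose * U) * D * U.conjTranspose := by
        rw [hUU, Matrix.mul_one, ← hDD]
        simp only [Matrix.mul_assoc]
      _ = _ := by simp only [Matrix.mul_assoc]
  have htr : ∀ B : Op ι, (U.conjTranspose * B * U).trace = B.trace := fun B => by
    rw [Matrix.trace_mul_comm, ← Matrix.mul_assoc, hUU', Matrix.one_mul]
  have hD : D = U.conjTranspose * P * U - U.conjTranspose * Q * U := by
    rw [← Matrix.sub_mul, ← Matrix.mul_sub, ← hXdef, hspec]
    calc D = (U.conjTranspose * U) * D * (U.conjTranspose * U) := by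
          rw [hUU, Matrix.one_mul, Matrix.mul_one]
      _ = _ := by simp only [Matrix.mul_assoc]
  have hP' := hP.conjTranspose_mul_mul_same U
  have hQ' := hQ.conjTranspose_mul_mul_same U
  rw [traceNorm, hsqrt, Matrix.trace_mul_comm, ← Matrix.mul_assoc, hUU, Matrix.one_mul,
    ← htr P, ← htr Q]
  simp only [Matrix.trace, Matrix.diag_apply, Complex.re_sum, ← Finset.sum_add_distrib]
  refine Finset.sum_le_sum fun i _ => ?_
  have h1 := (Complex.nonneg_iff.1 (hP'.diag_nonneg (i := i))).1
  have h2 := (Complex.nonneg_iff.1 (hQ'.diag_nonneg (i := i))).1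
  have h3 : lam i = ((U.conjTranspose * P * U) i i).re - ((U.conjTranspose * Q * U) i i).re := by
    have := congrArg (fun B : Op ι => (B i i).re) hD
    simpa [D] using this
  simp only [A, Matrix.diagonal_apply_eq, Complex.ofReal_re]
  rw [h3, abs_le]
  constructor <;> linarith

open scoped MatrixOrder in
lemma trace_mul_nonneg {ι : Type} [Fintype ι] [DecidableEq ι] {M P : Op ι} (hM : M.PosSemidef)
    (hP : P.PosSemidef) : 0 ≤ (M * P).trace.re := by
  obtain ⟨B, rfl⟩ := CStarAlgebra.nonneg_iff_eq_star_mul_self.1 (Matrix.nonneg_iff_posSemidef.2 hP)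
  rw [← Matrix.mul_assoc, Matrix.trace_mul_comm, ← Matrix.mul_assoc]
  exact (Complex.nonneg_iff.1 (hM.mul_mul_conjTranspose_same B).trace_nonneg).1

lemma acceptProb_mem_Icc {ι : Type} [Fintype ι] [DecidableEq ι] {M P : Op ι} (hM : IsEffect M)
    (hP : P.PosSemidef) : 0 ≤ acceptProb M P ∧ acceptProb M P ≤ P.trace.re := by
  refine ⟨trace_mul_nonneg hM.1 hP, ?_⟩
  have h := trace_mul_nonneg hM.2 hP
  rw [Matrix.sub_mul, Matrix.one_mul, Matrix.trace_sub, Complex.sub_re] at h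
  exact sub_nonneg.1 h

/-- This bounds the distinguishing advantage straight from a decomposition into positive parts,
without the variational formula for the trace norm. -/
lemma abs_acceptProb_sub_le {ι : Type} [Fintype ι] [DecidableEq ι] {M P Q : Op ι}
    (hM : IsEffect M) (hP : P.PosSemidef) (hQ : Q.PosSemidef) :
    |acceptProb M (P - Q)| ≤ P.trace.re + Q.trace.re := by
  have h1 := acceptProb_mem_Icc hM hP
  have h2 := acceptProb_mem_Icc hM hQ
  have h3 : acceptProb M (P - Q) = acceptProb M P - acceptProb M Q := by
    simp [acceptProb, Matrix.mul_sub]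
  rw [h3, abs_le]
  constructor <;> linarith

open scoped Classical in
/-- The matrix of an equivalence relation on a subset is positive semidefinite. -/
lemma posSemidef_relation {ι : Type} [Fintype ι] (good : ι → Prop) (r : Setoid ι)
    (hgood : ∀ u v, good u → r u v → good v) :
    (Matrix.of fun u v => if good u ∧ r u v then (1 : ℂ) else 0).PosSemidef := by
  -- Row `c` is the indicator of the good elements of class `c`, so `B† B` is the desired matrix.
  let B : Matrix (Quotient r) ι ℂ :=
    Matrix.of fun c u => if good u ∧ (Quotient.mk r u) = c then 1 else 0
  convert Matrix.posSemidef_conjTranspose_mul_self B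
  ext u v
  rw [Matrix.mul_apply, Finset.sum_eq_single (Quotient.mk r u)]
  · by_cases hu : good u
    · by_cases huv : r u v
      · have : good v := hgood u v hu huv
        have h2 : Quotient.mk r v = Quotient.mk r u := Quotient.sound (r.symm huv)
        simp [B, hu, huv, this, h2]
      · have h2 : ¬ Quotient.mk r v = Quotient.mk r u := fun h => huv (r.symm (Quotient.exact h))
        simp [B, huv, h2]
    · simp [B, hu]
  · intro c _ hc
    simp [B, hc.symm]
  · simp

open scoped Classical in
/-- Two density matrices that are proportional to each other on a common block differ by at most
their weights outside of this block. -/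
lemma exists_posSemidef_sub {ι : Type} [Fintype ι] {R S P : Op ι} (hR : R.PosSemidef)
    (hS : S.PosSemidef) (hP : P.PosSemidef) (hR1 : R.trace = 1) (hS1 : S.trace = 1)
    (good : ι → Prop) (a c : ℝ) (hRP : ∀ u v, good u → R u v = a * P u v)
    (hSP : ∀ u v, good u → S u v = c * P u v) (hP0 : ∀ u v, ¬ good u → P u v = 0) :
    ∃ A B : Op ι, A.PosSemidef ∧ B.PosSemidef ∧ R - S = A - B ∧
      A.trace.re + B.trace.re ≤
        2 * (∑ u with ¬ good u, (R u u).re + ∑ u with ¬ good u, (S u u).re) := by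
  -- `E` projects onto the bad block. A matrix proportional to `P` on good rows is, by Hermitian
  -- symmetry, its bad block plus a multiple of `P`.
  let E : Op ι := Matrix.diagonal fun u => if good u then 0 else 1
  have hE : ∀ (T : Op ι) (d : ℝ), T.PosSemidef → (∀ u v, good u → T u v = d * P u v) →
      (E * T * E.conjTranspose).PosSemidef ∧ T = E * T * E.conjTranspose + (d : ℂ) • P ∧
      (E * T * E.conjTranspose).trace = ∑ u with ¬ good u, T u u := by
    intro T d hT hTP
    have hent : ∀ u v, (E * T * E.conjTranspose) u v = if good u ∨ good v then 0 else T u v := by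
      intro u v
      simp only [E, Matrix.diagonal_conjTranspose, Matrix.mul_diagonal, Matrix.diagonal_mul]
      by_cases hu : good u <;> by_cases hv : good v <;> simp [hu, hv]
    refine ⟨hT.mul_mul_conjTranspose_same E, ?_, ?_⟩
    · ext u v
      rw [Matrix.add_apply, hent, Matrix.smul_apply, smul_eq_mul]
      by_cases hu : good u
      · simp [hu, hTP u v hu]
      · rw [hP0 u v hu]
        by_cases hv : good v
        · have h1 : T u v = star (T v u) := (hT.isHermitian.apply u v).symm
          have h2 : star (P v u) = P u v := hP.isHermitian.apply u v
          rw [h1, hTP v u hv, star_mul', h2, hP0 u v hu]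
          simp [hv]
        · simp [hu, hv]
    · simp only [Matrix.trace, Matrix.diag_apply, hent, or_self]
      rw [Finset.sum_filter]
      exact Finset.sum_congr rfl fun u _ => by by_cases hu : good u <;> simp [hu]
  obtain ⟨hR2, hR3, hR4⟩ := hE R a hR hRP
  obtain ⟨hS2, hS3, hS4⟩ := hE S c hS hSP
  set R' := E * R * E.conjTranspose
  set S' := E * S * E.conjTranspose
  have hR5 := congrArg (fun T : Op ι => T.trace.re) hR3
  have hS5 := congrArg (fun T : Op ι => T.trace.re) hS3
  simp only [hR1, hS1, Matrix.trace_add, Matrix.trace_smul, smul_eq_mul, Complex.add_re,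
    Complex.one_re, Complex.re_ofReal_mul] at hR5 hS5
  have hR6 := (Complex.nonneg_iff.1 hR2.trace_nonneg).1
  have hS6 := (Complex.nonneg_iff.1 hS2.trace_nonneg).1
  rw [← Complex.re_sum, ← Complex.re_sum, ← hR4, ← hS4]
  have hPt := (Complex.nonneg_iff.1 hP.trace_nonneg).1
  -- Equal traces give `(a - c) tr P = tr S' - tr R'`. The multiple of `P` joins whichever side
  -- keeps its coefficient nonnegative, and the total trace becomes twice the larger bad weight.
  rcases le_total c a with hca | hca
  · refine ⟨R' + ((a - c : ℝ) : ℂ) • P, S',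
      hR2.add (hP.smul (by exact_mod_cast sub_nonneg.2 hca)), hS2, ?_, ?_⟩
    · rw [hR3, hS3]
      push_cast
      rw [sub_smul]
      abel
    · simp only [Matrix.trace_add, Matrix.trace_smul, smul_eq_mul, Complex.add_re,
        Complex.re_ofReal_mul]
      linarith
  · refine ⟨R', S' + ((c - a : ℝ) : ℂ) • P, hR2,
      hS2.add (hP.smul (by exact_mod_cast sub_nonneg.2 hca)), ?_, ?_⟩
    · rw [hR3, hS3]
      push_cast
      rw [sub_smul]
      abel
    · simp only [Matrix.trace_add, Matrix.trace_smul, smul_eq_mul, Complex.add_re,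
        Complex.re_ofReal_mul]
      linarith

/-- Averages of rank-one projections are positive semidefinite. -/
lemma posSemidef_integral {Ω ι : Type} [Fintype ι] [MeasurableSpace Ω] {μ : Measure Ω}
    (f : Ω → ι → ℂ) (hf : ∀ u v, Integrable (fun ω => f ω u * star (f ω v)) μ) :
    (Matrix.of fun u v => ∫ ω, f ω u * star (f ω v) ∂μ).PosSemidef := by
  refine Matrix.PosSemidef.of_dotProduct_mulVec_nonneg ?_ fun x => ?_
  · ext u v
    rw [Matrix.conjTranspose_apply, Matrix.of_apply, Matrix.of_apply, Complex.star_def,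
      ← integral_conj]
    congr 1
    ext ω
    simp [mul_comm]
  · have h : star x ⬝ᵥ ((Matrix.of fun u v => ∫ ω, f ω u * star (f ω v) ∂μ).mulVec x) =
        ∫ ω, ((‖∑ u, star (x u) * f ω u‖ ^ 2 : ℝ) : ℂ) ∂μ := by
      simp only [dotProduct, Matrix.mulVec, Matrix.of_apply, Pi.star_apply, Finset.mul_sum]
      have hi : ∀ u v, Integrable (fun ω => star (x u) * (f ω u * star (f ω v)) * x v) μ :=
        fun u v => ((hf u v).const_mul _).mul_const _
      have h2 : ∀ u v, star (x u) * ((∫ ω, f ω u * star (f ω v) ∂μ) * x v) =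
          ∫ ω, star (x u) * (f ω u * star (f ω v)) * x v ∂μ := fun u v => by
        rw [integral_mul_const, integral_const_mul, mul_assoc]
      simp only [h2]
      simp_rw [← integral_finsetSum _ fun v _ => hi _ v]
      rw [← integral_finsetSum _ fun u _ => integrable_finsetSum _ fun v _ => hi u v]
      congr 1
      ext ω
      rw [← Complex.normSq_eq_norm_sq, ← Complex.mul_conj, map_sum, Finset.sum_mul_sum]
      refine Finset.sum_congr rfl fun u _ => Finset.sum_congr rfl fun v _ => ?_
      simp
      ring
    rw [h, integral_complex_ofReal]
    exact_mod_cast integral_nonneg fun ω => sq_nonneg _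

/-! ### The two ensembles -/

/-- The label of a tensor factor: a query, or `none` for the copies of the common state. -/
def label {m ℓ : ℕ} (x : Fin ℓ → Bits m) (t : ℕ) : Fin ℓ ⊕ Fin t → Option (Bits m) :=
  Sum.elim (fun i => some (x i)) fun _ => none

/-- The state in a tensor factor of the ideal state. -/
def idealFamily {m ℓ : ℕ} (n : ℕ) (x : Fin ℓ → Bits m) (t : ℕ) (j : Fin ℓ ⊕ Fin t)
    (p : (Bits m → PureState n) × PureState n) : PureState n :=
  Sum.elim (fun i => p.1 (x i)) (fun _ => p.2) j

lemma isEnsemble_haar (J : Type) (n : ℕ) :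
    IsEnsemble (haar n) (fun _ : J => ()) (fun _ θ => θ) where
  continuous _ := continuous_id
  marginal _ := MeasurePreserving.id _
  twirl U := ⟨PureState.apply (U ()), measurePreserving_haar _, fun _ _ => rfl⟩

instance haarFamily_isProbabilityMeasure (m n : ℕ) : IsProbabilityMeasure (haarFamily m n) := by
  unfold haarFamily
  infer_instance

lemma isEnsemble_idealFamily {m ℓ : ℕ} (n : ℕ) (x : Fin ℓ → Bits m) (t : ℕ) :
    IsEnsemble (haarFamily m n) (label x t) (idealFamily n x t) where
  continuous j := by
    rcases j with i | i
    · exact (continuous_apply (x i)).comp continuous_fst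
    · exact continuous_snd
  marginal j := by
    rcases j with i | i
    · exact (measurePreserving_eval (fun _ : Bits m => haar n) (x i)).comp measurePreserving_fst
    · exact measurePreserving_snd
  twirl U := by
    refine ⟨Prod.map (fun φ y => PureState.apply (U (some y)) (φ y)) (PureState.apply (U none)),
      (measurePreserving_pi _ _ fun y => measurePreserving_haar _).prod
        (measurePreserving_haar _), ?_⟩
    rintro (i | i) ω <;> rfl

/-- The basis of the joint system, indexed by all tensor factors at once. -/
def joinEquiv (ℓ t n : ℕ) :
    ((Fin ℓ → Bits n) × (Fin t → Bits n)) ≃ (Fin ℓ ⊕ Fin t → Bits n) :=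
  (Equiv.sumArrowEquivProdArrow (Fin ℓ) (Fin t) (Bits n)).symm

@[simp]
lemma joinEquiv_inl {ℓ t n : ℕ} (w : (Fin ℓ → Bits n) × (Fin t → Bits n)) (i : Fin ℓ) :
    joinEquiv ℓ t n w (.inl i) = w.1 i := rfl

@[simp]
lemma joinEquiv_inr {ℓ t n : ℕ} (w : (Fin ℓ → Bits n) × (Fin t → Bits n)) (i : Fin t) :
    joinEquiv ℓ t n w (.inr i) = w.2 i := rfl

lemma idealAverage_apply {m ℓ : ℕ} (n : ℕ) (x : Fin ℓ → Bits m) (t : ℕ)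
    (u v : (Fin ℓ → Bits n) × (Fin t → Bits n)) :
    idealAverage n x t u v =
      kernel (haarFamily m n) (idealFamily n x t) (joinEquiv ℓ t n u) (joinEquiv ℓ t n v) := by
  rw [idealAverage, kernel, Matrix.of_apply]
  congr 1
  ext p
  rw [Fintype.prod_sum_type]
  rfl

/-- The sign by which the generator with key `K` multiplies a basis vector. -/
def maskSign {m b n ℓ t : ℕ} (h : b ≤ n) (x : Fin ℓ → Bits m) (K : BlockKey m b)
    (u : Fin ℓ ⊕ Fin t → Bits n) : ℝ :=
  ∏ i, chi h (ggmMask K (x i)) (u (.inl i))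

lemma maskSign_mul_self {m b n ℓ t : ℕ} (h : b ≤ n) (x : Fin ℓ → Bits m) (K : BlockKey m b)
    (u : Fin ℓ ⊕ Fin t → Bits n) : maskSign h x K u * maskSign h x K u = 1 := by
  rw [maskSign, ← Finset.prod_mul_distrib]
  exact Finset.prod_eq_one fun i _ => chi_mul_self _ _ _

lemma ggmChannel_ketbra {m b n : ℕ} (h : b ≤ n) (K : BlockKey m b) (y : Bits m) (θ : PureState n)
    (u v : Bits n) : ggmChannel n K y (ketbra θ) u v =
      chi h (ggmMask K y) u * chi h (ggmMask K y) v * (θ.1 u * star (θ.1 v)) := by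
  show (zPrefix n (ggmMask K y) * ketbra θ * (zPrefix n (ggmMask K y)).conjTranspose) u v = _
  rw [zPrefix_eq_diagonal h, Matrix.diagonal_conjTranspose, Matrix.mul_diagonal,
    Matrix.diagonal_mul, ketbra, Matrix.vecMulVec_apply]
  simp only [Pi.star_apply, Complex.star_def, Complex.conj_ofReal]
  ring

lemma realState_apply {m b n ℓ : ℕ} (h : b ≤ n) (K : BlockKey m b) (x : Fin ℓ → Bits m) (t : ℕ)
    (θ : PureState n) (u v : (Fin ℓ → Bits n) × (Fin t → Bits n)) :
    realState (ggmChannel n K) x t θ u v =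
      maskSign h x K (joinEquiv ℓ t n u) * maskSign h x K (joinEquiv ℓ t n v) *
        ∏ j, (θ.1 (joinEquiv ℓ t n u j) * star (θ.1 (joinEquiv ℓ t n v j))) := by
  rw [Fintype.prod_sum_type]
  simp only [realState, tensorPi, ggmChannel_ketbra h, maskSign, Finset.prod_mul_distrib,
    Complex.ofReal_prod, joinEquiv_inl, joinEquiv_inr]
  rw [← mul_assoc, ← Finset.prod_mul_distrib (s := Finset.univ (α := Fin t))]
  rfl

/-- The factor by which the average over keys multiplies a matrix entry. -/
def signAverage {m ℓ t : ℕ} {b n : ℕ} (h : b ≤ n) (x : Fin ℓ → Bits m)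
    (u v : Fin ℓ ⊕ Fin t → Bits n) : ℝ :=
  𝔼 K : BlockKey m b, maskSign h x K u * maskSign h x K v

lemma ggmRealAverage_apply {m b n ℓ : ℕ} (h : b ≤ n) (x : Fin ℓ → Bits m) (t : ℕ)
    (u v : (Fin ℓ → Bits n) × (Fin t → Bits n)) :
    ggmRealAverage b n x t u v =
      signAverage h x (joinEquiv ℓ t n u) (joinEquiv ℓ t n v) *
        kernel (haar n) (fun _ θ => θ) (joinEquiv ℓ t n u) (joinEquiv ℓ t n v) := by
  rw [ggmRealAverage, Matrix.of_apply, signAverage]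
  simp only [realState_apply h, integral_const_mul]
  rw [← Finset.expect_mul, kernel]
  congr 1
  simp only [Finset.expect_eq_sum_div_card]
  push_cast
  rfl

/-! ### The average over keys -/

/-- The sign contributed by a factor depends only on its label and its bits, so the product is
unchanged by reordering within labels. -/
lemma maskSign_eq_of_rel {m b n ℓ t : ℕ} (h : b ≤ n) {x : Fin ℓ → Bits m} (K : BlockKey m b)
    {u v : Fin ℓ ⊕ Fin t → Bits n} (huv : Rel (label x t) u v) :
    maskSign h x K u = maskSign h x K v := by
  let f : Option (Bits m) → Bits n → ℝ := fun o z => o.elim 1 fun y => chi h (ggmMask K y) z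
  have hf : ∀ w : Fin ℓ ⊕ Fin t → Bits n, maskSign h x K w = ∏ j, f (label x t j) (w j) :=
    fun w => by simp [maskSign, Fintype.prod_sum_type, f, label]
  obtain ⟨π, h1, h2⟩ := huv
  rw [hf, hf, ← Equiv.prod_comp π fun j => f (label x t j) (u j)]
  simp only [h1, h2]

lemma signAverage_eq_one_of_rel {m b n ℓ t : ℕ} (h : b ≤ n) {x : Fin ℓ → Bits m}
    {u v : Fin ℓ ⊕ Fin t → Bits n} (huv : Rel (label x t) u v) : signAverage h x u v = 1 := by
  simp only [signAverage, maskSign_eq_of_rel h _ huv, maskSign_mul_self]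
  simp

lemma chi_ggmMask {m b n : ℕ} (h : b ≤ n) (K : BlockKey m b) (y : Bits m) (z : Bits n) :
    chi h (ggmMask K y) z =
      ∏ q : Fin b, ∏ i : Fin m, if K (y i) i q then sgn (z (Fin.castLE h q)) else 1 := by
  rw [chi]
  refine Finset.prod_congr rfl fun q _ => ?_
  rw [Finset.prod_ite]
  simp only [Finset.prod_const, one_pow, mul_one, ggmMask, decide_eq_true_eq]
  split_ifs with ho
  · obtain ⟨k, hk⟩ := ho
    rw [hk, pow_succ, pow_mul, pow_two, sgn_mul_self, one_pow, one_mul]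
  · obtain ⟨k, hk⟩ := Nat.not_odd_iff_even.1 ho
    rw [hk, ← two_mul, pow_mul, pow_two, sgn_mul_self, one_pow]

/-- Flipping one bit of the key. -/
def flipKey {m b : ℕ} (c : Bool) (i : Fin m) (q : Fin b) (K : BlockKey m b) : BlockKey m b :=
  fun c' i' q' => xor (K c' i' q') (decide (c' = c ∧ i' = i ∧ q' = q))

lemma flipKey_involutive {m b : ℕ} (c : Bool) (i : Fin m) (q : Fin b) :
    Function.Involutive (flipKey c i q) := fun K => by
  ext c' i' q'
  simp [flipKey]

lemma chi_ggmMask_flipKey {m b n : ℕ} (h : b ≤ n) (K : BlockKey m b) (y : Bits m) (z : Bits n)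
    (c : Bool) (i : Fin m) (q : Fin b) :
    chi h (ggmMask (flipKey c i q K) y) z =
      chi h (ggmMask K y) z * if y i = c then sgn (z (Fin.castLE h q)) else 1 := by
  have hflip : ∀ c' i' q' (e : Bool), (if flipKey c i q K c' i' q' then sgn e else 1) =
      (if K c' i' q' then sgn e else 1) * if c' = c ∧ i' = i ∧ q' = q then sgn e else 1 := by
    intro c' i' q' e
    rw [flipKey]
    by_cases hd : c' = c ∧ i' = i ∧ q' = q <;> cases K c' i' q' <;> simp [hd, sgn_mul_self]
  simp only [chi_ggmMask, hflip, Finset.prod_mul_distrib]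
  congr 1
  rw [Finset.prod_eq_single q, Finset.prod_eq_single i]
  · simp
  · intro i' _ hi
    simp [hi]
  · simp
  · intro q' _ hq
    simp [hq]
  · simp

/-- The sign `∏ (-1)^{u_j(q)}` over all queries with `i`-th bit `c`. -/
def blockSign {m b n ℓ t : ℕ} (h : b ≤ n) (x : Fin ℓ → Bits m) (u : Fin ℓ ⊕ Fin t → Bits n)
    (c : Bool) (i : Fin m) (q : Fin b) : ℝ :=
  ∏ j with x j i = c, sgn (u (.inl j) (Fin.castLE h q))

lemma maskSign_flipKey {m b n ℓ t : ℕ} (h : b ≤ n) (x : Fin ℓ → Bits m) (K : BlockKey m b)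
    (u : Fin ℓ ⊕ Fin t → Bits n) (c : Bool) (i : Fin m) (q : Fin b) :
    maskSign h x (flipKey c i q K) u = maskSign h x K u * blockSign h x u c i q := by
  simp only [maskSign, chi_ggmMask_flipKey, Finset.prod_mul_distrib, blockSign, Finset.prod_filter]

/-- Flipping key bit `(c, i, q)` permutes the keys and negates every summand. -/
lemma signAverage_eq_zero {m b n ℓ t : ℕ} (h : b ≤ n) {x : Fin ℓ → Bits m}
    {u v : Fin ℓ ⊕ Fin t → Bits n} {c : Bool} {i : Fin m} {q : Fin b}
    (hne : blockSign h x u c i q ≠ blockSign h x v c i q) : signAverage h x u v = 0 := by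
  have h1 : blockSign h x u c i q * blockSign h x v c i q = -1 := by
    rcases prod_sgn_eq (Finset.univ.filter fun j => x j i = c)
        (fun j => u (.inl j) (Fin.castLE h q)) with hu | hu <;>
      rcases prod_sgn_eq (Finset.univ.filter fun j => x j i = c)
        (fun j => v (.inl j) (Fin.castLE h q)) with hv | hv <;>
      simp_all [blockSign]
  have h2 : signAverage h x u v = signAverage h x u v * -1 := by
    conv_lhs => rw [signAverage]
    rw [Fintype.expect_equiv ((flipKey_involutive c i q).toPerm) _
      (fun K => maskSign h x (flipKey c i q K) u * maskSign h x (flipKey c i q K) v)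
      fun K => by simp [flipKey_involutive c i q K]]
    simp only [maskSign_flipKey]
    rw [signAverage, Finset.expect_mul]
    refine Finset.expect_congr rfl fun K _ => ?_
    rw [← h1]
    ring
  linarith

/-! ### Good basis vectors -/

/-- The relation of having a nonzero matrix entry in the average over keys. -/
def KeyRel {m b n ℓ t : ℕ} (h : b ≤ n) (x : Fin ℓ → Bits m) (u v : Fin ℓ ⊕ Fin t → Bits n) :
    Prop :=
  Rel (fun _ => ()) u v ∧ ∀ c i q, blockSign h x u c i q = blockSign h x v c i q

/-- Basis vectors on which the average over keys separates the queries. -/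
def Good {m b n ℓ t : ℕ} (h : b ≤ n) (x : Fin ℓ → Bits m) (u : Fin ℓ ⊕ Fin t → Bits n) : Prop :=
  Function.Injective u ∧ ∀ v, KeyRel h x u v → Rel (label x t) u v

lemma blockSign_eq_of_rel {m b n ℓ t : ℕ} (h : b ≤ n) {x : Fin ℓ → Bits m}
    {u v : Fin ℓ ⊕ Fin t → Bits n} (huv : Rel (label x t) u v) (c : Bool) (i : Fin m) (q : Fin b) :
    blockSign h x u c i q = blockSign h x v c i q := by
  by_contra hne
  have h1 := signAverage_eq_zero h hne
  rw [signAverage_eq_one_of_rel h huv] at h1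
  exact one_ne_zero h1

lemma KeyRel.of_rel {m b n ℓ t : ℕ} (h : b ≤ n) {x : Fin ℓ → Bits m}
    {u v : Fin ℓ ⊕ Fin t → Bits n} (huv : Rel (label x t) u v) : KeyRel h x u v :=
  ⟨huv.imp fun _ hπ => ⟨fun _ => rfl, hπ.2⟩, blockSign_eq_of_rel h huv⟩

lemma Good.of_rel {m b n ℓ t : ℕ} {h : b ≤ n} {x : Fin ℓ → Bits m}
    {u v : Fin ℓ ⊕ Fin t → Bits n} (hu : Good h x u) (huv : Rel (label x t) u v) :
    Good h x v := by
  refine ⟨?_, fun w hw => huv.symm.trans (hu.2 w ?_)⟩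
  · obtain ⟨π, -, hπ⟩ := huv
    rw [show v = u ∘ π from funext hπ]
    exact hu.1.comp π.injective
  · have := KeyRel.of_rel h huv
    exact ⟨this.1.trans hw.1, fun c i q => (this.2 c i q).trans (hw.2 c i q)⟩

/-- The positions of the queries with `i`-th bit `c`. -/
def queryPositions {m ℓ : ℕ} (x : Fin ℓ → Bits m) (t : ℕ) (c : Bool) (i : Fin m) :
    Finset (Fin ℓ ⊕ Fin t) :=
  (Finset.univ.filter fun j => x j i = c).map Function.Embedding.inl

lemma mem_queryPositions {m ℓ : ℕ} {x : Fin ℓ → Bits m} {t : ℕ} {c : Bool} {i : Fin m}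
    {j : Fin ℓ ⊕ Fin t} : j ∈ queryPositions x t c i ↔ ∃ k, j = .inl k ∧ x k i = c := by
  simp only [queryPositions, Finset.mem_map, Finset.mem_filter, Finset.mem_univ, true_and]
  exact ⟨fun ⟨k, h1, h2⟩ => ⟨k, h2.symm, h1⟩, fun ⟨k, h1, h2⟩ => ⟨k, h2, h1.symm⟩⟩

/-- The positions moved into or out of `queryPositions`. -/
def movedPositions {m ℓ : ℕ} (x : Fin ℓ → Bits m) {t : ℕ} (f : Fin ℓ → Fin ℓ ⊕ Fin t)
    (p : Bool × Fin m) : Finset (Fin ℓ ⊕ Fin t) :=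
  symmDiff (queryPositions x t p.1 p.2) ((Finset.univ.filter fun j => x j p.2 = p.1).image f)

open scoped Classical in
/-- The sets of positions whose parities are tested: pairs, and for every map of the query
positions one nontrivial set of moved positions, if there is any. -/
def testSet {m ℓ t : ℕ} (x : Fin ℓ → Bits m) :
    ((Fin ℓ ⊕ Fin t) × (Fin ℓ ⊕ Fin t)) ⊕ (Fin ℓ → Fin ℓ ⊕ Fin t) → Finset (Fin ℓ ⊕ Fin t)
  | .inl p => {p.1, p.2}
  -- A single choice of `p` for each `f` keeps the number of tests independent of `m`.
  | .inr f => if hf : ∃ p, (movedPositions x f p).Nontrivial then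
      movedPositions x f hf.choose else ∅

/-- The sets `queryPositions x t c i` containing a position reveal all bits of its query. Copies of
the common state lie in none of them, and `1 ≤ m` ensures that each query lies in at least one. -/
lemma rel_of_map_queryPositions {m ℓ t : ℕ} (hm : 1 ≤ m) {x : Fin ℓ → Bits m}
    (π : Equiv.Perm (Fin ℓ ⊕ Fin t))
    (hπ : ∀ c i, (queryPositions x t c i).image π = queryPositions x t c i)
    (j : Fin ℓ ⊕ Fin t) : label x t (π j) = label x t j := by
  have hmem : ∀ c i j, π j ∈ queryPositions x t c i ↔ j ∈ queryPositions x t c i := by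
    intro c i j
    conv_lhs => rw [← hπ c i, Finset.mem_image]
    exact ⟨fun ⟨k, hk, he⟩ => π.injective he ▸ hk, fun hj => ⟨j, hj, rfl⟩⟩
  rcases j with k | k
  · have h1 : ∀ i, ∃ k', π (.inl k) = .inl k' ∧ x k' i = x k i := fun i =>
      mem_queryPositions.1 ((hmem (x k i) i _).2 (mem_queryPositions.2 ⟨k, rfl, rfl⟩))
    obtain ⟨k', hk', -⟩ := h1 ⟨0, hm⟩
    rw [hk']
    simp only [label, Sum.elim_inl, Option.some.injEq]
    ext i
    obtain ⟨k'', hk'', he⟩ := h1 i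
    rw [hk'] at hk''
    rw [Sum.inl_injective hk'', he]
  · rcases hk : π (.inr k) with k' | k'
    · have h1 := (hmem (x k' ⟨0, hm⟩) ⟨0, hm⟩ (.inr k)).1
        (mem_queryPositions.2 ⟨k', hk, rfl⟩)
      obtain ⟨_, h2, -⟩ := mem_queryPositions.1 h1
      cases h2
    · rfl

/-- Equal block signs say that the signs of `u` have the same product over the query positions and
over their image under `π`. Common positions cancel because signs square to one; the symmetric
difference is left. -/
lemma parityEvent_movedPositions {m b n ℓ t : ℕ} (h : b ≤ n) {x : Fin ℓ → Bits m}
    {u v : Fin ℓ ⊕ Fin t → Bits n} (π : Equiv.Perm (Fin ℓ ⊕ Fin t)) (hv : ∀ j, v j = u (π j))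
    (hL : ∀ c i q, blockSign h x u c i q = blockSign h x v c i q) (p : Bool × Fin m) :
    ParityEvent h (movedPositions x (fun j => π (.inl j)) p) u := by
  intro q
  set A := queryPositions x t p.1 p.2
  set B := (Finset.univ.filter fun j => x j p.2 = p.1).image fun j => π (.inl j)
  let s : Fin ℓ ⊕ Fin t → ℝ := fun j => sgn (u j (Fin.castLE h q))
  have hA : ∏ j ∈ A, s j = blockSign h x u p.1 p.2 q := by
    simp [A, queryPositions, blockSign, s]
  have hB : ∏ j ∈ B, s j = blockSign h x v p.1 p.2 q := by
    rw [Finset.prod_image fun a _ c _ hac => Sum.inl_injective (π.injective hac)]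
    simp [blockSign, s, hv]
  have hsq : ∀ C : Finset (Fin ℓ ⊕ Fin t), (∏ j ∈ C, s j) * ∏ j ∈ C, s j = 1 := fun C => by
    rw [← Finset.prod_mul_distrib]
    exact Finset.prod_eq_one fun j _ => sgn_mul_self _
  have hD : ∏ j ∈ symmDiff A B, s j = (∏ j ∈ A, s j) * ∏ j ∈ B, s j := by
    rw [← Finset.prod_sdiff (Finset.inter_subset_left : A ∩ B ⊆ A),
      ← Finset.prod_sdiff (Finset.inter_subset_right : A ∩ B ⊆ B),
      show symmDiff A B = (A \ (A ∩ B)) ∪ (B \ (A ∩ B)) by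
        rw [Finset.sdiff_inter_self_left, Finset.sdiff_inter_self_right]; rfl,
      Finset.prod_union]
    · linear_combination (-(∏ j ∈ A \ (A ∩ B), s j) * ∏ j ∈ B \ (A ∩ B), s j) * hsq (A ∩ B)
    · rw [Finset.sdiff_inter_self_left, Finset.sdiff_inter_self_right]
      exact disjoint_sdiff_sdiff
  show ∏ j ∈ symmDiff A B, s j = 1
  rw [hD, hB, ← hL, ← hA, hsq]

/-- Two different finite sets of equal size each contain an element outside the other. -/
lemma movedPositions_nontrivial {m ℓ t : ℕ} {x : Fin ℓ → Bits m}
    (π : Equiv.Perm (Fin ℓ ⊕ Fin t)) {c : Bool} {i : Fin m}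
    (hne : (queryPositions x t c i).image π ≠ queryPositions x t c i) :
    (movedPositions x (fun j => π (.inl j)) (c, i)).Nontrivial := by
  have himg : (Finset.univ.filter fun j => x j i = c).image (fun j => π (.inl j)) =
      (queryPositions x t c i).image π := by
    rw [queryPositions, Finset.map_eq_image, Finset.image_image]
    rfl
  have hcard := Finset.card_image_of_injective (queryPositions x t c i) π.injective
  simp only [movedPositions, himg]
  set A := queryPositions x t c i
  set B := A.image π
  obtain ⟨j₁, h₁, h₁'⟩ : ∃ j ∈ A, j ∉ B := by
    by_contra! hs
    exact hne (Finset.eq_of_subset_of_card_le hs hcard.le).symm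
  obtain ⟨j₂, h₂, h₂'⟩ : ∃ j ∈ B, j ∉ A := by
    by_contra! hs
    exact hne (Finset.eq_of_subset_of_card_le hs hcard.ge)
  refine ⟨j₁, ?_, j₂, ?_, ?_⟩
  · exact Finset.mem_coe.2 (Finset.mem_symmDiff.2 (.inl ⟨h₁, h₁'⟩))
  · exact Finset.mem_coe.2 (Finset.mem_symmDiff.2 (.inr ⟨h₂, h₂'⟩))
  · rintro rfl
    exact h₂' h₁

lemma exists_parityEvent_of_not_good {m b n ℓ t : ℕ} (hm : 1 ≤ m) (h : b ≤ n)
    {x : Fin ℓ → Bits m} {u : Fin ℓ ⊕ Fin t → Bits n} (hu : ¬ Good h x u) :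
    ∃ d, (testSet x d).Nontrivial ∧ ParityEvent h (testSet x d) u := by
  by_cases hinj : Function.Injective u
  · obtain ⟨v, hv, hnot⟩ : ∃ v, KeyRel h x u v ∧ ¬ Rel (label x t) u v := by
      by_contra! h'
      exact hu ⟨hinj, h'⟩
    obtain ⟨⟨π, -, hπ⟩, hL⟩ := hv
    obtain ⟨c, i, hne⟩ : ∃ c i, (queryPositions x t c i).image π ≠ queryPositions x t c i := by
      by_contra! h'
      exact hnot ⟨π, rel_of_map_queryPositions hm π h', hπ⟩
    have hex : ∃ p, (movedPositions x (fun j => π (.inl j)) p).Nontrivial :=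
      ⟨(c, i), movedPositions_nontrivial π hne⟩
    -- Only the values of `π` at query positions enter the test. The chosen pair need not be `(c,
    -- i)`, but the parity condition holds for all pairs.
    refine ⟨.inr fun j => π (.inl j), ?_⟩
    rw [testSet, dif_pos hex]
    exact ⟨hex.choose_spec, parityEvent_movedPositions h π hπ hL _⟩
  · obtain ⟨j₁, j₂, he, hne⟩ := Function.not_injective_iff.1 hinj
    refine ⟨.inl (j₁, j₂), ?_, fun q => ?_⟩
    · exact ⟨j₁, by simp [testSet], j₂, by simp [testSet], hne⟩
    · simp only [testSet]
      rw [Finset.prod_pair hne, he, sgn_mul_self]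

open scoped Classical in
-- A union bound over the test sets. Trivial sets are excluded because the empty parity, for
-- instance, always holds.
lemma IsEnsemble.sum_not_good_le {Ω Y : Type} [TopologicalSpace Ω] [CompactSpace Ω]
    [MeasurableSpace Ω] [OpensMeasurableSpace Ω] {m b n ℓ t : ℕ}
    {μ : Measure Ω} [IsProbabilityMeasure μ]
    {lab : Fin ℓ ⊕ Fin t → Y} {ψ : Fin ℓ ⊕ Fin t → Ω → PureState n} (hE : IsEnsemble μ lab ψ)
    (hm : 1 ≤ m) (h : b ≤ n) (x : Fin ℓ → Bits m) :
    ∑ u : Fin ℓ ⊕ Fin t → Bits n with ¬ Good h x u, ∫ ω, ∏ j, (ψ j ω).prob (u j) ∂μ ≤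
      (((ℓ : ℝ) + t) ^ 2 + ((ℓ : ℝ) + t) ^ ℓ) * (3 / 2 ^ b) := by
  set p : (Fin ℓ ⊕ Fin t → Bits n) → ℝ := fun u => ∫ ω, ∏ j, (ψ j ω).prob (u j) ∂μ with hp
  have hp0 : ∀ u, 0 ≤ p u := fun u =>
    integral_nonneg fun ω => Finset.prod_nonneg fun j _ => (ψ j ω).prob_nonneg _
  calc ∑ u with ¬ Good h x u, p u
      ≤ ∑ u with ¬ Good h x u, ∑ d, if (testSet x d).Nontrivial ∧ ParityEvent h (testSet x d) u
          then p u else 0 := by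
        refine Finset.sum_le_sum fun u hu => ?_
        obtain ⟨d, hd⟩ := exists_parityEvent_of_not_good hm h (Finset.mem_filter.1 hu).2
        refine le_trans (le_of_eq ?_) (Finset.single_le_sum (fun d _ => ?_) (Finset.mem_univ d))
        · rw [if_pos hd]
        · split_ifs
          exacts [hp0 u, le_rfl]
    _ ≤ ∑ u, ∑ d, if (testSet x d).Nontrivial ∧ ParityEvent h (testSet x d) u
          then p u else 0 := by
        refine Finset.sum_le_sum_of_subset_of_nonneg (Finset.filter_subset _ _) fun u _ _ => ?_
        refine Finset.sum_nonneg fun d _ => ?_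
        split_ifs
        exacts [hp0 u, le_rfl]
    _ = ∑ d, ∑ u, if (testSet x d).Nontrivial ∧ ParityEvent h (testSet x d) u
          then p u else 0 := Finset.sum_comm
    _ ≤ ∑ _d : ((Fin ℓ ⊕ Fin t) × (Fin ℓ ⊕ Fin t)) ⊕ (Fin ℓ → Fin ℓ ⊕ Fin t), 3 / 2 ^ b := by
        refine Finset.sum_le_sum fun d _ => ?_
        by_cases hd : (testSet x d).Nontrivial
        · obtain ⟨j₁, h₁, j₂, h₂, hne⟩ := hd
          have := hE.parityEvent_le h h₁ h₂ hne
          rw [Finset.sum_filter] at this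
          refine le_trans (Finset.sum_le_sum fun u _ => ?_) this
          by_cases hpe : ParityEvent h (testSet x d) u
          · simp only [hpe, if_true, and_true]
            split_ifs
            exacts [le_rfl, hp0 u]
          · simp [hpe]
        · simp only [hd, false_and, if_false, Finset.sum_const_zero]
          positivity
    _ = _ := by
        rw [Finset.sum_const, Finset.card_univ, nsmul_eq_mul]
        congr 1
        simp
        ring

/-! ### The trace distance bound -/

lemma IsEnsemble.posSemidef_kernel {Ω J Y ι : Type} [TopologicalSpace Ω] [CompactSpace Ω]
    [MeasurableSpace Ω] [OpensMeasurableSpace Ω] [Fintype J] [Fintype ι] {n : ℕ}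
    {μ : Measure Ω} [IsProbabilityMeasure μ] {lab : J → Y} {ψ : J → Ω → PureState n}
    (hE : IsEnsemble μ lab ψ) (e : ι → J → Bits n) :
    (Matrix.of fun u v => kernel μ ψ (e u) (e v)).PosSemidef := by
  have h_entry : ∀ u v : ι, ∀ ω, ∏ j, ((ψ j ω).1 (e u j) * star ((ψ j ω).1 (e v j))) =
      (∏ j, (ψ j ω).1 (e u j)) * star (∏ j, (ψ j ω).1 (e v j)) := fun u v ω => by
    rw [Finset.prod_mul_distrib, star_prod]
  have h := posSemidef_integral (μ := μ) (fun ω (u : ι) => ∏ j, (ψ j ω).1 (e u j)) fun u v => by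
    simp only [← h_entry]
    exact integrable_of_continuous (hE.continuous_integrand (e u) (e v))
  simpa only [kernel, h_entry] using h

lemma posSemidef_idealAverage {m ℓ : ℕ} (n : ℕ) (x : Fin ℓ → Bits m) (t : ℕ) :
    (idealAverage n x t).PosSemidef := by
  convert (isEnsemble_idealFamily n x t).posSemidef_kernel (joinEquiv ℓ t n)
  ext u v
  exact idealAverage_apply n x t u v

/-- For each key the generator conjugates the Haar average by a diagonal sign matrix; the result is
a nonnegative combination of such conjugates. -/
lemma posSemidef_ggmRealAverage {m b n ℓ : ℕ} (h : b ≤ n) (x : Fin ℓ → Bits m) (t : ℕ) :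
    (ggmRealAverage b n x t).PosSemidef := by
  have hk := (isEnsemble_haar (Fin ℓ ⊕ Fin t) n).posSemidef_kernel (joinEquiv ℓ t n)
  set M : Op ((Fin ℓ → Bits n) × (Fin t → Bits n)) := Matrix.of fun u v =>
    kernel (haar n) (fun _ θ => θ) (joinEquiv ℓ t n u) (joinEquiv ℓ t n v)
  let D : BlockKey m b → Op ((Fin ℓ → Bits n) × (Fin t → Bits n)) := fun K =>
    Matrix.diagonal fun u => (maskSign h x K (joinEquiv ℓ t n u) : ℂ)
  have hsum := Matrix.posSemidef_sum Finset.univ fun K _ => hk.mul_mul_conjTranspose_same (D K)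
  have hc : (0 : ℂ) ≤ ((Fintype.card (BlockKey m b) : ℝ)⁻¹ : ℝ) := by
    exact_mod_cast inv_nonneg.2 (Nat.cast_nonneg' _)
  convert hsum.smul hc
  ext u v
  rw [ggmRealAverage_apply h, signAverage, Matrix.smul_apply, Matrix.sum_apply,
    Finset.expect_eq_sum_div_card]
  simp only [D, Matrix.diagonal_conjTranspose, Matrix.mul_diagonal, Matrix.diagonal_mul, M,
    Matrix.of_apply, Pi.star_apply, Complex.star_def, Complex.conj_ofReal, smul_eq_mul]
  push_cast
  rw [Finset.card_univ, div_eq_inv_mul, mul_assoc, Finset.sum_mul]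
  congr 1
  exact Finset.sum_congr rfl fun K _ => by ring

lemma ggmRealAverage_self {m b n ℓ : ℕ} (h : b ≤ n) (x : Fin ℓ → Bits m) (t : ℕ)
    (u : (Fin ℓ → Bits n) × (Fin t → Bits n)) :
    ggmRealAverage b n x t u u =
      ((∫ θ : PureState n, ∏ j, θ.prob (joinEquiv ℓ t n u j) ∂haar n : ℝ) : ℂ) := by
  rw [ggmRealAverage_apply h, signAverage_eq_one_of_rel h (Rel.refl _ _), kernel_self]
  simp

lemma idealAverage_self {m ℓ : ℕ} (n : ℕ) (x : Fin ℓ → Bits m) (t : ℕ)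
    (u : (Fin ℓ → Bits n) × (Fin t → Bits n)) :
    idealAverage n x t u u =
      ((∫ p, ∏ j, (idealFamily n x t j p).prob (joinEquiv ℓ t n u j) ∂haarFamily m n : ℝ) : ℂ) := by
  rw [idealAverage_apply, kernel_self]

lemma trace_ggmRealAverage {m b n ℓ : ℕ} (h : b ≤ n) (x : Fin ℓ → Bits m) (t : ℕ) :
    (ggmRealAverage b n x t).trace = 1 := by
  simp only [Matrix.trace, Matrix.diag_apply, ggmRealAverage_self h]
  rw [(joinEquiv ℓ t n).sum_comp
    fun u => ((∫ θ : PureState n, ∏ j, θ.prob (u j) ∂haar n : ℝ) : ℂ)]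
  exact_mod_cast (isEnsemble_haar (Fin ℓ ⊕ Fin t) n).sum_prob

lemma trace_idealAverage {m ℓ : ℕ} (n : ℕ) (x : Fin ℓ → Bits m) (t : ℕ) :
    (idealAverage n x t).trace = 1 := by
  simp only [Matrix.trace, Matrix.diag_apply, idealAverage_self]
  rw [(joinEquiv ℓ t n).sum_comp
    fun u => ((∫ p, ∏ j, (idealFamily n x t j p).prob (u j) ∂haarFamily m n : ℝ) : ℂ)]
  exact_mod_cast (isEnsemble_idealFamily n x t).sum_prob

open scoped Classical in
-- An unrelated entry vanishes for one of two reasons: either `v` is no permutation of `u`, and Haar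
-- phases kill it, or goodness supplies a block sign that differs, and the key average kills it.
lemma ggmRealAverage_of_good {m b n ℓ t : ℕ} (h : b ≤ n) (x : Fin ℓ → Bits m)
    {u v : (Fin ℓ → Bits n) × (Fin t → Bits n)} (hu : Good h x (joinEquiv ℓ t n u)) :
    ggmRealAverage b n x t u v =
      if Rel (label x t) (joinEquiv ℓ t n u) (joinEquiv ℓ t n v) then
        ((∫ θ : PureState n, ∏ j, θ.prob (joinEquiv ℓ t n u j) ∂haar n : ℝ) : ℂ) else 0 := by
  rw [ggmRealAverage_apply h]
  split_ifs with hr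
  · obtain ⟨π, -, hπ⟩ := id hr
    rw [signAverage_eq_one_of_rel h hr, kernel_eq_of_perm π (fun _ => rfl) hπ, kernel_self]
    simp
  · by_cases hr' : Rel (fun _ => ()) (joinEquiv ℓ t n u) (joinEquiv ℓ t n v)
    · obtain ⟨c, i, q, hne⟩ : ∃ c i q, blockSign h x (joinEquiv ℓ t n u) c i q ≠
          blockSign h x (joinEquiv ℓ t n v) c i q := by
        by_contra! hL
        exact hr (hu.2 _ ⟨hr', hL⟩)
      rw [signAverage_eq_zero h hne]
      simp
    · rw [(isEnsemble_haar (Fin ℓ ⊕ Fin t) n).kernel_eq_zero hr', mul_zero]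

open scoped Classical in
lemma idealAverage_eq {m n ℓ t : ℕ} (x : Fin ℓ → Bits m)
    (u v : (Fin ℓ → Bits n) × (Fin t → Bits n)) :
    idealAverage n x t u v =
      if Rel (label x t) (joinEquiv ℓ t n u) (joinEquiv ℓ t n v) then
        ((∫ p, ∏ j, (idealFamily n x t j p).prob (joinEquiv ℓ t n u j) ∂haarFamily m n : ℝ) : ℂ)
      else 0 := by
  rw [idealAverage_apply]
  split_ifs with hr
  · obtain ⟨π, hlab, hπ⟩ := hr
    rw [kernel_eq_of_perm π (fun j => ?_) hπ, kernel_self]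
    have := hlab j
    ext p
    rcases j with j | j <;> rcases hj : π _ with k | k <;> rw [hj] at this <;>
      simp_all [label, idealFamily]
  · exact (isEnsemble_idealFamily n x t).kernel_eq_zero hr

open scoped Classical in
lemma exists_posSemidef_ggm_sub_ideal {m b n ℓ : ℕ} (hm : 1 ≤ m) (h : b ≤ n) (x : Fin ℓ → Bits m)
    (t : ℕ) :
    ∃ A B : Op ((Fin ℓ → Bits n) × (Fin t → Bits n)), A.PosSemidef ∧ B.PosSemidef ∧
      ggmRealAverage b n x t - idealAverage n x t = A - B ∧
      A.trace.re + B.trace.re ≤ 12 * (((ℓ : ℝ) + t) ^ 2 + ((ℓ : ℝ) + t) ^ ℓ) / 2 ^ b := by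
  let good : (Fin ℓ → Bits n) × (Fin t → Bits n) → Prop := fun u => Good h x (joinEquiv ℓ t n u)
  let r : Setoid ((Fin ℓ → Bits n) × (Fin t → Bits n)) :=
    { r := fun u v => Rel (label x t) (joinEquiv ℓ t n u) (joinEquiv ℓ t n v)
      iseqv := ⟨fun _ => Rel.refl _ _, Rel.symm, Rel.trans⟩ }
  have hP := posSemidef_relation good r fun u v hu huv => hu.of_rel huv
  set P : Op ((Fin ℓ → Bits n) × (Fin t → Bits n)) :=
    Matrix.of fun u v => if good u ∧ r u v then (1 : ℂ) else 0
  have hPr : ∀ u v, good u → P u v =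
      if Rel (label x t) (joinEquiv ℓ t n u) (joinEquiv ℓ t n v) then 1 else 0 := by
    intro u v hu
    simp only [P, Matrix.of_apply, hu, true_and]
    rfl
  obtain ⟨a, ha⟩ : ∃ a : ℝ, ∀ u, good u →
      ∫ θ : PureState n, ∏ j, θ.prob (joinEquiv ℓ t n u j) ∂haar n = a := by
    by_cases hex : ∃ u, good u
    · obtain ⟨u₀, hu₀⟩ := hex
      refine ⟨∫ θ : PureState n, ∏ j, θ.prob (joinEquiv ℓ t n u₀ j) ∂haar n, fun u hu => ?_⟩
      have := (isEnsemble_haar (Fin ℓ ⊕ Fin t) n).kernel_self_eq hu.1 hu₀.1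
      rw [kernel_self, kernel_self] at this
      exact_mod_cast this
    · exact ⟨0, fun u hu => (hex ⟨u, hu⟩).elim⟩
  obtain ⟨c, hc⟩ : ∃ c : ℝ, ∀ u, good u →
      ∫ p, ∏ j, (idealFamily n x t j p).prob (joinEquiv ℓ t n u j) ∂haarFamily m n = c := by
    by_cases hex : ∃ u, good u
    · obtain ⟨u₀, hu₀⟩ := hex
      refine ⟨∫ p, ∏ j, (idealFamily n x t j p).prob (joinEquiv ℓ t n u₀ j) ∂haarFamily m n,
        fun u hu => ?_⟩
      have := (isEnsemble_idealFamily n x t).kernel_self_eq hu.1 hu₀.1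
      rw [kernel_self, kernel_self] at this
      exact_mod_cast this
    · exact ⟨0, fun u hu => (hex ⟨u, hu⟩).elim⟩
  obtain ⟨A, B, hA, hB, hAB, htr⟩ := exists_posSemidef_sub (posSemidef_ggmRealAverage h x t)
    (posSemidef_idealAverage n x t) hP (trace_ggmRealAverage h x t) (trace_idealAverage n x t)
    good a c
    (fun u v hu => by
      rw [ggmRealAverage_of_good h x hu, hPr u v hu, ha u hu]
      simp)
    (fun u v hu => by
      rw [idealAverage_eq, hPr u v hu, hc u hu]
      simp)
    (fun u v hu => by simp [P, hu])
  refine ⟨A, B, hA, hB, hAB, htr.trans ?_⟩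
  have h1 := (isEnsemble_haar (Fin ℓ ⊕ Fin t) n).sum_not_good_le hm h x
  have h2 := (isEnsemble_idealFamily n x t).sum_not_good_le hm h x
  rw [Finset.sum_filter, ← (joinEquiv ℓ t n).sum_comp] at h1 h2
  simp only [Finset.sum_filter, ggmRealAverage_self h, idealAverage_self, Complex.ofReal_re]
  calc _ ≤ 2 * ((((ℓ : ℝ) + t) ^ 2 + ((ℓ : ℝ) + t) ^ ℓ) * (3 / 2 ^ b) +
      (((ℓ : ℝ) + t) ^ 2 + ((ℓ : ℝ) + t) ^ ℓ) * (3 / 2 ^ b)) := by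
        gcongr
    _ = _ := by ring

/-- Without queries the key is irrelevant. This case stands apart because the collision term `t^2`
of the union bound is not controlled by `(ℓ+t)^(2ℓ) = 1`. -/
lemma ggmRealAverage_eq_idealAverage {m b n : ℕ} (h : b ≤ n) (x : Fin 0 → Bits m) (t : ℕ) :
    ggmRealAverage b n x t = idealAverage n x t := by
  ext u v
  rw [ggmRealAverage_apply h, idealAverage_apply]
  have hs : signAverage h x (joinEquiv 0 t n u) (joinEquiv 0 t n v) = 1 := by
    simp [signAverage, maskSign]
  have hsnd : MeasurePreserving Prod.snd (haarFamily m n) (haar n) := measurePreserving_snd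
  rw [hs, Complex.ofReal_one, one_mul, kernel, kernel, ← hsnd.map_eq,
    integral_map hsnd.measurable.aemeasurable
      ((isEnsemble_haar (Fin 0 ⊕ Fin t) n).continuous_integrand _ _).aestronglyMeasurable]
  congr 1
  ext p
  refine Finset.prod_congr rfl fun j _ => ?_
  rcases j with j | j
  · exact j.elim0
  · rfl

/-- The averaged states differ by a difference of positive semidefinite matrices of small trace. -/
lemma exists_posSemidef_ggm_sub_ideal_le {m b n ℓ : ℕ} (hm : 1 ≤ m) (h : b ≤ n)
    (x : Fin ℓ → Bits m) (t : ℕ) :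
    ∃ A B : Op ((Fin ℓ → Bits n) × (Fin t → Bits n)), A.PosSemidef ∧ B.PosSemidef ∧
      ggmRealAverage b n x t - idealAverage n x t = A - B ∧
      A.trace.re + B.trace.re ≤ 24 * ((ℓ : ℝ) + t) ^ (2 * ℓ) / 2 ^ b := by
  rcases Nat.eq_zero_or_pos ℓ with rfl | hℓ
  · refine ⟨0, 0, .zero, .zero, ?_, ?_⟩
    · rw [ggmRealAverage_eq_idealAverage h]
      simp
    · simp only [Matrix.trace_zero, Complex.zero_re, add_zero]
      positivity
  · obtain ⟨A, B, hA, hB, hAB, htr⟩ := exists_posSemidef_ggm_sub_ideal hm h x t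
    refine ⟨A, B, hA, hB, hAB, htr.trans ?_⟩
    have h1 : (1 : ℝ) ≤ (ℓ : ℝ) + t := by exact_mod_cast (Nat.le_add_right_of_le hℓ : 1 ≤ ℓ + t)
    have h2 : ((ℓ : ℝ) + t) ^ 2 ≤ ((ℓ : ℝ) + t) ^ (2 * ℓ) := pow_le_pow_right₀ h1 (by omega)
    have h3 : ((ℓ : ℝ) + t) ^ ℓ ≤ ((ℓ : ℝ) + t) ^ (2 * ℓ) := pow_le_pow_right₀ h1 (by omega)
    refine div_le_div_of_nonneg_right ?_ (by positivity)
    linarith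

theorem traceDist_ggm_ideal_le {m b n ℓ : ℕ} (hm : 1 ≤ m) (h : b ≤ n) (x : Fin ℓ → Bits m)
    (t : ℕ) : traceDist (ggmRealAverage b n x t) (idealAverage n x t) ≤
      12 * ((ℓ : ℝ) + t) ^ (2 * ℓ) / 2 ^ b := by
  obtain ⟨A, B, hA, hB, hAB, htr⟩ := exists_posSemidef_ggm_sub_ideal_le hm h x t
  rw [traceDist, hAB]
  have := traceNorm_sub_le hA hB
  calc traceNorm (A - B) / 2 ≤ (24 * ((ℓ : ℝ) + t) ^ (2 * ℓ) / 2 ^ b) / 2 := by linarith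
    _ = _ := by ring

/-! ### The function computed by the machine -/

/-- Adds the leading bits of `l` to the bits of `acc` if `d` is set. -/
def addBits (d : Bool) : List Bool → List Bool → List Bool
  | [], _ => []
  | v :: acc, l => xor v (l.head?.getD false && d) :: addBits d acc l.tail

/-- Adds those blocks of `l` to `acc` whose index `i` satisfies `xᵢ = c`; returns the sum and the
unused part of `l`. -/
def addBlocks (c : Bool) : List Bool → List Bool → List Bool → List Bool × List Bool
  | [], acc, l => (acc, l)
  | a :: x, acc, l => addBlocks c x (addBits (a == c) acc l) (l.drop acc.length)

/-- The sum of the blocks of the key selected by the input, and the unused part of the key. -/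
def maskAux (k x : List Bool) : List Bool × List Bool :=
  let r := addBlocks false x (List.replicate (k.length / (2 * x.length)) false) k
  addBlocks true x r.1 r.2

/-- Four `T` gates, that is, one `Z` gate, for every bit that is set. -/
def zGates : List Bool → ℕ → List Gate → List Gate
  | [], _, gs => gs
  | v :: acc, j, gs => zGates acc (j + 1) (if v then List.replicate 4 (.T (.data j)) ++ gs else gs)

/-- The circuit of the generator, as a function of the key and the input. -/
def ggmCircuit (p : List Bool × List Bool) : Circuit := ⟨0, zGates (maskAux p.1 p.2).1 0 []⟩

lemma length_addBits (d : Bool) (acc l : List Bool) : (addBits d acc l).length = acc.length := by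
  induction acc generalizing l with
  | nil => rfl
  | cons v acc ih => simp [addBits, ih]

lemma length_addBlocks (c : Bool) (x acc l : List Bool) :
    (addBlocks c x acc l).1.length = acc.length := by
  induction x generalizing acc l with
  | nil => rfl
  | cons a x ih => rw [addBlocks, ih, length_addBits]

lemma length_addBlocks_snd_le (c : Bool) (x acc l : List Bool) :
    (addBlocks c x acc l).2.length ≤ l.length := by
  induction x generalizing acc l with
  | nil => exact le_rfl
  | cons a x ih => exact (ih _ _).trans (by simp)

/-! ### The machine -/

namespace Machine

/-- The stacks: input, reversed key, key, queries and reversed queries, counter, accumulator,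
auxiliary stack, output. -/
inductive Stack : Type
  | inp | yek | key | qry | yrq | cnt | acc | aux | out
  deriving DecidableEq

instance : Fintype Stack where
  elems := {.inp, .yek, .key, .qry, .yrq, .cnt, .acc, .aux, .out}
  complete k := by cases k <;> simp

/-- The alphabets of the stacks. -/
def Letter : Stack → Type
  | .inp => Bool ⊕ Bool
  | .out => Sym
  | _ => Bool

inductive Label : Type
  | load | reverse | check | divide | restore | finish | rewind | emit
  | block (c : Bool) | add (c a : Bool) | back (c : Bool)
  | gate (r : Fin 4) | tick (r : Fin 4) | untick (r : Fin 4)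
  | cleanKey | cleanQry | cleanCnt
  deriving Fintype

/-- Two registers for symbols. -/
abbrev Regs : Type := Option Bool × Option Bool

abbrev Program : Type := Turing.TM2.Stmt Letter Label Regs

open Turing.TM2.Stmt

/-- Pops a bit into the first register and continues with `q₁` if there is one, otherwise with
`q₂`. -/
def popBit (k : Stack) (hk : Letter k = Bool) (q₁ q₂ : Program) : Program :=
  pop k (fun _ o => (o.map (cast hk), none)) (branch (fun s => s.1.isSome) q₁ q₂)

/-- Pushes the content of the first register. -/
def pushBit (k : Stack) (hk : Bool = Letter k) (q : Program) : Program :=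
  push k (fun s => cast hk (s.1.getD false)) q

def jump (l : Label) : Program := goto fun _ => l

def program : Label → Program
  | .load => pop .inp (fun _ o => match o with
      | some (.inl a) => (some a, none)
      | some (.inr a) => (none, some a)
      | none => (none, none))
      (branch (fun s => s.1.isSome) (pushBit .yek rfl (jump .load))
        (branch (fun s => s.2.isSome)
          (push .qry (fun s => (s.2.getD false : Bool)) (jump .load)) (jump .reverse)))
  | .reverse => popBit .yek rfl
      (pushBit .key rfl (push .cnt (fun _ => true) (jump .reverse))) (jump .check)
  | .check => peek .qry (fun _ o => (o, none))
      (branch (fun s => s.1.isSome) (jump .divide) (jump .cleanKey))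
  | .divide => popBit .qry rfl
      (pushBit .yrq rfl (pop .cnt (fun s _ => s) (pop .cnt (fun s o => (s.1, o))
        (branch (fun s => s.2.isSome) (jump .divide) (jump .finish)))))
      (push .acc (fun _ => false) (jump .restore))
  | .restore => popBit .yrq rfl (pushBit .qry rfl (jump .restore)) (jump .divide)
  | .finish => popBit .qry rfl (pushBit .yrq rfl (jump .finish)) (jump (.block false))
  | .block c => popBit .yrq rfl
      (pushBit .qry rfl (goto fun s => .add c (s.1.getD false)))
      (jump (if c then .emit else .rewind))
  | .rewind => popBit .qry rfl (pushBit .yrq rfl (jump .rewind)) (jump (.block true))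
  | .add c a => popBit .acc rfl
      (pop .key (fun s o => (s.1, o))
        (push .aux (fun s => xor (s.1.getD false) (s.2.getD false && (a == c)))
          (jump (.add c a))))
      (jump (.back c))
  | .back c => popBit .aux rfl (pushBit .acc rfl (jump (.back c))) (jump (.block c))
  | .emit => popBit .acc rfl
      (branch (fun s => s.1.getD false) (jump (.gate 0)) (push .cnt (fun _ => true) (jump .emit)))
      (jump .cleanKey)
  | .gate r => push .out (fun _ => Sym.t) (push .out (fun _ => Sym.data) (jump (.tick r)))
  | .tick r => popBit .cnt rfl
      (push .out (fun _ => Sym.tick) (pushBit .aux rfl (jump (.tick r)))) (jump (.untick r))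
  | .untick r => popBit .aux rfl (pushBit .cnt rfl (jump (.untick r)))
      (if r = 3 then push .cnt (fun _ => true) (jump .emit) else jump (.gate (r + 1)))
  | .cleanKey => popBit .key rfl (jump .cleanKey) (jump .cleanQry)
  | .cleanQry => popBit .qry rfl (jump .cleanQry) (jump .cleanCnt)
  | .cleanCnt => popBit .cnt rfl (jump .cleanCnt) (push .out (fun _ => Sym.start) halt)

instance : Fintype (Letter .inp) := inferInstanceAs (Fintype (Bool ⊕ Bool))

/-- The Turing machine that writes down the circuit of the generator. -/
def machine : Turing.FinTM2 where
  K := Stack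
  k₀ := .inp
  k₁ := .out
  Γ := Letter
  Λ := Label
  main := .load
  σ := Regs
  initialState := (none, none)
  m := program

/-- The contents of the stacks. -/
structure Mem : Type where
  inp : List (Bool ⊕ Bool) := []
  yek : List Bool := []
  key : List Bool := []
  qry : List Bool := []
  yrq : List Bool := []
  cnt : List Bool := []
  acc : List Bool := []
  aux : List Bool := []
  out : List Sym := []

def Mem.stk (s : Mem) : ∀ k, List (Letter k)
  | .inp => s.inp
  | .yek => s.yek
  | .key => s.key
  | .qry => s.qry
  | .yrq => s.yrq
  | .cnt => s.cnt
  | .acc => s.acc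
  | .aux => s.aux
  | .out => s.out

/-- A configuration of the machine. -/
def cfg (l : Option Label) (v : Regs) (s : Mem) : machine.Cfg := ⟨l, v, s.stk⟩

/-- Reachability in at most `n` steps. -/
def RunsIn (c c' : machine.Cfg) (n : ℕ) : Prop :=
  ∃ k ≤ n, (flip Bind.bind machine.step)^[k] (some c) = some c'

lemma RunsIn.trans {c c' c'' : machine.Cfg} {n n' : ℕ} (h : RunsIn c c' n)
    (h' : RunsIn c' c'' n') : RunsIn c c'' (n + n') := by
  obtain ⟨k, hk, e⟩ := h
  obtain ⟨k', hk', e'⟩ := h'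
  exact ⟨k' + k, by omega, by rw [Function.iterate_add_apply, e, e']⟩

lemma RunsIn.mono {c c' : machine.Cfg} {n n' : ℕ} (h : RunsIn c c' n) (hn : n ≤ n') :
    RunsIn c c' n' := by
  obtain ⟨k, hk, e⟩ := h
  exact ⟨k, hk.trans hn, e⟩

lemma RunsIn.of_step {l : Label} {v : Regs} {s : Mem} {l' : Option Label} {v' : Regs} {s' : Mem}
    (hl : (Turing.TM2.stepAux (program l) v s.stk).l = l')
    (hv : (Turing.TM2.stepAux (program l) v s.stk).var = v')
    (hs : ∀ k, (Turing.TM2.stepAux (program l) v s.stk).stk k = s'.stk k) :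
    RunsIn (cfg (some l) v s) (cfg l' v' s') 1 := by
  refine ⟨1, le_rfl, ?_⟩
  rw [cfg, cfg, ← hl, ← hv, ← funext hs]
  rfl

lemma RunsIn.step {l : Label} {v : Regs} {s : Mem} {l' : Option Label} {v' : Regs} {s' : Mem}
    {c : machine.Cfg} {n : ℕ} (h : RunsIn (cfg l' v' s') c n)
    (hl : (Turing.TM2.stepAux (program l) v s.stk).l = l')
    (hv : (Turing.TM2.stepAux (program l) v s.stk).var = v')
    (hs : ∀ k, (Turing.TM2.stepAux (program l) v s.stk).stk k = s'.stk k) :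
    RunsIn (cfg (some l) v s) c (n + 1) :=
  ((RunsIn.of_step hl hv hs).trans h).mono (by omega)

/-! ### Runs of the single loops of the machine -/

lemma run_load (v : Regs) (s : Mem) (k x : List Bool) :
    RunsIn (cfg (some .load) v { s with inp := k.map .inl ++ x.map .inr })
      (cfg (some .reverse) (none, none)
        { s with inp := [], yek := k.reverse ++ s.yek, qry := x.reverse ++ s.qry })
      (k.length + x.length + 1) := by
  induction k generalizing s v with
  | nil =>
    induction x generalizing s v with
    | nil => exact .of_step rfl rfl (by rintro ⟨⟩ <;> rfl)
    | cons a x ih =>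
      have := (ih (none, some a) { s with qry := a :: s.qry }).step (l := .load) (v := v)
        (s := { s with inp := .inr a :: x.map .inr }) rfl rfl (by rintro ⟨⟩ <;> rfl)
      simpa using this
  | cons a k ih =>
    have := (ih (some a, none) { s with yek := a :: s.yek }).step (l := .load) (v := v)
      (s := { s with inp := .inl a :: (k.map .inl ++ x.map .inr) }) rfl rfl
      (by rintro ⟨⟩ <;> rfl)
    simpa [add_right_comm] using this

lemma run_reverse (v : Regs) (s : Mem) (k : List Bool) :
    RunsIn (cfg (some .reverse) v { s with yek := k })
      (cfg (some .check) (none, none)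
        { s with yek := [], key := k.reverse ++ s.key,
                 cnt := List.replicate k.length true ++ s.cnt })
      (k.length + 1) := by
  induction k generalizing s v with
  | nil => exact .of_step rfl rfl (by rintro ⟨⟩ <;> rfl)
  | cons a k ih =>
    have := (ih (some a, none) { s with key := a :: s.key, cnt := true :: s.cnt }).step
      (l := .reverse) (v := v) (s := { s with yek := a :: k }) rfl rfl (by rintro ⟨⟩ <;> rfl)
    simpa [List.replicate_succ'] using this

lemma run_restore (v : Regs) (s : Mem) (y : List Bool) :
    RunsIn (cfg (some .restore) v { s with yrq := y })
      (cfg (some .divide) (none, none) { s with yrq := [], qry := y.reverse ++ s.qry })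
      (y.length + 1) := by
  induction y generalizing s v with
  | nil => exact .of_step rfl rfl (by rintro ⟨⟩ <;> rfl)
  | cons a y ih =>
    have := (ih (some a, none) { s with qry := a :: s.qry }).step (l := .restore) (v := v)
      (s := { s with yrq := a :: y }) rfl rfl (by rintro ⟨⟩ <;> rfl)
    simpa using this

lemma run_finish (v : Regs) (s : Mem) (y : List Bool) :
    RunsIn (cfg (some .finish) v { s with qry := y })
      (cfg (some (.block false)) (none, none) { s with qry := [], yrq := y.reverse ++ s.yrq })
      (y.length + 1) := by
  induction y generalizing s v with
  | nil => exact .of_step rfl rfl (by rintro ⟨⟩ <;> rfl)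
  | cons a y ih =>
    have := (ih (some a, none) { s with yrq := a :: s.yrq }).step (l := .finish) (v := v)
      (s := { s with qry := a :: y }) rfl rfl (by rintro ⟨⟩ <;> rfl)
    simpa using this

lemma run_rewind (v : Regs) (s : Mem) (y : List Bool) :
    RunsIn (cfg (some .rewind) v { s with qry := y })
      (cfg (some (.block true)) (none, none) { s with qry := [], yrq := y.reverse ++ s.yrq })
      (y.length + 1) := by
  induction y generalizing s v with
  | nil => exact .of_step rfl rfl (by rintro ⟨⟩ <;> rfl)
  | cons a y ih =>
    have := (ih (some a, none) { s with yrq := a :: s.yrq }).step (l := .rewind) (v := v)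
      (s := { s with qry := a :: y }) rfl rfl (by rintro ⟨⟩ <;> rfl)
    simpa using this

/-- One subtraction in a division by `2 * y.length`: each query bit consumes two counter symbols,
and a completed pass lengthens the zero accumulator by one. -/
lemma run_divide_pass (v : Regs) (s : Mem) (y : List Bool) (r : ℕ) :
    RunsIn (cfg (some .divide) v
        { s with qry := y, cnt := List.replicate (2 * y.length + r) true })
      (cfg (some .restore) (none, none)
        { s with qry := [], yrq := y.reverse ++ s.yrq, cnt := List.replicate r true,
                 acc := false :: s.acc })
      (y.length + 1) := by
  induction y generalizing s v with
  | nil =>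
    rw [show 2 * ([] : List Bool).length + r = r by simp]
    exact .of_step rfl rfl (by rintro ⟨⟩ <;> rfl)
  | cons a y ih =>
    have := (ih (some a, some true) { s with yrq := a :: s.yrq }).step (l := .divide) (v := v)
      (s := { s with qry := a :: y,
                     cnt := true :: true :: List.replicate (2 * y.length + r) true })
      rfl rfl (by rintro ⟨⟩ <;> rfl)
    rw [show 2 * (a :: y).length + r = 2 * y.length + r + 1 + 1 by simp; ring]
    simpa [List.replicate_succ] using this

/-- The counter runs out in the middle of this pass: the remainder is discarded and the quotient
stays as it is. -/
lemma run_divide_last (v : Regs) (s : Mem) (y : List Bool) (r : ℕ) (hr : r < 2 * y.length) :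
    RunsIn (cfg (some .divide) v { s with qry := y, cnt := List.replicate r true })
      (cfg (some (.block false)) (none, none)
        { s with qry := [], yrq := y.reverse ++ s.yrq, cnt := [] })
      (y.length + 1) := by
  induction y generalizing s v r with
  | nil => simp at hr
  | cons a y ih =>
    match r, hr with
    | 0, _ =>
      have := (run_finish (some a, none) { s with yrq := a :: s.yrq, cnt := [] } y).step
        (l := .divide) (v := v) (s := { s with qry := a :: y, cnt := [] })
        rfl rfl (by rintro ⟨⟩ <;> rfl)
      simpa using this
    | 1, _ =>
      have := (run_finish (some a, none) { s with yrq := a :: s.yrq, cnt := [] } y).step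
        (l := .divide) (v := v) (s := { s with qry := a :: y, cnt := [true] })
        rfl rfl (by rintro ⟨⟩ <;> rfl)
      simpa using this
    | r + 2, hr =>
      have := (ih (some a, some true) { s with yrq := a :: s.yrq } r (by
        simp at hr; omega)).step (l := .divide) (v := v)
        (s := { s with qry := a :: y, cnt := true :: true :: List.replicate r true })
        rfl rfl (by rintro ⟨⟩ <;> rfl)
      simpa [List.replicate_succ] using this

lemma run_divide (v : Regs) (s : Mem) (y : List Bool) (q r : ℕ) (hr : r < 2 * y.length) :
    RunsIn (cfg (some .divide) v
        { s with qry := y, yrq := [], cnt := List.replicate (2 * y.length * q + r) true })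
      (cfg (some (.block false)) (none, none)
        { s with qry := [], yrq := y.reverse, cnt := [],
                 acc := List.replicate q false ++ s.acc })
      ((q + 1) * (2 * y.length + 2)) := by
  induction q generalizing s v with
  | zero =>
    have := run_divide_last v { s with yrq := [] } y r hr
    simpa using this.mono (by omega : y.length + 1 ≤ 2 * y.length + 2)
  | succ q ih =>
    have h1 := run_divide_pass v { s with yrq := [] } y (2 * y.length * q + r)
    have h2 := run_restore (none, none)
      { s with qry := [], cnt := List.replicate (2 * y.length * q + r) true,
               acc := false :: s.acc } y.reverse
    have h3 := ih (none, none) { s with acc := false :: s.acc }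
    rw [show 2 * y.length * (q + 1) + r = 2 * y.length + (2 * y.length * q + r) by ring]
    simp only [List.append_nil, List.reverse_reverse, List.length_reverse] at h1 h2 h3
    have h4 := (h1.trans h2).trans h3
    rw [List.replicate_succ', List.append_assoc]
    exact h4.mono (by ring_nf; omega)

lemma run_add (c a : Bool) (v : Regs) (s : Mem) (acc l : List Bool) :
    RunsIn (cfg (some (.add c a)) v { s with acc := acc, key := l })
      (cfg (some (.back c)) (none, none)
        { s with acc := [], key := l.drop acc.length,
                 aux := (addBits (a == c) acc l).reverse ++ s.aux })
      (acc.length + 1) := by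
  induction acc generalizing s v l with
  | nil => exact .of_step rfl rfl (by rintro ⟨⟩ <;> rfl)
  | cons w acc ih =>
    have := (ih (some w, l.head?)
      { s with aux := xor w (l.head?.getD false && (a == c)) :: s.aux } l.tail).step
      (l := .add c a) (v := v) (s := { s with acc := w :: acc, key := l })
      rfl rfl (by rintro ⟨⟩ <;> rfl)
    simpa [addBits] using this

lemma run_back (c : Bool) (v : Regs) (s : Mem) (y : List Bool) :
    RunsIn (cfg (some (.back c)) v { s with aux := y })
      (cfg (some (.block c)) (none, none) { s with aux := [], acc := y.reverse ++ s.acc })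
      (y.length + 1) := by
  induction y generalizing s v with
  | nil => exact .of_step rfl rfl (by rintro ⟨⟩ <;> rfl)
  | cons a y ih =>
    have := (ih (some a, none) { s with acc := a :: s.acc }).step (l := .back c) (v := v)
      (s := { s with aux := a :: y }) rfl rfl (by rintro ⟨⟩ <;> rfl)
    simpa using this

lemma run_block (c : Bool) (v : Regs) (s : Mem) (y acc l : List Bool) :
    RunsIn (cfg (some (.block c)) v { s with yrq := y, acc := acc, key := l, aux := [] })
      (cfg (some (if c then .emit else .rewind)) (none, none)
        { s with yrq := [], qry := y.reverse ++ s.qry, acc := (addBlocks c y acc l).1,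
                 key := (addBlocks c y acc l).2, aux := [] })
      (y.length * (2 * acc.length + 3) + 1) := by
  induction y generalizing s v acc l with
  | nil =>
    refine RunsIn.mono (.of_step rfl rfl ?_) (by simp)
    rintro ⟨⟩ <;> rfl
  | cons a y ih =>
    have h1 := run_add c a (some a, none)
      { s with yrq := y, qry := a :: s.qry, aux := [] } acc l
    have h2 := run_back c (none, none)
      { s with yrq := y, qry := a :: s.qry, acc := [], key := l.drop acc.length }
      (addBits (a == c) acc l).reverse
    have h3 := ih (none, none) { s with qry := a :: s.qry } (addBits (a == c) acc l)
      (l.drop acc.length)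
    simp only [List.append_nil, List.reverse_reverse, List.length_reverse, length_addBits]
      at h1 h2 h3
    have h4 := ((h1.trans h2).trans h3).step (l := .block c) (v := v)
      (s := { s with yrq := a :: y, acc := acc, key := l, aux := [] })
      rfl rfl (by rintro ⟨⟩ <;> rfl)
    rw [List.reverse_cons, List.append_assoc]
    refine h4.mono ?_
    simp only [List.length_cons]
    ring_nf
    omega

lemma run_tick (r : Fin 4) (v : Regs) (s : Mem) (y : List Bool) :
    RunsIn (cfg (some (.tick r)) v { s with cnt := y })
      (cfg (some (.untick r)) (none, none)
        { s with cnt := [], aux := y.reverse ++ s.aux,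
                 out := List.replicate y.length .tick ++ s.out })
      (y.length + 1) := by
  induction y generalizing s v with
  | nil => exact .of_step rfl rfl (by rintro ⟨⟩ <;> rfl)
  | cons a y ih =>
    have := (ih (some a, none) { s with aux := a :: s.aux, out := .tick :: s.out }).step
      (l := .tick r) (v := v) (s := { s with cnt := a :: y }) rfl rfl (by rintro ⟨⟩ <;> rfl)
    simpa [List.replicate_succ'] using this

/-- The continuation after a gate has been written. -/
def afterGate (r : Fin 4) (s : Mem) : machine.Cfg :=
  if r = 3 then cfg (some .emit) (none, none) { s with cnt := true :: s.cnt }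
  else cfg (some (.gate (r + 1))) (none, none) s

lemma run_untick (r : Fin 4) (v : Regs) (s : Mem) (y : List Bool) :
    RunsIn (cfg (some (.untick r)) v { s with aux := y })
      (afterGate r { s with aux := [], cnt := y.reverse ++ s.cnt }) (y.length + 1) := by
  induction y generalizing s v with
  | nil =>
    fin_cases r <;> exact .of_step rfl rfl (by rintro ⟨⟩ <;> rfl)
  | cons a y ih =>
    have := (ih (some a, none) { s with cnt := a :: s.cnt }).step (l := .untick r) (v := v)
      (s := { s with aux := a :: y }) rfl rfl (by rintro ⟨⟩ <;> rfl)
    simpa using this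

/-- The output is a stack, so the code of a gate is pushed back to front. The wire number is copied
from the unary counter, which passes through `aux` and returns. -/
lemma run_gate (r : Fin 4) (v : Regs) (s : Mem) :
    RunsIn (cfg (some (.gate r)) v { s with aux := [] })
      (afterGate r { s with aux := [],
                            out := Gate.encode (.T (.data s.cnt.length)) ++ s.out })
      (2 * s.cnt.length + 3) := by
  have h1 := run_tick r v { s with aux := [], out := .data :: .t :: s.out } s.cnt
  have h2 := run_untick r (none, none)
    { s with cnt := [], out := List.replicate s.cnt.length .tick ++ .data :: .t :: s.out }
    s.cnt.reverse
  simp only [List.append_nil, List.reverse_reverse, List.length_reverse] at h1 h2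
  have h3 := (h1.trans h2).step (l := .gate r) (v := v) (s := { s with aux := [] })
    rfl rfl (by rintro ⟨⟩ <;> rfl)
  have h4 : Gate.encode (.T (.data s.cnt.length)) ++ s.out =
      List.replicate s.cnt.length .tick ++ .data :: .t :: s.out := by
    simp [Gate.encode, Wire.encode]
  rw [h4]
  exact h3.mono (by omega)

lemma run_gates (v : Regs) (s : Mem) :
    RunsIn (cfg (some (.gate 0)) v { s with aux := [] })
      (cfg (some .emit) (none, none)
        { s with aux := [], cnt := true :: s.cnt, out :=
          (List.replicate 4 (Gate.T (.data s.cnt.length))).flatMap Gate.encode ++ s.out })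
      (4 * (2 * s.cnt.length + 3)) := by
  set e := Gate.encode (.T (.data s.cnt.length)) with he
  have h0 := run_gate 0 v s
  have h1 := run_gate 1 (none, none) { s with out := e ++ s.out }
  have h2 := run_gate 2 (none, none) { s with out := e ++ (e ++ s.out) }
  have h3 := run_gate 3 (none, none) { s with out := e ++ (e ++ (e ++ s.out)) }
  have h := ((h0.trans h1).trans h2).trans h3
  have hout : (List.replicate 4 (Gate.T (.data s.cnt.length))).flatMap Gate.encode ++ s.out =
      e ++ (e ++ (e ++ (e ++ s.out))) := by
    simp [List.replicate_succ, he]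
  rw [hout]
  exact h.mono (by dsimp only; omega)

/-- The counter holds the index of the current bit in unary. Only its final length is recorded,
since it is erased afterwards. -/
lemma run_emit (v : Regs) (s : Mem) (acc : List Bool) (gs : List Gate)
    (hs : s.out = gs.flatMap Gate.encode) :
    ∃ c : List Bool, c.length = s.cnt.length + acc.length ∧
    RunsIn (cfg (some .emit) v { s with acc := acc, aux := [] })
      (cfg (some .cleanKey) (none, none)
        { s with acc := [], aux := [], cnt := c,
                 out := (zGates acc s.cnt.length gs).flatMap Gate.encode })
      (acc.length * (8 * (s.cnt.length + acc.length) + 13) + 1) := by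
  induction acc generalizing s v gs with
  | nil =>
    refine ⟨s.cnt, rfl, RunsIn.mono (.of_step rfl rfl ?_) (by simp)⟩
    rw [zGates, ← hs]
    rintro ⟨⟩ <;> rfl
  | cons a acc ih =>
    cases a with
    | false =>
      obtain ⟨c, hc, h⟩ := ih (some false, none) { s with cnt := true :: s.cnt } gs hs
      refine ⟨c, by simp at hc ⊢; omega, ?_⟩
      have h1 := h.step (l := .emit) (v := v) (s := { s with acc := false :: acc, aux := [] })
        rfl rfl (by rintro ⟨⟩ <;> rfl)
      refine h1.mono ?_
      simp only [List.length_cons]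
      ring_nf
      omega
    | true =>
      have h0 := run_gates (some true, none) { s with acc := acc }
      obtain ⟨c, hc, h⟩ := ih (none, none)
        { s with cnt := true :: s.cnt, out :=
          (List.replicate 4 (Gate.T (.data s.cnt.length))).flatMap Gate.encode ++ s.out }
        (List.replicate 4 (Gate.T (.data s.cnt.length)) ++ gs) (by simp [hs])
      refine ⟨c, by simp at hc ⊢; omega, ?_⟩
      have h1 := (h0.trans h).step (l := .emit) (v := v)
        (s := { s with acc := true :: acc, aux := [] }) rfl rfl (by rintro ⟨⟩ <;> rfl)
      refine h1.mono ?_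
      simp only [List.length_cons]
      ring_nf
      omega

lemma run_cleanCnt (v : Regs) (s : Mem) (y : List Bool) :
    RunsIn (cfg (some .cleanCnt) v { s with cnt := y })
      (cfg none (none, none) { s with cnt := [], out := .start :: s.out }) (y.length + 1) := by
  induction y generalizing v with
  | nil => exact .of_step rfl rfl (by rintro ⟨⟩ <;> rfl)
  | cons a y ih =>
    exact (ih (some a, none)).step rfl rfl (by rintro ⟨⟩ <;> rfl)

lemma run_cleanQry (v : Regs) (s : Mem) (y : List Bool) :
    RunsIn (cfg (some .cleanQry) v { s with qry := y })
      (cfg (some .cleanCnt) (none, none) { s with qry := [] }) (y.length + 1) := by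
  induction y generalizing v with
  | nil => exact .of_step rfl rfl (by rintro ⟨⟩ <;> rfl)
  | cons a y ih =>
    exact (ih (some a, none)).step rfl rfl (by rintro ⟨⟩ <;> rfl)

lemma run_cleanKey (v : Regs) (s : Mem) (y : List Bool) :
    RunsIn (cfg (some .cleanKey) v { s with key := y })
      (cfg (some .cleanQry) (none, none) { s with key := [] }) (y.length + 1) := by
  induction y generalizing v with
  | nil => exact .of_step rfl rfl (by rintro ⟨⟩ <;> rfl)
  | cons a y ih =>
    exact (ih (some a, none)).step rfl rfl (by rintro ⟨⟩ <;> rfl)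

lemma run_clean (v : Regs) (s : Mem) :
    RunsIn (cfg (some .cleanKey) v s)
      (cfg none (none, none) { s with key := [], qry := [], cnt := [], out := .start :: s.out })
      (s.key.length + s.qry.length + s.cnt.length + 3) := by
  have h := ((run_cleanKey v s s.key).trans
    (run_cleanQry (none, none) { s with key := [] } s.qry)).trans
    (run_cleanCnt (none, none) { s with key := [], qry := [] } s.cnt)
  exact h.mono (by omega)

end Machine

/-! ### The complete run and its polynomial time bound -/

namespace Machine

lemma run_check_nil (v : Regs) (s : Mem) :
    RunsIn (cfg (some .check) v { s with qry := [] })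
      (cfg (some .cleanKey) (none, none) { s with qry := [] }) 1 :=
  .of_step rfl rfl (by rintro ⟨⟩ <;> rfl)

lemma run_check_cons (v : Regs) (s : Mem) (a : Bool) (y : List Bool) :
    RunsIn (cfg (some .check) v { s with qry := a :: y })
      (cfg (some .divide) (some a, none) { s with qry := a :: y }) 1 :=
  .of_step rfl rfl (by rintro ⟨⟩ <;> rfl)

lemma length_maskAux (k x : List Bool) :
    (maskAux k x).1.length = k.length / (2 * x.length) := by
  rw [maskAux, length_addBlocks, length_addBlocks, List.length_replicate]

lemma length_maskAux_snd_le (k x : List Bool) : (maskAux k x).2.length ≤ k.length :=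
  (length_addBlocks_snd_le _ _ _ _).trans (length_addBlocks_snd_le _ _ _ _)

lemma run_prepare (k x : List Bool) :
    RunsIn (cfg (some .load) (none, none) { inp := k.map .inl ++ x.map .inr })
      (cfg (some .check) (none, none)
        { key := k, qry := x.reverse, cnt := List.replicate k.length true })
      (2 * k.length + x.length + 2) := by
  have h1 := run_load (none, none) {} k x
  have h2 := run_reverse (none, none) { qry := x.reverse } k.reverse
  simp only [List.append_nil, List.reverse_reverse, List.length_reverse] at h1 h2
  exact (h1.trans h2).mono (by omega)

lemma run_divided (v : Regs) (k x : List Bool) (hx : x ≠ []) :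
    RunsIn (cfg (some .divide) v
        { key := k, qry := x.reverse, cnt := List.replicate k.length true })
      (cfg (some (.block false)) (none, none)
        { key := k, yrq := x, acc := List.replicate (k.length / (2 * x.length)) false })
      ((k.length / (2 * x.length) + 1) * (2 * x.length + 2)) := by
  have hpos : 0 < 2 * x.length := by
    have := List.length_pos_iff.2 hx
    omega
  have h := run_divide v { key := k } x.reverse (k.length / (2 * x.length))
    (k.length % (2 * x.length)) (by simpa using Nat.mod_lt _ hpos)
  simpa [Nat.div_add_mod] using h

lemma run_blocks (v : Regs) (k x : List Bool) :
    RunsIn (cfg (some (.block false)) v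
        { key := k, yrq := x, acc := List.replicate (k.length / (2 * x.length)) false })
      (cfg (some .emit) (none, none)
        { key := (maskAux k x).2, qry := x.reverse, acc := (maskAux k x).1 })
      (2 * (x.length * (2 * (k.length / (2 * x.length)) + 3) + 1) + x.length + 1) := by
  have h1 := run_block false v {} x (List.replicate (k.length / (2 * x.length)) false) k
  set r := addBlocks false x (List.replicate (k.length / (2 * x.length)) false) k with hr
  have hlen : r.1.length = k.length / (2 * x.length) := by
    rw [hr, length_addBlocks, List.length_replicate]
  have h2 := run_rewind (none, none) { acc := r.1, key := r.2 } x.reverse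
  have h3 := run_block true (none, none) {} x r.1 r.2
  simp only [List.append_nil, List.reverse_reverse, List.length_reverse, List.length_replicate,
    hlen, Bool.false_eq_true, if_false, if_true] at h1 h2 h3
  exact ((h1.trans h2).trans h3).mono (by omega)

lemma run_machine (k x : List Bool) :
    RunsIn (cfg (some .load) (none, none) { inp := k.map .inl ++ x.map .inr })
      (cfg none (none, none) { out := (ggmCircuit (k, x)).encode })
      (100 * (k.length + x.length + 1) ^ 2) := by
  have hout : (ggmCircuit (k, x)).encode =
      .start :: (zGates (maskAux k x).1 0 []).flatMap Gate.encode := by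
    simp [ggmCircuit, Circuit.encode]
  have h1 := run_prepare k x
  rcases x.eq_nil_or_concat with rfl | ⟨x', a, hx⟩
  -- On an empty input the division loop would never end, so the machine skips it; division by zero
  -- yields 0, which agrees with an empty mask.
  · have h2 := run_check_nil (none, none)
      { key := k, cnt := List.replicate k.length true }
    have h3 := run_clean (none, none) { key := k, cnt := List.replicate k.length true }
    have hm : (maskAux k []).1 = [] := List.length_eq_zero_iff.1 (by rw [length_maskAux]; simp)
    rw [hout, hm]
    refine ((h1.trans h2).trans h3).mono ?_
    simp
    nlinarith
  · have hx' : x.reverse = a :: x'.reverse := by simp [hx]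
    have h2 := run_check_cons (none, none)
      { key := k, cnt := List.replicate k.length true } a x'.reverse
    rw [← hx'] at h2
    have h3 := run_divided (some a, none) k x (by simp [hx])
    have h4 := run_blocks (none, none) k x
    obtain ⟨c, hc, h5⟩ := run_emit (none, none)
      { key := (maskAux k x).2, qry := x.reverse } (maskAux k x).1 [] rfl
    have h6 := run_clean (none, none) { key := (maskAux k x).2, qry := x.reverse, cnt := c, out :=
      (zGates (maskAux k x).1 0 []).flatMap Gate.encode }
    rw [hout]
    refine (((((h1.trans h2).trans h3).trans h4).trans h5).trans h6).mono ?_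
    simp only [List.length_nil, zero_add, length_maskAux] at hc ⊢
    rw [hc, List.length_reverse]
    have hL := length_maskAux_snd_le k x
    -- This makes the products of input length and block length linear in the key length; only the
    -- emission time is quadratic in the block length.
    have hb : 2 * x.length * (k.length / (2 * x.length)) ≤ k.length := Nat.mul_div_le _ _
    have hb' : k.length / (2 * x.length) ≤ k.length := Nat.div_le_self _ _
    set b := k.length / (2 * x.length)
    set L := (maskAux k x).2.length
    generalize k.length = K at *
    generalize x.length = m at *
    have e1 : b * b ≤ K * K := Nat.mul_le_mul hb' hb'
    nlinarith [Nat.zero_le (K * m), Nat.zero_le (m * m)]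

lemma initList_machine (l : List (Bool ⊕ Bool)) :
    Turing.initList machine l = cfg (some .load) (none, none) { inp := l } := by
  refine congrArg (Turing.TM2.Cfg.mk _ _) (funext fun k => ?_)
  cases k <;> rfl

lemma haltList_machine (l : List Sym) :
    Turing.haltList machine l = cfg none (none, none) { out := l } := by
  refine congrArg (Turing.TM2.Cfg.mk _ _) (funext fun k => ?_)
  cases k <;> rfl

/-- The circuit of the generator is computable in polynomial time. -/
def computableInPolyTime :
    Turing.TM2ComputableInPolyTime bitsPairEncoding.encode circuitEncoding.encode ggmCircuit where
  tm := machine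
  inputAlphabet := Equiv.refl _
  outputAlphabet := Equiv.refl _
  time := 100 * (Polynomial.X + 1) ^ 2
  outputsFun p := by
    have e1 : List.map (Equiv.refl (Bool ⊕ Bool)).invFun (bitsPairEncoding.encode p) =
        p.1.map .inl ++ p.2.map .inr := List.map_id _
    have e2 : List.map (Equiv.refl Sym).invFun (circuitEncoding.encode (ggmCircuit p)) =
        (ggmCircuit p).encode := List.map_id _
    have h : RunsIn
        (Turing.initList machine
          (List.map (Equiv.refl (Bool ⊕ Bool)).invFun (bitsPairEncoding.encode p)))
        (Turing.haltList machine
          (List.map (Equiv.refl Sym).invFun (circuitEncoding.encode (ggmCircuit p))))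
        (100 * (p.1.length + p.2.length + 1) ^ 2) :=
      (congrArg₂ (fun c c' => RunsIn c c' _)
        ((initList_machine _).trans
          (congrArg (fun l => cfg (some .load) (none, none) { inp := l }) e1))
        ((haltList_machine _).trans
          (congrArg (fun l => cfg none (none, none) { out := l }) e2))).mpr (run_machine p.1 p.2)
    refine ⟨⟨h.choose, h.choose_spec.2⟩, ?_⟩
    refine h.choose_spec.1.trans (le_of_eq ?_)
    simp [bitsPairEncoding, encodingProd, encodingList]

end Machine

/-! ### The circuit implements the generator -/

lemma sgn_xor (a b : Bool) : sgn (xor a b) = sgn a * sgn b := by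
  cases a <;> cases b <;> simp

lemma sgn_and (a d : Bool) : sgn (a && d) = if d then sgn a else 1 := by
  cases a <;> cases d <;> simp

lemma sgn_injective : Function.Injective sgn := by
  intro a b h
  cases a <;> cases b <;> first | rfl | (norm_num at h)

lemma sgn_ggmMask {m b : ℕ} (K : BlockKey m b) (y : Bits m) (q : Fin b) :
    sgn (ggmMask K y q) = ∏ i, sgn (K (y i) i q) := by
  have h1 : ∀ i, sgn (K (y i) i q) = if K (y i) i q = true then -1 else 1 := fun i => rfl
  simp only [h1]
  rw [Finset.prod_ite]
  simp only [Finset.prod_const, one_pow, mul_one, ggmMask]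
  by_cases ho : Odd (Finset.univ.filter fun i : Fin m => K (y i) i q = true).card
  · simp [ho, ho.neg_one_pow]
  · simp [ho, (Nat.not_odd_iff_even.1 ho).neg_one_pow]

lemma getD_addBits (d : Bool) (acc l : List Bool) (j : ℕ) (hj : j < acc.length) :
    (addBits d acc l).getD j false = xor (acc.getD j false) (l.getD j false && d) := by
  induction acc generalizing l j with
  | nil => simp at hj
  | cons v acc ih =>
    rcases j with - | j
    · cases l <;> simp [addBits]
    · rw [addBits, List.getD_cons_succ, List.getD_cons_succ, ih _ _ (by simpa using hj)]
      cases l <;> simp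

lemma addBlocks_snd (c : Bool) (x acc l : List Bool) :
    (addBlocks c x acc l).2 = l.drop (x.length * acc.length) := by
  induction x generalizing acc l with
  | nil => simp [addBlocks]
  | cons a x ih =>
    rw [addBlocks, ih, length_addBits, List.drop_drop]
    congr 1
    simp only [List.length_cons]
    ring

lemma getD_drop (l : List Bool) (i j : ℕ) : (l.drop i).getD j false = l.getD (i + j) false := by
  simp [List.getD_eq_getElem?_getD, List.getElem?_drop]

lemma sgn_addBlocks (c : Bool) (x acc l : List Bool) (j : ℕ) (hj : j < acc.length) :
    sgn ((addBlocks c x acc l).1.getD j false) = sgn (acc.getD j false) *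
      ∏ i ∈ Finset.range x.length,
        if x.getD i false = c then sgn (l.getD (i * acc.length + j) false) else 1 := by
  induction x generalizing acc l with
  | nil => simp [addBlocks]
  | cons a x ih =>
    rw [addBlocks, ih _ _ (by rwa [length_addBits]), getD_addBits _ _ _ _ hj, sgn_xor, sgn_and,
      List.length_cons, Finset.prod_range_succ', mul_assoc]
    congr 1
    rw [mul_comm]
    simp only [List.getD_cons_zero, List.getD_cons_succ, zero_mul, zero_add, beq_iff_eq,
      length_addBits, getD_drop]
    congr 1
    refine Finset.prod_congr rfl fun i _ => ?_
    rw [show acc.length + (i * acc.length + j) = (i + 1) * acc.length + j by ring]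

lemma getD_ofFn {n : ℕ} (f : Fin n → Bool) (i : ℕ) (hi : i < n) :
    (List.ofFn f).getD i false = f ⟨i, hi⟩ := by
  simp [List.getD_eq_getElem?_getD, hi]

/-- Signs turn sums of bits into products. The first pass consumes the `m` blocks for bit value
`false`, so the second starts exactly where `keyBlocks` places the blocks for `true`. -/
lemma getD_maskAux {lam m : ℕ} (k : Bits lam) (x : Bits m) (q : Fin (lam / (2 * m))) :
    (maskAux (List.ofFn k) (List.ofFn x)).1.getD q false = ggmMask (keyBlocks m k) x q := by
  apply sgn_injective
  have hlen : (List.replicate (lam / (2 * m)) false).length = lam / (2 * m) := by simp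
  rw [sgn_ggmMask, maskAux]
  simp only [List.length_ofFn]
  rw [sgn_addBlocks _ _ _ _ _ (by rw [length_addBlocks, hlen]; exact q.2),
    sgn_addBlocks _ _ _ _ _ (by rw [hlen]; exact q.2), addBlocks_snd]
  simp only [List.length_ofFn, length_addBlocks, hlen, getD_drop]
  have hrep : (List.replicate (lam / (2 * m)) false).getD q false = false := by
    simp [List.getD_eq_getElem?_getD]
  rw [hrep, sgn_false, one_mul, ← Finset.prod_mul_distrib,
    Finset.prod_range]
  refine Finset.prod_congr rfl fun i _ => ?_
  rw [getD_ofFn x i i.2, Fin.eta, keyBlocks]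
  cases hx : x i
  · have h := block_index_lt (lam := lam) false i q
    rw [getD_ofFn k _ (by simpa using h)]
    simp
  · have h := block_index_lt (lam := lam) true i q
    have e : m * (lam / (2 * m)) + (i * (lam / (2 * m)) + q) =
        (true.toNat * m + i) * (lam / (2 * m)) + q := by
      simp only [Bool.toNat_true]
      ring
    rw [e, getD_ofFn k _ h]
    simp

lemma zGates_cases {acc : List Bool} {j : ℕ} {gs : List Gate} {g : Gate}
    (hg : g ∈ zGates acc j gs) :
    g ∈ gs ∨ ∃ i, i < j + acc.length ∧ g = .T (.data i) := by
  induction acc generalizing j gs with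
  | nil => exact .inl hg
  | cons v acc ih =>
    rcases ih hg with h | ⟨i, hi, h⟩
    · split_ifs at h
      · rcases List.mem_append.1 h with h | h
        · exact .inr ⟨j, by simp, List.eq_of_mem_replicate h⟩
        · exact .inl h
      · exact .inl h
    · exact .inr ⟨i, by simp only [List.length_cons]; omega, h⟩

/-- The phase that a `T` gate on an input qubit contributes to a basis vector. -/
def tPhase {n a : ℕ} (s : Fin n ⊕ Fin a → Bool) : Gate → ℂ
  | .T (.data j) => if h : j < n then
      (if s (.inl ⟨j, h⟩) then Complex.exp (Real.pi / 4 * Complex.I) else 1) else 1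
  | _ => 1

lemma onQubit_tGate {W : Type} [Fintype W] [DecidableEq W] (w : W) :
    onQubit w tGate = Matrix.diagonal fun s : W → Bool =>
      if s w then Complex.exp (Real.pi / 4 * Complex.I) else 1 := by
  ext u v
  rw [onQubit, tensorPi, Matrix.of_apply, Matrix.diagonal_apply]
  split_ifs with huv hw
  · subst huv
    rw [Finset.prod_eq_single w]
    · simp [tGate, hw]
    · intro i _ hi
      simp [hi]
    · simp
  · subst huv
    rw [Finset.prod_eq_single w]
    · simp [tGate, hw]
    · intro i _ hi
      simp [hi]
    · simp
  · obtain ⟨i, hi⟩ := Function.ne_iff.1 huv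
    refine Finset.prod_eq_zero (Finset.mem_univ i) ?_
    split_ifs <;> simp [tGate, hi]

lemma gate_op_eq_diagonal {n a j : ℕ} (hj : j < n) :
    Gate.op n a (.T (.data j)) = Matrix.diagonal fun s => tPhase s (.T (.data j)) := by
  simp [Gate.op, Wire.resolve, hj, onQubit_tGate, tPhase]

lemma gatesOp_eq_diagonal {n a : ℕ} (gs : List Gate)
    (hgs : ∀ g ∈ gs, ∃ j < n, g = .T (.data j)) :
    gatesOp n a gs = Matrix.diagonal fun s => (gs.map (tPhase s)).prod := by
  have key : ∀ d : (Fin n ⊕ Fin a → Bool) → ℂ,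
      gs.foldl (fun U g => g.op n a * U) (Matrix.diagonal d) =
        Matrix.diagonal fun s => (gs.map (tPhase s)).prod * d s := by
    induction gs with
    | nil => intro d; simp
    | cons g gs ih =>
      intro d
      obtain ⟨j, hj, rfl⟩ := hgs g (by simp)
      rw [List.foldl_cons, gate_op_eq_diagonal hj, Matrix.diagonal_mul_diagonal,
        ih fun g hg => hgs g (by simp [hg])]
      congr 1
      ext s
      simp only [List.map_cons, List.prod_cons]
      ring
  rw [gatesOp, ← Matrix.diagonal_one, key]
  simp

lemma tPhase_pow_four {n a j : ℕ} (hj : j < n) (s : Fin n ⊕ Fin a → Bool) :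
    tPhase s (.T (.data j)) ^ 4 = (sgn (s (.inl ⟨j, hj⟩)) : ℂ) := by
  simp only [tPhase, hj, dif_pos]
  cases s (.inl ⟨j, hj⟩)
  · simp
  · simp only [if_true, ← Complex.exp_nat_mul, sgn_true]
    rw [show ((4 : ℕ) : ℂ) * (Real.pi / 4 * Complex.I) = Real.pi * Complex.I by push_cast; ring,
      Complex.exp_pi_mul_I]
    simp

lemma prod_tPhase_zGates {n a : ℕ} (s : Fin n ⊕ Fin a → Bool) (acc : List Bool) (j : ℕ)
    (gs : List Gate) :
    ((zGates acc j gs).map (tPhase s)).prod =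
      (∏ i ∈ Finset.range acc.length,
        if acc.getD i false then tPhase s (.T (.data (j + i))) ^ 4 else 1) *
        (gs.map (tPhase s)).prod := by
  induction acc generalizing j gs with
  | nil => simp [zGates]
  | cons v acc ih =>
    rw [zGates, ih, List.length_cons, Finset.prod_range_succ', mul_assoc]
    congr 1
    · refine Finset.prod_congr rfl fun i _ => ?_
      rw [List.getD_cons_succ, show j + 1 + i = j + (i + 1) by ring]
    · cases v
      · simp
      · simp
        ring

lemma ggmCircuit_gates {lam m n : ℕ} (h : lam / (2 * m) ≤ n) (k : Bits lam) (x : Bits m) :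
    ∀ g ∈ (ggmCircuit (List.ofFn k, List.ofFn x)).gates, ∃ j < n, g = .T (.data j) := by
  intro g hg
  rcases zGates_cases hg with hg | ⟨j, hj, rfl⟩
  · simp at hg
  · refine ⟨j, ?_, rfl⟩
    rw [Machine.length_maskAux, List.length_ofFn, List.length_ofFn] at hj
    omega

lemma ggmCircuit_wellFormed {lam m n : ℕ} (h : lam / (2 * m) ≤ n) (k : Bits lam) (x : Bits m) :
    (ggmCircuit (List.ofFn k, List.ofFn x)).WellFormed n := by
  intro g hg
  obtain ⟨j, hj, rfl⟩ := ggmCircuit_gates h k x g hg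
  simp [Gate.WellFormed, Wire.resolve, hj]

lemma gatesOp_ggmCircuit {lam m n : ℕ} (h : lam / (2 * m) ≤ n) (k : Bits lam) (x : Bits m) :
    gatesOp n 0 (ggmCircuit (List.ofFn k, List.ofFn x)).gates =
      Matrix.diagonal fun s => (chi h (ggmMask (keyBlocks m k) x) fun i => s (.inl i) : ℂ) := by
  rw [gatesOp_eq_diagonal _ (ggmCircuit_gates h k x)]
  congr 1
  ext s
  rw [ggmCircuit, prod_tPhase_zGates, Machine.length_maskAux]
  simp only [List.length_ofFn, List.map_nil, List.prod_nil, mul_one]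
  rw [Finset.prod_range, chi, Complex.ofReal_prod]
  refine Finset.prod_congr rfl fun q _ => ?_
  rw [getD_maskAux k x q, zero_add, tPhase_pow_four (q.2.trans_le h)]
  split_ifs <;> rfl

lemma run_ggmCircuit {lam m n : ℕ} (h : lam / (2 * m) ≤ n) (k : Bits lam) (x : Bits m)
    (ρ : Op (Bits n)) :
    (ggmCircuit (List.ofFn k, List.ofFn x)).run n ρ = ggmChannel n (keyBlocks m k) x ρ := by
  ext u v
  show (traceAncillas (n := n) (a := 0) (gatesOp n 0 _ * withAncillas ρ *
    (gatesOp n 0 _).conjTranspose)) u v =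
    (zPrefix n (ggmMask (keyBlocks m k) x) * ρ *
      (zPrefix n (ggmMask (keyBlocks m k) x)).conjTranspose) u v
  rw [gatesOp_ggmCircuit h, zPrefix_eq_diagonal h, traceAncillas, Matrix.of_apply,
    Fintype.sum_subsingleton _ (Fin.elim0 : Bits 0), Matrix.diagonal_conjTranspose,
    Matrix.diagonal_conjTranspose, Matrix.mul_diagonal, Matrix.mul_diagonal, Matrix.diagonal_mul,
    Matrix.diagonal_mul, withAncillas, Matrix.of_apply,
    if_pos ⟨fun j => j.elim0, fun j => j.elim0⟩]
  rfl

/-! ### State generation -/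

lemma zPrefix_mem_unitary {b n : ℕ} (h : b ≤ n) (s : Bits b) :
    (zPrefix n s).conjTranspose * zPrefix n s = 1 := by
  rw [zPrefix_eq_diagonal h, Matrix.diagonal_conjTranspose, Matrix.diagonal_mul_diagonal,
    ← Matrix.diagonal_one]
  congr 1
  ext z
  simp only [Pi.star_apply, Complex.star_def, Complex.conj_ofReal]
  exact_mod_cast chi_mul_self h s z

lemma isChannel_conjBy {ι : Type} [Fintype ι] [DecidableEq ι] {U : Op ι}
    (hU : U.conjTranspose * U = 1) : IsChannel (conjBy U) := by
  refine ⟨fun ρ => ?_, fun d X hX => ?_⟩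
  · show (U * ρ * U.conjTranspose).trace = ρ.trace
    rw [Matrix.trace_mul_comm, ← Matrix.mul_assoc, hU, Matrix.one_mul]
  -- The ampliation of a conjugation is the conjugation by `1 ⊗ U`.
  · let V : Op (Fin d × ι) := (1 : Op (Fin d)) ⊗ₖ U
    convert hX.mul_mul_conjTranspose_same V
    ext ⟨p, i⟩ ⟨q, j⟩
    show (U * (Matrix.of fun i j => X (p, i) (q, j)) * U.conjTranspose) i j = _
    simp only [V, Matrix.mul_apply, Matrix.conjTranspose_apply, Matrix.kronecker_apply,
      Fintype.sum_prod_type, Matrix.of_apply, Matrix.one_apply]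
    rw [Finset.sum_eq_single q (fun a _ ha => by simp [ha.symm]) (by simp)]
    simp

lemma ggmChannel_ketbra_pure {m b n : ℕ} (h : b ≤ n) (K : BlockKey m b) (y : Bits m)
    (θ : PureState n) : ∃ θ' : PureState n, ggmChannel n K y (ketbra θ) = ketbra θ' := by
  have hc : ∀ z, ‖(chi h (ggmMask K y) z : ℂ)‖ = 1 := fun z => by
    have h1 := congrArg (fun r : ℝ => ‖(r : ℂ)‖) (chi_mul_self h (ggmMask K y) z)
    simp only [Complex.ofReal_mul, norm_mul, Complex.ofReal_one, norm_one] at h1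
    nlinarith [norm_nonneg (chi h (ggmMask K y) z : ℂ)]
  let c : Bits n → Circle := fun z =>
    ⟨(chi h (ggmMask K y) z : ℂ), mem_sphere_zero_iff_norm.2 (hc z)⟩
  refine ⟨PureState.apply (phaseIsometry c) θ, ?_⟩
  ext u v
  rw [ggmChannel_ketbra h, ketbra, Matrix.vecMulVec_apply, apply_phaseIsometry,
    apply_phaseIsometry, star_mul']
  have hs : ∀ z, star ((c z : Circle) : ℂ) = (chi h (ggmMask K y) z : ℂ) := fun z =>
    Complex.conj_ofReal _
  rw [hs]
  show _ = (chi h (ggmMask K y) u : ℂ) * θ.1 u * (chi h (ggmMask K y) v * star (θ.1 v))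
  ring

/-! ### Acceptance probabilities -/

lemma acceptProb_eq_sum {ι : Type} [Fintype ι] (M ρ : Op ι) :
    acceptProb M ρ = ∑ u, ∑ v, (M u v * ρ v u).re := by
  simp only [acceptProb, Matrix.trace, Matrix.diag_apply, Matrix.mul_apply, Complex.re_sum]

lemma integral_acceptProb {Ω ι : Type} [Fintype ι] [MeasurableSpace Ω] {μ : Measure Ω} (M : Op ι)
    (f : Ω → Op ι) (hf : ∀ u v, Integrable (fun ω => f ω u v) μ) :
    ∫ ω, acceptProb M (f ω) ∂μ = acceptProb M (Matrix.of fun u v => ∫ ω, f ω u v ∂μ) := by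
  have hi : ∀ u v, Integrable (fun ω => (M u v * f ω v u).re) μ := fun u v =>
    ((hf v u).const_mul _).re
  simp only [acceptProb_eq_sum]
  rw [integral_finsetSum _ fun u _ => integrable_finsetSum _ fun v _ => hi u v]
  refine Finset.sum_congr rfl fun u _ => ?_
  rw [integral_finsetSum _ fun v _ => hi u v]
  refine Finset.sum_congr rfl fun v _ => ?_
  rw [Matrix.of_apply, ← integral_const_mul]
  exact integral_re ((hf v u).const_mul _)

lemma expect_acceptProb {κ ι : Type} [Fintype ι] [Fintype κ] (M : Op ι) (f : κ → Op ι) :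
    𝔼 K, acceptProb M (f K) = acceptProb M (Matrix.of fun u v => 𝔼 K, f K u v) := by
  have h : (Matrix.of fun u v => 𝔼 K, f K u v) = ((Fintype.card κ : ℝ)⁻¹ : ℂ) • ∑ K, f K := by
    ext u v
    simp [Finset.expect_eq_sum_div_card, Matrix.sum_apply, div_eq_inv_mul]
  rw [h, acceptProb, Matrix.mul_smul, Matrix.trace_smul, Matrix.mul_sum, Matrix.trace_sum,
    smul_eq_mul, ← Complex.ofReal_inv, Complex.re_ofReal_mul, Complex.re_sum,
    Finset.expect_eq_sum_div_card, div_eq_inv_mul, Finset.card_univ]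
  rfl

lemma integrable_realState {m b n ℓ : ℕ} (h : b ≤ n) (K : BlockKey m b) (x : Fin ℓ → Bits m)
    (t : ℕ) (u v : (Fin ℓ → Bits n) × (Fin t → Bits n)) :
    Integrable (fun θ => realState (ggmChannel n K) x t θ u v) (haar n) := by
  simp only [realState_apply h]
  exact (integrable_of_continuous
    ((isEnsemble_haar (Fin ℓ ⊕ Fin t) n).continuous_integrand _ _)).const_mul _

lemma integrable_idealState {m n ℓ : ℕ} (x : Fin ℓ → Bits m) (t : ℕ)
    (u v : (Fin ℓ → Bits n) × (Fin t → Bits n)) :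
    Integrable (fun p => idealState x t p.1 p.2 u v) (haarFamily m n) := by
  have h : (fun p => idealState x t p.1 p.2 u v) = fun p : (Bits m → PureState n) × PureState n =>
      ∏ j, ((idealFamily n x t j p).1 (joinEquiv ℓ t n u j) *
        star ((idealFamily n x t j p).1 (joinEquiv ℓ t n v j))) := by
    ext p
    rw [Fintype.prod_sum_type]
    rfl
  rw [h]
  exact integrable_of_continuous ((isEnsemble_idealFamily n x t).continuous_integrand _ _)

lemma idealProb_eq {m n ℓ : ℕ} (x : Fin ℓ → Bits m) (t : ℕ)
    (M : Op ((Fin ℓ → Bits n) × (Fin t → Bits n))) :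
    idealProb x t M = acceptProb M (idealAverage n x t) :=
  integral_acceptProb M _ (integrable_idealState x t)

/-! ### Uniform keys have uniform blocks -/

lemma block_index_injective {lam m : ℕ} :
    Function.Injective fun p : Bool × Fin m × Fin (lam / (2 * m)) =>
      (⟨(p.1.toNat * m + p.2.1.val) * (lam / (2 * m)) + p.2.2.val,
        block_index_lt p.1 p.2.1 p.2.2⟩ : Fin lam) := by
  rintro ⟨c, i, j⟩ ⟨c', i', j'⟩ h
  simp only [Fin.mk.injEq] at h
  have h1 := congrArg (· / (lam / (2 * m))) h
  have h2 := congrArg (· % (lam / (2 * m))) h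
  simp only [mul_comm _ (lam / (2 * m)), Nat.mul_add_mod, Nat.mod_eq_of_lt j.2,
    Nat.mod_eq_of_lt j'.2] at h2
  simp only [mul_comm _ (lam / (2 * m)), Nat.mul_add_div j.pos, Nat.div_eq_of_lt j.2,
    Nat.div_eq_of_lt j'.2, add_zero] at h1
  have hi := i.2
  have hi' := i'.2
  have hj : j = j' := Fin.ext h2
  cases c <;> cases c' <;> simp at h1 <;>
    first
    | omega
    | simp [Fin.ext_iff, h1, hj]

lemma exists_keyBlocks_eq {lam m : ℕ} (K : BlockKey m (lam / (2 * m))) :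
    ∃ k : Bits lam, keyBlocks m k = K := by
  refine ⟨Function.extend (fun p : Bool × Fin m × Fin (lam / (2 * m)) =>
      (⟨(p.1.toNat * m + p.2.1.val) * (lam / (2 * m)) + p.2.2.val,
        block_index_lt p.1 p.2.1 p.2.2⟩ : Fin lam)) (fun p => K p.1 p.2.1 p.2.2)
      fun _ => false, ?_⟩
  ext c i j
  exact block_index_injective.extend_apply _ _ (c, i, j)

/-- The involution `K ↦ K ⊕ L`. -/
def xorKey {κ : Type} (k' k : κ → Bool) : κ → Bool := fun i => xor (k i) (k' i)

lemma xorKey_involutive {κ : Type} (k' : κ → Bool) : Function.Involutive (xorKey k') := fun k => by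
  ext i
  simp [xorKey]

/-- The blockwise involution `K ↦ K ⊕ L`. -/
def xorBlocks {m b : ℕ} (K' K : BlockKey m b) : BlockKey m b :=
  fun c i j => xor (K c i j) (K' c i j)

lemma xorBlocks_comm {m b : ℕ} (K' K : BlockKey m b) : xorBlocks K' K = xorBlocks K K' := by
  ext c i j
  simp [xorBlocks, Bool.xor_comm]

lemma xorBlocks_involutive {m b : ℕ} (K' : BlockKey m b) :
    Function.Involutive (xorBlocks K') := fun K => by
  ext c i j
  simp [xorBlocks]

/-- Every block shift lifts to a shift of the whole key, so the left side is unchanged by shifting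
blocks. Averaging over all shifts and exchanging the averages makes the blocks uniform without
counting fibres. -/
lemma expect_keyBlocks {lam m : ℕ} (F : BlockKey m (lam / (2 * m)) → ℝ) :
    𝔼 k : Bits lam, F (keyBlocks m k) = 𝔼 K, F K := by
  have h1 : ∀ K', 𝔼 k : Bits lam, F (xorBlocks K' (keyBlocks m k)) =
      𝔼 k : Bits lam, F (keyBlocks m k) := by
    intro K'
    obtain ⟨k', rfl⟩ := exists_keyBlocks_eq K'
    exact Fintype.expect_equiv (xorKey_involutive k').toPerm _ _ fun k => rfl
  calc 𝔼 k : Bits lam, F (keyBlocks m k)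
      = 𝔼 K' : BlockKey m (lam / (2 * m)), 𝔼 k : Bits lam, F (xorBlocks K' (keyBlocks m k)) := by
        simp only [h1]
        rw [Fintype.expect_const]
    _ = 𝔼 k : Bits lam, 𝔼 K' : BlockKey m (lam / (2 * m)), F (xorBlocks K' (keyBlocks m k)) :=
        Finset.expect_comm _ _ _
    _ = 𝔼 _k : Bits lam, 𝔼 K, F K := by
        refine Finset.expect_congr rfl fun k _ => ?_
        refine Fintype.expect_equiv (xorBlocks_involutive (keyBlocks m k)).toPerm _ _ fun K' => ?_
        rw [xorBlocks_comm]
        rfl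
    _ = _ := by rw [Fintype.expect_const]

/-- The generator of the construction. -/
def ggmGenerator (m n : ℕ → ℕ) : Generator m n :=
  fun lam k x => ggmChannel (n lam) (keyBlocks (m lam) k) x

lemma realProb_ggmGenerator {m n : ℕ → ℕ} {lam ℓ : ℕ} (h : lam / (2 * m lam) ≤ n lam)
    (x : Fin ℓ → Bits (m lam)) (t : ℕ)
    (M : Op ((Fin ℓ → Bits (n lam)) × (Fin t → Bits (n lam)))) :
    realProb (ggmGenerator m n) lam x t M =
      acceptProb M (ggmRealAverage (lam / (2 * m lam)) (n lam) x t) := by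
  rw [realProb]
  have h1 : ∀ k : Bits lam,
      ∫ θ, acceptProb M (realState (ggmGenerator m n lam k) x t θ) ∂haar (n lam) =
      acceptProb M (Matrix.of fun u v =>
        ∫ θ, realState (ggmChannel (n lam) (keyBlocks (m lam) k)) x t θ u v ∂haar (n lam)) :=
    fun k => integral_acceptProb M _ (integrable_realState h (keyBlocks (m lam) k) x t)
  simp only [h1]
  rw [expect_keyBlocks fun K => acceptProb M (Matrix.of fun u v =>
        ∫ θ, realState (ggmChannel (n lam) K) x t θ u v ∂haar (n lam)), expect_acceptProb]
  rfl

lemma abs_realProb_sub_idealProb_le {m n : ℕ → ℕ} {lam ℓ : ℕ} (hm : 1 ≤ m lam)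
    (h : lam / (2 * m lam) ≤ n lam) (x : Fin ℓ → Bits (m lam)) (t : ℕ)
    {M : Op ((Fin ℓ → Bits (n lam)) × (Fin t → Bits (n lam)))} (hM : IsEffect M) :
    |realProb (ggmGenerator m n) lam x t M - idealProb x t M| ≤
      24 * ((ℓ : ℝ) + t) ^ (2 * ℓ) / 2 ^ (lam / (2 * m lam)) := by
  obtain ⟨A, B, hA, hB, hAB, htr⟩ := exists_posSemidef_ggm_sub_ideal_le hm h x t
  rw [realProb_ggmGenerator h, idealProb_eq]
  have h1 : acceptProb M (ggmRealAverage (lam / (2 * m lam)) (n lam) x t) -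
      acceptProb M (idealAverage (n lam) x t) = acceptProb M (A - B) := by
    rw [← hAB]
    simp [acceptProb, Matrix.mul_sub]
  rw [h1]
  exact (abs_acceptProb_sub_le hM hA hB).trans htr

lemma isQPT_ggmGenerator {m n : ℕ → ℕ} (h : ∀ lam, lam / (2 * m lam) ≤ n lam) :
    IsQPT (ggmGenerator m n) :=
  ⟨ggmCircuit, ⟨Machine.computableInPolyTime⟩, fun lam k x =>
    ⟨ggmCircuit_wellFormed (h lam) k x, fun ρ => (run_ggmCircuit (h lam) k x ρ).symm⟩⟩

lemma stateGeneration_ggmGenerator {m n : ℕ → ℕ} (h : ∀ lam, lam / (2 * m lam) ≤ n lam) :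
    StateGeneration (ggmGenerator m n) := fun lam _ x =>
  ⟨isChannel_conjBy (zPrefix_mem_unitary (h lam) _), fun θ => ggmChannel_ketbra_pure (h lam) _ x θ⟩

/-! ### Asymptotics of the parameters -/

section Parameters

variable {c : ℝ} {lam m : ℕ}

lemma one_le_rpow_natCast (hc : 0 ≤ c) (hlam : 1 ≤ lam) : 1 ≤ (lam : ℝ) ^ c :=
  Real.one_le_rpow (by exact_mod_cast hlam) hc

lemma one_le_of_eq_floor_or_ceil (hc : 0 ≤ c) (hlam : 1 ≤ lam)
    (hm : m = ⌊(lam : ℝ) ^ c⌋₊ ∨ m = ⌈(lam : ℝ) ^ c⌉₊) : 1 ≤ m := by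
  have h1 := one_le_rpow_natCast hc hlam
  rcases hm with rfl | rfl
  · exact (Nat.one_le_floor_iff _).2 h1
  · exact Nat.one_le_ceil_iff.2 (by linarith)

lemma rpow_le_two_mul_of_eq_floor_or_ceil (hc : 0 ≤ c) (hlam : 1 ≤ lam)
    (hm : m = ⌊(lam : ℝ) ^ c⌋₊ ∨ m = ⌈(lam : ℝ) ^ c⌉₊) : (lam : ℝ) ^ c ≤ 2 * m := by
  have h1 : (1 : ℝ) ≤ m := by exact_mod_cast one_le_of_eq_floor_or_ceil hc hlam hm
  rcases hm with rfl | rfl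
  · have := Nat.lt_floor_add_one ((lam : ℝ) ^ c)
    linarith
  · have := Nat.le_ceil ((lam : ℝ) ^ c)
    linarith

lemma le_two_mul_rpow_of_eq_floor_or_ceil (hc : 0 ≤ c) (hlam : 1 ≤ lam)
    (hm : m = ⌊(lam : ℝ) ^ c⌋₊ ∨ m = ⌈(lam : ℝ) ^ c⌉₊) : (m : ℝ) ≤ 2 * (lam : ℝ) ^ c := by
  have h1 := one_le_rpow_natCast hc hlam
  rcases hm with rfl | rfl
  · have := Nat.floor_le (zero_le_one.trans h1)
    linarith
  · have := Nat.ceil_lt_add_one (zero_le_one.trans h1)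
    linarith

lemma rpow_mul_rpow_one_sub (hlam : 1 ≤ lam) : (lam : ℝ) ^ c * (lam : ℝ) ^ (1 - c) = lam := by
  rw [← Real.rpow_add (by exact_mod_cast hlam), add_sub_cancel, Real.rpow_one]

lemma block_length_le (hc : 0 ≤ c) {n : ℕ}
    (hm : m = ⌊(lam : ℝ) ^ c⌋₊ ∨ m = ⌈(lam : ℝ) ^ c⌉₊) (hn : (lam : ℝ) ^ (1 - c) ≤ n) :
    lam / (2 * m) ≤ n := by
  rcases Nat.eq_zero_or_pos lam with rfl | hlam
  · simp
  have hX : 0 ≤ (lam : ℝ) ^ (1 - c) := by positivity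
  have h2 := rpow_le_two_mul_of_eq_floor_or_ceil hc hlam hm
  have h3 : (lam : ℝ) ≤ 2 * m * n := by
    rw [← rpow_mul_rpow_one_sub (c := c) hlam]
    exact mul_le_mul h2 hn hX (by positivity)
  exact Nat.div_le_of_le_mul (by exact_mod_cast h3)

lemma rpow_div_four_le_block_length (hc : 0 ≤ c) (hlam : 1 ≤ lam)
    (hm : m = ⌊(lam : ℝ) ^ c⌋₊ ∨ m = ⌈(lam : ℝ) ^ c⌉₊) :
    (lam : ℝ) ^ (1 - c) / 4 ≤ ((lam / (2 * m) : ℕ) : ℝ) + 1 := by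
  have h1 := one_le_of_eq_floor_or_ceil hc hlam hm
  have h2 := le_two_mul_rpow_of_eq_floor_or_ceil hc hlam hm
  have h0 := one_le_rpow_natCast hc hlam
  have h3 : (lam : ℝ) ≤ 2 * m * (((lam / (2 * m) : ℕ) : ℝ) + 1) := by
    exact_mod_cast (Nat.lt_mul_div_succ lam (by omega : 0 < 2 * m)).le
  have h4 : (lam : ℝ) ^ c * (lam : ℝ) ^ (1 - c) ≤
      (lam : ℝ) ^ c * (4 * (((lam / (2 * m) : ℕ) : ℝ) + 1)) := by
    rw [rpow_mul_rpow_one_sub hlam]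
    refine h3.trans ?_
    rw [← mul_assoc]
    exact mul_le_mul_of_nonneg_right (by linarith) (by positivity)
  have h5 := le_of_mul_le_mul_left h4 (by linarith)
  linarith

/-- The factor 2 pays for the unit lost by rounding the block length down. -/
lemma inv_two_pow_block_length_le (hc : 0 ≤ c) (hlam : 1 ≤ lam)
    (hm : m = ⌊(lam : ℝ) ^ c⌋₊ ∨ m = ⌈(lam : ℝ) ^ c⌉₊) :
    ((2 : ℝ) ^ (lam / (2 * m)))⁻¹ ≤ 2 * Real.exp (-(Real.log 2 / 4 * (lam : ℝ) ^ (1 - c))) := by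
  have h := rpow_div_four_le_block_length hc hlam hm
  have hlog : 0 < Real.log 2 := Real.log_pos one_lt_two
  have h2 : ∀ k : ℕ, (2 : ℝ) ^ k = Real.exp (k * Real.log 2) := fun k => by
    rw [Real.exp_nat_mul, Real.exp_log two_pos]
  rw [h2, ← Real.exp_neg]
  nth_rewrite 2 [← Real.exp_log (two_pos : (0 : ℝ) < 2)]
  rw [← Real.exp_add, Real.exp_le_exp]
  nlinarith

end Parameters

/-! ### Growth of the query term and negligibility -/

lemma eventually_eval_add_le_pow (p : Polynomial ℕ) :
    ∀ᶠ lam : ℕ in atTop, lam + p.eval lam ≤ lam ^ (p.natDegree + 2) := by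
  filter_upwards [eventually_ge_atTop (p.eval 1 + 1)] with lam hlam
  have h1 : 1 ≤ lam := by omega
  -- `p.eval 1` is the sum of the coefficients; one further power of `lam` absorbs the constant
  -- `p.eval 1 + 1`.
  have h2 : p.eval lam ≤ p.eval 1 * lam ^ (p.natDegree + 1) := by
    rw [Polynomial.eval_eq_sum_range, Polynomial.eval_eq_sum_range, Finset.sum_mul]
    refine Finset.sum_le_sum fun i hi => ?_
    rw [one_pow, mul_one]
    exact Nat.mul_le_mul_left _ (Nat.pow_le_pow_right h1 (Finset.mem_range.1 hi).le)
  calc lam + p.eval lam ≤ lam ^ (p.natDegree + 1) + p.eval 1 * lam ^ (p.natDegree + 1) :=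
        add_le_add (Nat.le_self_pow (by omega) lam) h2
    _ = (p.eval 1 + 1) * lam ^ (p.natDegree + 1) := by ring
    _ ≤ lam * lam ^ (p.natDegree + 1) := Nat.mul_le_mul_right _ hlam
    _ = lam ^ (p.natDegree + 2) := by ring

lemma tendsto_log_natCast_atTop : Tendsto (fun lam : ℕ => Real.log lam) atTop atTop :=
  Real.tendsto_log_atTop.comp tendsto_natCast_atTop_atTop

/-- Multiplying by the logarithm still leaves a spare factor `(log λ)^(-ε)`, which tends to zero. -/
lemma isLittleO_queries_mul_log {c ε : ℝ} (hε : 0 < ε) {ℓ : ℕ → ℕ}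
    (hℓ : (fun lam : ℕ => (ℓ lam : ℝ)) =O[atTop]
      (fun lam : ℕ => (lam : ℝ) ^ (1 - c) / Real.log lam ^ (1 + ε))) :
    (fun lam : ℕ => ℓ lam * Real.log lam) =o[atTop] fun lam : ℕ => (lam : ℝ) ^ (1 - c) := by
  have h1 := hℓ.mul (isBigO_refl (fun lam : ℕ => Real.log lam) atTop)
  have h2 : (fun lam : ℕ => (lam : ℝ) ^ (1 - c) / Real.log lam ^ (1 + ε) * Real.log lam) =ᶠ[atTop]
      fun lam : ℕ => (lam : ℝ) ^ (1 - c) * Real.log lam ^ (-ε) := by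
    filter_upwards [tendsto_log_natCast_atTop.eventually_gt_atTop 0] with lam hlam
    rw [Real.rpow_add hlam, Real.rpow_one, Real.rpow_neg hlam.le]
    have := (Real.rpow_pos_of_pos hlam ε).ne'
    field_simp
  have h3 : (fun lam : ℕ => Real.log lam ^ (-ε)) =o[atTop] fun _ => (1 : ℝ) :=
    (isLittleO_one_iff ℝ).2 ((tendsto_rpow_neg_atTop hε).comp tendsto_log_natCast_atTop)
  refine (h1.congr' EventuallyEq.rfl h2).trans_isLittleO ?_
  simpa using (isBigO_refl (fun lam : ℕ => (lam : ℝ) ^ (1 - c)) atTop).mul_isLittleO h3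

/-- The base is at most a fixed power `λ^D`, so the left side is at most `exp(2D ℓ log λ)`, and this
exponent is `o(λ^(1-c))`. -/
lemma eventually_pow_queries_le {c ε : ℝ} (hc : 0 ≤ c) (hε : 0 < ε) {ℓ t : ℕ → ℕ}
    (hℓ : (fun lam : ℕ => (ℓ lam : ℝ)) =O[atTop]
      (fun lam : ℕ => (lam : ℝ) ^ (1 - c) / Real.log lam ^ (1 + ε)))
    (ht : PolyBounded t) {δ : ℝ} (hδ : 0 < δ) :
    ∀ᶠ lam : ℕ in atTop, ((ℓ lam : ℝ) + t lam) ^ (2 * ℓ lam) ≤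
      Real.exp (δ * (lam : ℝ) ^ (1 - c)) := by
  obtain ⟨p, hp⟩ := ht
  have ho := isLittleO_queries_mul_log hε hℓ
  set D := p.natDegree + 2
  have hD : 0 < (2 * D : ℝ) := by positivity
  filter_upwards [eventually_eval_add_le_pow p, ho.bound one_pos, ho.bound (div_pos hδ hD),
    tendsto_log_natCast_atTop.eventually_ge_atTop 1, eventually_ge_atTop 1]
    with lam h1 h2 h3 h4 hlam
  have hlam' : (1 : ℝ) ≤ lam := by exact_mod_cast hlam
  have hX : 0 ≤ (lam : ℝ) ^ (1 - c) := by positivity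
  have hnn : 0 ≤ ℓ lam * Real.log lam := by positivity
  rw [Real.norm_of_nonneg hX, Real.norm_of_nonneg hnn] at h2 h3
  have h5 : (lam : ℝ) ^ (1 - c) ≤ lam := by
    conv_rhs => rw [← Real.rpow_one (lam : ℝ)]
    exact Real.rpow_le_rpow_of_exponent_le hlam' (by linarith)
  have h6 : (ℓ lam : ℝ) ≤ lam := by
    nlinarith [(Nat.cast_nonneg (ℓ lam) : (0 : ℝ) ≤ ℓ lam)]
  have h7 : (ℓ lam : ℝ) + t lam ≤ (lam : ℝ) ^ D := by
    have h8 : (t lam : ℝ) ≤ (p.eval lam : ℕ) := by exact_mod_cast hp lam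
    have h9 : (lam : ℝ) + (p.eval lam : ℕ) ≤ (lam : ℝ) ^ D := by exact_mod_cast h1
    linarith
  calc ((ℓ lam : ℝ) + t lam) ^ (2 * ℓ lam) ≤ ((lam : ℝ) ^ D) ^ (2 * ℓ lam) :=
        pow_le_pow_left₀ (by positivity) h7 _
    _ = Real.exp (2 * D * (ℓ lam * Real.log lam)) := by
        rw [← pow_mul, ← Real.exp_log (pow_pos (zero_lt_one.trans_le hlam') (D * (2 * ℓ lam))),
          Real.log_pow]
        push_cast
        ring_nf
    _ ≤ Real.exp (δ * (lam : ℝ) ^ (1 - c)) := by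
        rw [Real.exp_le_exp]
        calc 2 * D * (ℓ lam * Real.log lam) ≤ 2 * D * (δ / (2 * D) * (lam : ℝ) ^ (1 - c)) :=
              mul_le_mul_of_nonneg_left h3 hD.le
          _ = δ * (lam : ℝ) ^ (1 - c) := by
            rw [← mul_assoc, mul_div_cancel₀ _ hD.ne']

lemma negligible_exp_neg_rpow {a δ : ℝ} (ha : 0 < a) (hδ : 0 < δ) :
    Negligible fun lam : ℕ => Real.exp (-(δ * (lam : ℝ) ^ a)) := by
  intro k
  have h1 := (tendsto_rpow_mul_exp_neg_mul_atTop_nhds_zero (k / a) δ hδ).comp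
    ((tendsto_rpow_atTop ha).comp tendsto_natCast_atTop_atTop)
  refine h1.congr fun lam => ?_
  simp only [Function.comp_apply]
  rw [← Real.rpow_mul (Nat.cast_nonneg lam), mul_div_cancel₀ _ ha.ne', Real.rpow_natCast, neg_mul]

lemma selectivelySecure_ggmGenerator {c ε : ℝ} (hc : 0 ≤ c) (hc1 : c < 1) (hε : 0 < ε)
    {m n ℓ : ℕ → ℕ}
    (hm : ∀ lam : ℕ, m lam = ⌊(lam : ℝ) ^ c⌋₊ ∨ m lam = ⌈(lam : ℝ) ^ c⌉₊)
    (hn : ∀ lam : ℕ, (lam : ℝ) ^ (1 - c) ≤ n lam)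
    (hℓ : (fun lam : ℕ => (ℓ lam : ℝ)) =O[atTop]
      (fun lam : ℕ => (lam : ℝ) ^ (1 - c) / Real.log lam ^ (1 + ε))) :
    SelectivelySecure ℓ (ggmGenerator m n) := by
  intro t ht A hA x
  -- The advantage itself serves as the negligible function, so an estimate for large `lam` is
  -- enough.
  refine ⟨_, ?_, fun lam => le_rfl⟩
  -- Half of the decay rate `log 2 / 4` of `2^(-b)` is spent on the growth of the query term; the
  -- other half remains.
  have hlog : 0 < Real.log 2 / 8 := div_pos (Real.log_pos one_lt_two) (by norm_num)
  refine ((negligible_exp_neg_rpow (sub_pos.2 hc1) hlog).const_mul 48).trans_eventually_abs_le ?_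
  filter_upwards [eventually_pow_queries_le hc hε hℓ ht hlog, eventually_ge_atTop 1]
    with lam h1 hlam
  have h2 := abs_realProb_sub_idealProb_le (one_le_of_eq_floor_or_ceil hc hlam (hm lam))
    (block_length_le hc (hm lam) (hn lam)) (x lam) (t lam) (hA lam (x lam))
  have h3 := inv_two_pow_block_length_le hc hlam (hm lam)
  simp only [Function.comp_apply, abs_abs]
  refine h2.trans (le_trans ?_ (le_abs_self _))
  rw [div_eq_mul_inv]
  calc 24 * ((ℓ lam : ℝ) + t lam) ^ (2 * ℓ lam) * ((2 : ℝ) ^ (lam / (2 * m lam)))⁻¹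
      ≤ 24 * Real.exp (Real.log 2 / 8 * (lam : ℝ) ^ (1 - c)) *
          (2 * Real.exp (-(Real.log 2 / 4 * (lam : ℝ) ^ (1 - c)))) := by gcongr
    _ = 48 * Real.exp (-(Real.log 2 / 8 * (lam : ℝ) ^ (1 - c))) := by
        rw [mul_mul_mul_comm, ← Real.exp_add]
        ring_nf

end CHS

end

open CHS in
theorem mainTheorem2 :
    (∃ C : ℝ, 0 < C ∧ ∀ m b n ℓ t : ℕ, 1 ≤ m → b ≤ n → ∀ x : Fin ℓ → Bits m,
      traceDist (ggmRealAverage b n x t) (idealAverage n x t) ≤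
        C * ((ℓ : ℝ) + t) ^ (2 * ℓ) / 2 ^ b) ∧
    ∀ c : ℝ, 0 ≤ c → c < 1 → ∀ m n : ℕ → ℕ,
      (∀ lam : ℕ, m lam = ⌊(lam : ℝ) ^ c⌋₊ ∨ m lam = ⌈(lam : ℝ) ^ c⌉₊) →
      (∀ lam : ℕ, (lam : ℝ) ^ (1 - c) ≤ n lam) →
      ∃ G : Generator m n,
        (∀ (lam : ℕ) (k : Bits lam) (x : Bits (m lam)),
          lam / (2 * m lam) ≤ n lam ∧
          G lam k x = ggmChannel (n lam) (keyBlocks (m lam) k) x) ∧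
        ∀ ε : ℝ, 0 < ε → ∀ ℓ : ℕ → ℕ,
          (fun lam : ℕ => (ℓ lam : ℝ)) =O[atTop]
            (fun lam : ℕ => (lam : ℝ) ^ (1 - c) / Real.log lam ^ (1 + ε)) →
          IsStatisticalPRFS m n ℓ G := by
  refine ⟨⟨12, by norm_num, fun m b n ℓ t hm h x => traceDist_ggm_ideal_le hm h x t⟩,
    fun c hc hc1 m n hm hn => ?_⟩
  have h : ∀ lam, lam / (2 * m lam) ≤ n lam := fun lam => block_length_le hc (hm lam) (hn lam)
  exact ⟨ggmGenerator m n, fun lam _ _ => ⟨h lam, rfl⟩, fun ε hε ℓ hℓ =>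
    ⟨isQPT_ggmGenerator h, stateGeneration_ggmGenerator h,
      selectivelySecure_ggmGenerator hc hc1 hε hm hn hℓ⟩⟩
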